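/- Let $\ell$ be a prime number. For a number field $F$ and a place $w$ of $F$ (finite or infinite) let $\mathcal R_{F_w}=\varprojlim_n F_w^\times/F_w^{\times \ell^n}$, and let $\mathcal U_{F_w}\subset\mathcal R_{F_w}$ be the image of the $\ell$-adification $\varprojlim_n U_w/U_w^{\ell^n}$ of the unit group $U_w$ of $F_w$, where $U_w$ is the group of elements of absolute value $1$ if $w$ is finite, $U_w=\mathbb R_{>0}$ if $w$ is real and $U_w=\mathbb C^\times$ if $w$ is complex. Let $\mathcal J(F)=\prod_w^{\mathrm{res}}\mathcal R_{F_w}$ be the restricted product with respect to the $\mathcal U_{F_w}$, and let $\mathcal R(F)=\mathbb Z_\ell\otimes_{\mathbb Z}F^\times$, with its canonical map to $\mathcal J(F)$. For disjoint finite sets $S,T$ of places of $F$ put $\mathcal J^T(F)=\prod^{\mathrm{res}}_{w\notin T}\mathcal R_{F_w}$ (viewed as the ideles that are trivial at $T$), $\mathcal J^T_S(F)=\prod_{w\in S}\mathcal R_{F_w}\prod_{w\notin S\cup T}\mathcal U_{F_w}$, and let $\mathcal R^T(F)$ be the group of elements of $\mathcal R(F)$ whose idele lies in $\mathcal J^T(F)$.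 Define - $\mathcal D^T_S(F)=\mathcal J^T(F)/\mathcal J^T_S(F)$, the $\ell$-group of $S$-divisors prime to $T$; - $\mathcal P^T_S(F)$, the image of $\mathcal R^T(F)$ in $\mathcal D^T_S(F)$; - $\mathcal Cl^T_S(F)=\mathcal D^T_S(F)/\mathcal P^T_S(F)$, the $\ell$-group of $T$-infinitesimal $S$-classes, with projection $cl^T_S:\mathcal D^T_S(F)\to\mathcal Cl^T_S(F)$; - $\mathcal E^T_S(F)=\{x\in\mathcal R^T(F) : \text{the idele of } x \text{ lies in } \mathcal J^T_S(F)\}$, the group of $T$-infinitesimal $S$-units. **Proposition.** Let $N/K$ be a cyclic extension of number fields whose degree is a power of $\ell$, with Galois group $\Gamma$, and let $S$ and $T$ be disjoint finite sets of places of $K$. Write again $S$ and $T$ for the sets of places of $N$ above them, and let $N_{N/K}:\mathcal R(N)\to\mathcal R(K)$ be the $\mathbb Z_\ell$-linear extension of the norm $N^\times\to K^\times$. Then there is an isomorphism of $\mathbb Z_\ell$-modules $$\mathcal Cl^T_S(N)^\Gamma\big/cl^T_S\big(\mathcal D^T_S(N)^\Gamma\big)\;\simeq\;\big(\mathcal E^T_S(K)\cap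 N_{N/K}(\mathcal R(N))\big)\big/N_{N/K}\big(\mathcal E^T_S(N)\big).$$ -/

import Mathlib

open scoped TensorProduct NumberField

set_option linter.unusedSectionVars false

noncomputable section

namespace LadicClass

/-! ### The `ℓ`-adification `lim A / ℓⁿ A` of an abelian group -/

section EllAdic

variable (ℓ : ℕ) [Fact ℓ.Prime]

/-- `A / ℓⁿ A`. -/
def Level (A : Type*) [AddCommGroup A] (n : ℕ) : Type _ :=
  A ⧸ (nsmulAddMonoidHom (ℓ ^ n) : A →+ A).range

namespace Level

variable (A : Type*) [AddCommGroup A] {B C : Type*} [AddCommGroup B] [AddCommGroup C] (n : ℕ)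

instance : AddCommGroup (Level ℓ A n) :=
  inferInstanceAs (AddCommGroup (A ⧸ (nsmulAddMonoidHom (ℓ ^ n) : A →+ A).range))

/-- The projection `A → A / ℓⁿ A`. -/
def mk : A →+ Level ℓ A n := QuotientAddGroup.mk' _

variable {A} in
theorem mk_surjective : Function.Surjective (mk ℓ A n) := QuotientAddGroup.mk'_surjective _

variable {A} in
theorem mk_eq_zero_iff (a : A) : mk ℓ A n a = 0 ↔ ∃ b : A, ℓ ^ n • b = a :=
  (QuotientAddGroup.eq_zero_iff a).trans AddMonoidHom.mem_range

instance : Module (ZMod (ℓ ^ n)) (Level ℓ A n) :=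
  AddCommGroup.zmodModule (by
    intro x
    obtain ⟨a, rfl⟩ := mk_surjective ℓ n x
    rw [← map_nsmul]
    exact (mk_eq_zero_iff ℓ n _).2 ⟨a, rfl⟩)

/-- `ℤ_ℓ` acts on `A / ℓⁿ A` through `ℤ_ℓ → ℤ / ℓⁿ`. -/
instance : Module ℤ_[ℓ] (Level ℓ A n) := Module.compHom _ (PadicInt.toZModPow (p := ℓ) n)

variable {A}

theorem padic_smul_def (z : ℤ_[ℓ]) (x : Level ℓ A n) :
    z • x = (PadicInt.toZModPow (p := ℓ) n z).val • x := by
  change (PadicInt.toZModPow (p := ℓ) n z) • x = _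
  rw [← Nat.cast_smul_eq_nsmul (ZMod (ℓ ^ n)), ZMod.natCast_zmod_val]

/-- The map `A / ℓⁿ A → B / ℓⁿ B` induced by a homomorphism `A → B`. -/
def map (f : A →+ B) : Level ℓ A n →ₗ[ℤ_[ℓ]] Level ℓ B n where
  toFun := QuotientAddGroup.map _ _ f (by
    rintro _ ⟨a, rfl⟩
    exact ⟨f a, (map_nsmul f _ a).symm⟩)
  map_add' := map_add _
  map_smul' z x := by
    simp only [padic_smul_def, RingHom.id_apply]
    refine (map_nsmul (QuotientAddGroup.map (nsmulAddMonoidHom (ℓ ^ n) : A →+ A).range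
      (nsmulAddMonoidHom (ℓ ^ n) : B →+ B).range f _) _ x).trans ?_
    exact (padic_smul_def ℓ n z _).symm

@[simp] theorem map_mk (f : A →+ B) (a : A) : map ℓ n f (mk ℓ A n a) = mk ℓ B n (f a) := rfl

/-- The transition map `A / ℓⁿ⁺¹ A → A / ℓⁿ A`. -/
def trans : Level ℓ A (n + 1) →ₗ[ℤ_[ℓ]] Level ℓ A n where
  toFun := QuotientAddGroup.map _ _ (AddMonoidHom.id A) (by
    rintro _ ⟨a, rfl⟩
    exact ⟨ℓ • a, by simp [pow_succ, mul_smul]⟩)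
  map_add' := map_add _
  map_smul' z x := by
    obtain ⟨a, rfl⟩ := mk_surjective ℓ (n + 1) x
    have h : PadicInt.toZModPow (p := ℓ) n z =
        (((PadicInt.toZModPow (p := ℓ) (n + 1) z).val : ℕ) : ZMod (ℓ ^ n)) := by
      have := PadicInt.zmod_cast_comp_toZModPow (p := ℓ) n (n + 1) (Nat.le_succ n)
      rw [← this]
      simp [ZMod.natCast_val]
    rw [padic_smul_def]
    refine (map_nsmul (QuotientAddGroup.map _ _ (AddMonoidHom.id A) _) _ (mk ℓ A (n + 1) a)).trans ?_
    change _ = (PadicInt.toZModPow (p := ℓ) n z) • (mk ℓ A n a)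
    rw [h, Nat.cast_smul_eq_nsmul]
    rfl

@[simp] theorem trans_mk (a : A) : trans ℓ n (mk ℓ A (n + 1) a) = mk ℓ A n a := rfl

end Level

/-- The compatible families in `∏ A / ℓⁿ A`. -/
def compatibleFamilies (A : Type*) [AddCommGroup A] : Submodule ℤ_[ℓ] (∀ n, Level ℓ A n) where
  carrier := {x | ∀ n, Level.trans ℓ n (x (n + 1)) = x n}
  add_mem' hx hy n := by simp [hx n, hy n]
  zero_mem' n := by simp
  smul_mem' z x hx n := by simp [hx n]

/-- The `ℓ`-adification `lim A / ℓⁿ A` of an (additively written) abelian group `A`. -/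
def EllAdic (A : Type*) [AddCommGroup A] : Type _ := ↥(compatibleFamilies ℓ A)

namespace EllAdic

instance (A : Type*) [AddCommGroup A] : AddCommGroup (EllAdic ℓ A) :=
  inferInstanceAs (AddCommGroup ↥(compatibleFamilies ℓ A))

instance (A : Type*) [AddCommGroup A] : Module ℤ_[ℓ] (EllAdic ℓ A) :=
  inferInstanceAs (Module ℤ_[ℓ] ↥(compatibleFamilies ℓ A))

variable {A B C : Type*} [AddCommGroup A] [AddCommGroup B] [AddCommGroup C]

theorem ext {x y : EllAdic ℓ A} (h : ∀ n, x.1 n = y.1 n) : x = y :=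
  Subtype.ext (funext h)

variable (A) in
/-- The canonical map `A → lim A / ℓⁿ A`. -/
def of : A →+ EllAdic ℓ A where
  toFun a := ⟨fun n => Level.mk ℓ A n a, fun _ => rfl⟩
  map_zero' := ext ℓ fun n => by exact map_zero _
  map_add' a b := ext ℓ fun n => by exact map_add (Level.mk ℓ A n) a b

/-- Functoriality of the `ℓ`-adification. -/
def map (f : A →+ B) : EllAdic ℓ A →ₗ[ℤ_[ℓ]] EllAdic ℓ B where
  toFun x := ⟨fun n => Level.map ℓ n f (x.1 n), fun n => by
    obtain ⟨a, ha⟩ := Level.mk_surjective ℓ (n + 1) (x.1 (n + 1))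
    have hx := x.2 n
    rw [← ha] at hx
    simp [← ha, ← hx]⟩
  map_add' x y := ext ℓ fun n => by exact map_add (Level.map ℓ n f) _ _
  map_smul' z x := ext ℓ fun n => by exact map_smul (Level.map ℓ n f) _ _

@[simp] theorem map_of (f : A →+ B) (a : A) : map ℓ f (of ℓ A a) = of ℓ B (f a) := rfl

theorem map_map (g : B →+ C) (f : A →+ B) (x : EllAdic ℓ A) :
    map ℓ g (map ℓ f x) = map ℓ (g.comp f) x := by
  refine ext ℓ fun n => ?_
  obtain ⟨a, ha⟩ := Level.mk_surjective ℓ n (x.1 n)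
  change Level.map ℓ n g (Level.map ℓ n f (x.1 n)) = Level.map ℓ n (g.comp f) (x.1 n)
  rw [← ha]
  rfl

theorem map_id (x : EllAdic ℓ A) : map ℓ (AddMonoidHom.id A) x = x := by
  refine ext ℓ fun n => ?_
  obtain ⟨a, ha⟩ := Level.mk_surjective ℓ n (x.1 n)
  change Level.map ℓ n _ (x.1 n) = x.1 n
  rw [← ha]
  rfl

end EllAdic

end EllAdic

/-! ### Places of a number field and their completions -/

section Place

open NumberField IsDedekindDomain

/-- A place of a number field, finite or infinite, represented by its normalised absolute value. -/
def Place (K : Type*) [Field K] [NumberField K] : Type _ :=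
  {w : AbsoluteValue K ℝ // IsFinitePlace w ∨ IsInfinitePlace w}

variable {K : Type*} [Field K] [NumberField K]

theorem valuation_comap_ringEquiv (σ : K ≃+* K) (v v' : HeightOneSpectrum (𝓞 K))
    (h : v'.asIdeal = v.asIdeal.comap (RingOfIntegers.mapRingEquiv σ)) (x : K) :
    v'.valuation K x = v.valuation K (σ x) := by
  set e := RingOfIntegers.mapRingEquiv σ with he
  have key : ∀ (r : 𝓞 K) (n : ℕ), r ∈ v'.asIdeal ^ n ↔ e r ∈ v.asIdeal ^ n := by
    intro r n
    have : v'.asIdeal ^ n = (v.asIdeal ^ n).comap e := by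
      rw [h, ← Ideal.map_symm, ← Ideal.map_symm, Ideal.map_pow]
    rw [this, Ideal.mem_comap]
  have hint : ∀ r : 𝓞 K, v'.intValuation r = v.intValuation (e r) := by
    intro r
    by_cases hr : r = 0
    · simp [hr]
    have hr' : e r ≠ 0 := by simpa using hr
    have h1 : ∀ n : ℕ, v'.intValuation r ≤ WithZero.exp (-(n : ℤ)) ↔
        v.intValuation (e r) ≤ WithZero.exp (-(n : ℤ)) := by
      intro n
      rw [v'.intValuation_le_pow_iff_mem, v.intValuation_le_pow_iff_mem, key]
    apply le_antisymm
    · rw [v.intValuation_if_neg hr']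
      rw [h1, v.intValuation_if_neg hr']
    · rw [v'.intValuation_if_neg hr]
      rw [← h1, v'.intValuation_if_neg hr]
  obtain ⟨a, b, hb, rfl⟩ := IsFractionRing.div_surjective (A := 𝓞 K) x
  rw [map_div₀, map_div₀, map_div₀, HeightOneSpectrum.valuation_of_algebraMap,
    HeightOneSpectrum.valuation_of_algebraMap, hint, hint]
  have h2 : ∀ r : 𝓞 K, σ (algebraMap (𝓞 K) K r) = algebraMap (𝓞 K) K (e r) := fun r => rfl
  rw [h2, h2, HeightOneSpectrum.valuation_of_algebraMap, HeightOneSpectrum.valuation_of_algebraMap]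

theorem isFinitePlace_comp (σ : K ≃+* K) {w : AbsoluteValue K ℝ} (hw : IsFinitePlace w) :
    IsFinitePlace (w.comp (f := (σ : K →+* K)) σ.injective) := by
  obtain ⟨v, rfl⟩ := hw
  set e := RingOfIntegers.mapRingEquiv σ with he
  let v' : HeightOneSpectrum (𝓞 K) :=
    { asIdeal := v.asIdeal.comap e
      isPrime := v.isPrime.comap e
      ne_bot := by
        intro hbot
        apply v.ne_bot
        rw [← Ideal.map_symm] at hbot
        exact (Ideal.map_eq_bot_iff_of_injective e.symm.injective).1 hbot }
  refine ⟨v', ?_⟩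
  have hnorm : Ideal.absNorm v'.asIdeal = Ideal.absNorm v.asIdeal := by
    rw [Ideal.absNorm_apply, Ideal.absNorm_apply, Submodule.cardQuot_apply,
      Submodule.cardQuot_apply]
    exact Nat.card_congr (Ideal.quotientEquiv _ _ e
      (Ideal.map_comap_of_surjective _ e.surjective _).symm).toEquiv
  ext x
  change ‖FinitePlace.embedding v' x‖ = ‖FinitePlace.embedding v (σ x)‖
  rw [FinitePlace.norm_embedding', FinitePlace.norm_embedding',
    valuation_comap_ringEquiv σ v v' rfl x]
  simp only [hnorm]

theorem isInfinitePlace_comp (σ : K ≃+* K) {w : AbsoluteValue K ℝ} (hw : IsInfinitePlace w) :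
    IsInfinitePlace (w.comp (f := (σ : K →+* K)) σ.injective) := by
  obtain ⟨φ, rfl⟩ := hw
  exact ⟨φ.comp (σ : K →+* K), rfl⟩

namespace Place

/-- The place `w ∘ σ`, i.e. the conjugate of `w` by `σ⁻¹`. -/
def comap (σ : K ≃+* K) (w : Place K) : Place K :=
  ⟨w.1.comp (f := (σ : K →+* K)) σ.injective,
    w.2.imp (isFinitePlace_comp σ) (isInfinitePlace_comp σ)⟩

theorem comap_injective (σ : K ≃+* K) : Function.Injective (comap (K := K) σ) := by
  intro w w' h
  apply Subtype.ext
  ext x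
  have h1 : w.1 (σ (σ.symm x)) = w'.1 (σ (σ.symm x)) :=
    congrArg (fun u : Place K => u.1 (σ.symm x)) h
  simpa using h1

/-- The completion `K_w`. -/
abbrev Completion (w : Place K) : Type _ := w.1.Completion

theorem continuous_withAbsMap (σ : K ≃+* K) (w : Place K) :
    Continuous (WithAbs.map (comap σ w).1 w.1 (σ : K →+* K)) :=
  (AddMonoidHomClass.isometry_of_norm (WithAbs.map (comap σ w).1 w.1 (σ : K →+* K))
    (fun _ => rfl)).continuous

/-- The isomorphism `K_{w ∘ σ} → K_w` extending `σ` by continuity. -/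
def completionMap (σ : K ≃+* K) (w : Place K) : (comap σ w).Completion →+* w.Completion :=
  UniformSpace.Completion.mapRingHom
    (WithAbs.map (comap σ w).1 w.1 (σ : K →+* K)) (continuous_withAbsMap σ w)

/-- The canonical embedding `K → K_w`. -/
def embed (w : Place K) : K →+* w.Completion :=
  UniformSpace.Completion.coeRingHom.comp (WithAbs.equiv w.1).symm.toRingHom

theorem norm_completionMap (σ : K ≃+* K) (w : Place K) (x : (comap σ w).Completion) :
    ‖completionMap σ w x‖ = ‖x‖ := by
  have h : Isometry (WithAbs.map (comap σ w).1 w.1 (σ : K →+* K)) :=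
    AddMonoidHomClass.isometry_of_norm _ (fun _ => rfl)
  have := (h.completion_map).norm_map_of_map_zero (map_zero (completionMap σ w)) x
  exact this

theorem completionMap_embed (σ : K ≃+* K) (w : Place K) (x : K) :
    completionMap σ w (embed (comap σ w) x) = embed w (σ x) :=
  UniformSpace.Completion.mapRingHom_coe _ _

theorem completionMap_refl (w : Place K) (x : w.Completion) :
    completionMap (RingEquiv.refl K) w x = x := by
  exact congrFun (UniformSpace.Completion.map_id) x

theorem completionMap_comp (σ τ : K ≃+* K) (w : Place K)
    (x : (comap τ (comap σ w)).Completion) :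
    completionMap (τ.trans σ) w x = completionMap σ w (completionMap τ (comap σ w) x) := by
  exact (RingHom.congr_fun (UniformSpace.Completion.mapRingHom_comp
    (f := WithAbs.map (comap τ (comap σ w)).1 (comap σ w).1 (τ : K →+* K))
    (g := WithAbs.map (comap σ w).1 w.1 (σ : K →+* K))
    (continuous_withAbsMap σ w) (continuous_withAbsMap τ (comap σ w))) x).symm

/-- The units of `K_w`: the elements of absolute value `1` at a finite place, the squares
(i.e. `ℝ_{>0}`, resp. `ℂˣ`) at a real, resp. complex, place. -/
def units (w : Place K) : Subgroup (w.Completion)ˣ where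
  carrier := {u | (IsFinitePlace w.1 → ‖(u : w.Completion)‖ = 1) ∧
    (IsInfinitePlace w.1 → IsSquare u)}
  one_mem' := ⟨fun _ => by simp, fun _ => .one⟩
  mul_mem' hu hv := ⟨fun h => by simp [hu.1 h, hv.1 h], fun h => (hu.2 h).mul (hv.2 h)⟩
  inv_mem' hu := ⟨fun h => by simp [hu.1 h], fun h => (hu.2 h).inv⟩

end Place

end Place

/-! ### Idèles, divisors, classes and units -/

section Class

open NumberField

variable (ℓ : ℕ) [Fact ℓ.Prime]

section OneField

variable {K : Type*} [Field K] [NumberField K]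

/-- The `ℓ`-adification `R_{K_w} = lim K_wˣ / (K_wˣ)^(ℓⁿ)`, written additively. -/
abbrev LocalR (w : Place K) : Type _ := EllAdic ℓ (Additive (w.Completion)ˣ)

/-- The unit subgroup `U_{K_w}` of `R_{K_w}`: the image of the `ℓ`-adification of the units. -/
def localU (w : Place K) : Submodule ℤ_[ℓ] (LocalR ℓ w) :=
  LinearMap.range (EllAdic.map ℓ (MonoidHom.toAdditive (Place.units w).subtype))

variable (K) in
/-- The full product `∏_w R_{K_w}`. -/
abbrev LocalProd : Type _ := ∀ w : Place K, LocalR ℓ w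

variable (K) in
/-- The `ℓ`-adified idèle group: the restricted product of the `R_{K_w}` with respect to the
`U_{K_w}`. -/
def ideles : Submodule ℤ_[ℓ] (LocalProd ℓ K) where
  carrier := {x | {w | x w ∉ localU ℓ w}.Finite}
  zero_mem' := by simp
  add_mem' {x y} hx hy := (hx.union hy).subset fun w hw => by
    by_contra h
    simp only [Set.mem_union, Set.mem_ofPred_eq, not_or, not_not] at h
    exact hw (add_mem h.1 h.2)
  smul_mem' z x hx := hx.subset fun w hw h => hw ((localU ℓ w).smul_mem z h)

/-- `J^T(K)`: the idèles supported outside `T`. -/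
def idelesAway (T : Set (Place K)) : Submodule ℤ_[ℓ] (LocalProd ℓ K) where
  carrier := {x | x ∈ ideles ℓ K ∧ ∀ w ∈ T, x w = 0}
  zero_mem' := ⟨zero_mem _, fun _ _ => rfl⟩
  add_mem' hx hy := ⟨add_mem hx.1 hy.1, fun w hw => by simp [hx.2 w hw, hy.2 w hw]⟩
  smul_mem' z x hx := ⟨Submodule.smul_mem _ z hx.1, fun w hw => by simp [hx.2 w hw]⟩

/-- `J^T_S(K) = ∏_{w ∈ S} R_{K_w} × ∏_{w ∉ S ∪ T} U_{K_w}` for disjoint `S` and `T`. -/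
def idelesUnit (S T : Set (Place K)) : Submodule ℤ_[ℓ] (LocalProd ℓ K) where
  carrier := {x | (∀ w ∈ T, x w = 0) ∧ ∀ w, w ∉ S → w ∉ T → x w ∈ localU ℓ w}
  zero_mem' := ⟨fun _ _ => rfl, fun _ _ _ => zero_mem _⟩
  add_mem' hx hy := ⟨fun w hw => by simp [hx.1 w hw, hy.1 w hw],
    fun w hS hT => add_mem (hx.2 w hS hT) (hy.2 w hS hT)⟩
  smul_mem' z x hx := ⟨fun w hw => by simp [hx.1 w hw],
    fun w hS hT => Submodule.smul_mem _ z (hx.2 w hS hT)⟩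

variable (K) in
/-- The group of principal idèles `R(K) = ℤ_ℓ ⊗ Kˣ`. -/
abbrev Principal : Type _ := ℤ_[ℓ] ⊗[ℤ] Additive Kˣ

variable (K) in
/-- The map `R(K) → ∏_w R_{K_w}` induced by the embeddings `K → K_w`. -/
def diag : Principal ℓ K →ₗ[ℤ_[ℓ]] LocalProd ℓ K :=
  LinearMap.pi fun w => LinearMap.liftBaseChange ℤ_[ℓ]
    ((EllAdic.of ℓ (Additive (w.Completion)ˣ)).comp
      (MonoidHom.toAdditive (Units.map (Place.embed w : K →* w.Completion)))).toIntLinearMap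

/-- `R^T(K)`: the `T`-infinitesimal principal idèles. -/
def infinitesimal (T : Set (Place K)) : Submodule ℤ_[ℓ] (Principal ℓ K) :=
  (idelesAway ℓ T).comap (diag ℓ K)

/-- `E^T_S(K)`: the `T`-infinitesimal `S`-units. -/
def unitsST (S T : Set (Place K)) : Submodule ℤ_[ℓ] (Principal ℓ K) :=
  infinitesimal ℓ T ⊓ (idelesUnit ℓ S T).comap (diag ℓ K)

/-- `D^T_S(K) = J^T(K) / J^T_S(K)`: the `ℓ`-group of `S`-divisors prime to `T`. -/
abbrev Divisors (S T : Set (Place K)) : Type _ :=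
  ↥(idelesAway ℓ T) ⧸ (idelesUnit ℓ S T).submoduleOf (idelesAway ℓ T)

/-- `P^T_S(K)`: the image of `R^T(K)` in `D^T_S(K)`. -/
def principalDivisors (S T : Set (Place K)) : Submodule ℤ_[ℓ] (Divisors ℓ S T) :=
  (((infinitesimal ℓ T).map (diag ℓ K)).submoduleOf (idelesAway ℓ T)).map
    ((idelesUnit ℓ S T).submoduleOf (idelesAway ℓ T)).mkQ

/-- `Cl^T_S(K) = D^T_S(K) / P^T_S(K)`: the `ℓ`-group of `T`-infinitesimal `S`-classes. -/
abbrev ClassGroupST (S T : Set (Place K)) : Type _ :=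
  Divisors ℓ S T ⧸ principalDivisors ℓ S T

end OneField

section Extension

variable (K N : Type*) [Field K] [NumberField K] [Field N] [NumberField N] [Algebra K N]

variable {K} in
/-- The places of `N` above the places in `S`. -/
def placesAbove (S : Set (Place K)) : Set (Place N) :=
  {W | ∃ w ∈ S, (W.1.comp (f := algebraMap K N) (algebraMap K N).injective).IsEquiv w.1}

variable {K N} in
theorem comap_mem_placesAbove (S : Set (Place K)) (σ : N ≃ₐ[K] N) (W : Place N) :
    Place.comap (σ : N ≃+* N) W ∈ placesAbove N S ↔ W ∈ placesAbove N S := by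
  have h : ((Place.comap (σ : N ≃+* N) W).1.comp (f := algebraMap K N)
      (algebraMap K N).injective) =
      W.1.comp (f := algebraMap K N) (algebraMap K N).injective := by
    ext x
    change W.1 (σ (algebraMap K N x)) = W.1 (algebraMap K N x)
    rw [σ.commutes]
  simp only [placesAbove, Set.mem_ofPred_eq, h]

/-- The homomorphism `N_{W ∘ σ}ˣ → N_Wˣ` induced by `σ`, written additively. -/
def localUnitsMap {N : Type*} [Field N] [NumberField N] (σ : N ≃+* N) (W : Place N) :
    Additive ((Place.comap σ W).Completion)ˣ →+ Additive (W.Completion)ˣ :=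
  MonoidHom.toAdditive (Units.map (Place.completionMap σ W : _ →* W.Completion))

/-- The action of the Galois group on `∏_W R_{N_W}`:
`(σ x)_W` is the image of `x_{W ∘ σ}` under `σ : N_{W ∘ σ} → N_W`. -/
def localProdRep : Representation ℤ_[ℓ] (N ≃ₐ[K] N) (LocalProd ℓ N) where
  toFun σ := LinearMap.pi fun W =>
    (EllAdic.map ℓ (localUnitsMap (σ : N ≃+* N) W)).comp
      (LinearMap.proj (Place.comap (σ : N ≃+* N) W))
  map_one' := by
    ext x W : 2
    refine Eq.trans ?_ (EllAdic.map_id ℓ (x W))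
    have h : localUnitsMap (RingEquiv.refl N) W = AddMonoidHom.id _ := by
      ext u
      exact Place.completionMap_refl W _
    exact congrArg (fun f => EllAdic.map ℓ f (x W)) h
  map_mul' σ τ := by
    ext x W : 2
    have h : localUnitsMap ((τ : N ≃+* N).trans (σ : N ≃+* N)) W =
        (localUnitsMap (σ : N ≃+* N) W).comp
          (localUnitsMap (τ : N ≃+* N) (Place.comap (σ : N ≃+* N) W)) := by
      ext u
      exact Place.completionMap_comp _ _ W _
    exact (congrArg (fun f => EllAdic.map ℓ f
      (x (Place.comap (τ : N ≃+* N) (Place.comap (σ : N ≃+* N) W)))) h).trans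
      (EllAdic.map_map ℓ _ _ _).symm

/-- The action of the Galois group on `R(N) = ℤ_ℓ ⊗ Nˣ`. -/
def principalMap (σ : N ≃ₐ[K] N) : Principal ℓ N →ₗ[ℤ_[ℓ]] Principal ℓ N :=
  LinearMap.baseChange ℤ_[ℓ]
    (MonoidHom.toAdditive (Units.map (σ : N →* N))).toIntLinearMap

/-- The norm `N_{N/K} : R(N) → R(K)`, the `ℤ_ℓ`-linear extension of the norm `Nˣ → Kˣ`. -/
def principalNorm : Principal ℓ N →ₗ[ℤ_[ℓ]] Principal ℓ K :=
  LinearMap.baseChange ℤ_[ℓ]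
    (MonoidHom.toAdditive (Units.map (Algebra.norm K : N →* K))).toIntLinearMap

variable {K N}

theorem localProdRep_diag (σ : N ≃ₐ[K] N) (a : Principal ℓ N) :
    localProdRep ℓ K N σ (diag ℓ N a) = diag ℓ N (principalMap ℓ K N σ a) := by
  induction a using TensorProduct.induction_on with
  | zero => simp
  | add a b ha hb => simp only [map_add, ha, hb]
  | tmul z u =>
    funext W
    change EllAdic.map ℓ (localUnitsMap (σ : N ≃+* N) W) (z • EllAdic.of ℓ _ _) =
      z • EllAdic.of ℓ _ _
    rw [map_smul, EllAdic.map_of]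
    congr 2
    apply Additive.toMul.injective
    ext
    exact Place.completionMap_embed (σ : N ≃+* N) W _

theorem localProdRep_localU (σ : N ≃ₐ[K] N) (x : LocalProd ℓ N) (W : Place N)
    (h : x (Place.comap (σ : N ≃+* N) W) ∈ localU ℓ (Place.comap (σ : N ≃+* N) W)) :
    localProdRep ℓ K N σ x W ∈ localU ℓ W := by
  obtain ⟨y, hy⟩ := h
  let σ' : N ≃+* N := σ
  have hmap : ∀ u ∈ Place.units (Place.comap σ' W),
      Units.map (Place.completionMap σ' W : _ →* W.Completion) u ∈ Place.units W := by
    intro u hu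
    refine ⟨fun hW => ?_, fun hW => ?_⟩
    · change ‖Place.completionMap σ' W u‖ = 1
      rw [Place.norm_completionMap]
      exact hu.1 (isFinitePlace_comp σ' hW)
    · exact (hu.2 (isInfinitePlace_comp σ' hW)).map _
  let f : Additive (Place.units (Place.comap σ' W)) →+ Additive (Place.units W) :=
    MonoidHom.toAdditive (((Units.map (Place.completionMap σ' W : _ →* W.Completion)).comp
      (Place.units (Place.comap σ' W)).subtype).codRestrict _ fun u => hmap u.1 u.2)
  refine ⟨EllAdic.map ℓ f y, ?_⟩
  change _ = EllAdic.map ℓ (localUnitsMap σ' W) (x (Place.comap σ' W))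
  rw [← hy, EllAdic.map_map, EllAdic.map_map]
  rfl

theorem idelesAway_le_comap (T : Set (Place K)) (σ : N ≃ₐ[K] N) :
    idelesAway ℓ (placesAbove N T) ≤
      (idelesAway ℓ (placesAbove N T)).comap (localProdRep ℓ K N σ) := by
  intro x hx
  refine ⟨?_, fun W hW => ?_⟩
  · refine (hx.1.preimage ((Place.comap_injective (σ : N ≃+* N)).injOn)).subset ?_
    intro W hW h
    exact hW (localProdRep_localU ℓ σ x W h)
  · change EllAdic.map ℓ _ (x (Place.comap (σ : N ≃+* N) W)) = 0
    rw [hx.2 _ ((comap_mem_placesAbove T σ W).2 hW), map_zero]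

theorem idelesUnit_le_comap (S T : Set (Place K)) (σ : N ≃ₐ[K] N) :
    idelesUnit ℓ (placesAbove N S) (placesAbove N T) ≤
      (idelesUnit ℓ (placesAbove N S) (placesAbove N T)).comap (localProdRep ℓ K N σ) := by
  intro x hx
  refine ⟨fun W hW => ?_, fun W hS hT => ?_⟩
  · change EllAdic.map ℓ _ (x (Place.comap (σ : N ≃+* N) W)) = 0
    rw [hx.1 _ ((comap_mem_placesAbove T σ W).2 hW), map_zero]
  · exact localProdRep_localU ℓ σ x W (hx.2 _ (mt (comap_mem_placesAbove S σ W).1 hS)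
      (mt (comap_mem_placesAbove T σ W).1 hT))

variable (N)

/-- The action of the Galois group on `J^T(N)`. -/
def idelesAwayRep (T : Set (Place K)) :
    Representation ℤ_[ℓ] (N ≃ₐ[K] N) (idelesAway ℓ (placesAbove N T)) :=
  (localProdRep ℓ K N).subrepresentation _ (idelesAway_le_comap ℓ T)

/-- The action of the Galois group on `D^T_S(N)`. -/
def divisorsRep (S T : Set (Place K)) :
    Representation ℤ_[ℓ] (N ≃ₐ[K] N) (Divisors ℓ (placesAbove N S) (placesAbove N T)) :=
  (idelesAwayRep ℓ N T).quotient _ fun σ _ hx => idelesUnit_le_comap ℓ S T σ hx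

theorem principalDivisors_le_comap (S T : Set (Place K)) (σ : N ≃ₐ[K] N) :
    principalDivisors ℓ (placesAbove N S) (placesAbove N T) ≤
      (principalDivisors ℓ (placesAbove N S) (placesAbove N T)).comap
        (divisorsRep ℓ N S T σ) := by
  rintro _ ⟨x, ⟨a, ha, hax⟩, rfl⟩
  have hx : diag ℓ N (principalMap ℓ K N σ a) = localProdRep ℓ K N σ x.1 := by
    rw [← localProdRep_diag, hax]
    rfl
  refine ⟨idelesAwayRep ℓ N T σ x, ⟨principalMap ℓ K N σ a, ?_, hx⟩, rfl⟩
  change diag ℓ N (principalMap ℓ K N σ a) ∈ idelesAway ℓ (placesAbove N T)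
  rw [hx]
  exact idelesAway_le_comap ℓ T σ x.2

/-- The action of the Galois group on `Cl^T_S(N)`. -/
def classRep (S T : Set (Place K)) :
    Representation ℤ_[ℓ] (N ≃ₐ[K] N) (ClassGroupST ℓ (placesAbove N S) (placesAbove N T)) :=
  (divisorsRep ℓ N S T).quotient _ (principalDivisors_le_comap ℓ N S T)

/-- `Cl^T_S(N)^Γ`: the ambiguous classes. -/
def ambiguousClasses (S T : Set (Place K)) :
    Submodule ℤ_[ℓ] (ClassGroupST ℓ (placesAbove N S) (placesAbove N T)) :=
  (classRep ℓ N S T).invariants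

/-- `cl(D^T_S(N)^Γ)`: the classes of the ambiguous `S`-divisors prime to `T`. -/
def classesOfAmbiguousDivisors (S T : Set (Place K)) :
    Submodule ℤ_[ℓ] (ClassGroupST ℓ (placesAbove N S) (placesAbove N T)) :=
  (divisorsRep ℓ N S T).invariants.map
    (principalDivisors ℓ (placesAbove N S) (placesAbove N T)).mkQ

/-- `E^T_S(K) ∩ N_{N/K}(R(N))`. -/
def unitsThatAreNorms (S T : Set (Place K)) : Submodule ℤ_[ℓ] (Principal ℓ K) :=
  unitsST ℓ S T ⊓ LinearMap.range (principalNorm ℓ K N)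

/-- `N_{N/K}(E^T_S(N))`. -/
def normsOfUnits (S T : Set (Place K)) : Submodule ℤ_[ℓ] (Principal ℓ K) :=
  (unitsST ℓ (placesAbove N S) (placesAbove N T)).map (principalNorm ℓ K N)

end Extension

end Class

end LadicClass

end

/-! Fix a generator `σ` of `Γ`. Both sides are quotients of one module, `linkedPairs`: the pairs
`(d, a)`, with `d` an idele prime to `T` and `a` a `T`-infinitesimal principal element, such that `σ
d - d` and `a` have the same `S`-divisor. Send `(d, a)` to the class of `d` and to the norm of `a`.
The isomorphism follows from `nonempty_subquotient_linearEquiv` once the two maps have the right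
images and the two submodules divided out have the same preimage in the pairs.

A class is fixed by `σ` exactly when a representative `d` occurs in such a pair, which gives the
first image. For the second, summing `σ d - d - a` over `Γ` shows that the norm of `a` is an
`S`-unit in `N`, and `principalNorm_mem_unitsST` brings this down to `K`. Conversely, let an
`S`-unit of `K` be the norm of `y`. By `exists_sub_principalMap_mem`, `y` becomes `T`-infinitesimal
after subtracting some `σ c - c`, which leaves its norm unchanged. Its divisor then has trivial
norm, hence is of the form `σ d - d` by `exists_sub_mem_idelesUnit`: at finite places divisors form
permutation modules over `ℤ_ℓ`, which is torsion-free, and `Γ` acts freely on the real places.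

For the preimages: if `a` and a unit `e` have the same norm, Hilbert 90
(`exists_principalMap_sub_eq`) gives `a - e = σ b - b`, and `exists_sub_principalIncl_mem` corrects
`b` by an element of `R(K)` to make it `T`-infinitesimal. Subtracting it from `d` leaves an
invariant divisor. The other direction is a direct computation.

The work at `T` is done modulo `ℓ ^ n`: a principal element is `1 ⊗ u` up to `ℓ ^ n`, so the
question concerns `ℓ ^ n`-th powers in finitely many completions. It is settled by a semilocal
Hilbert 90 and weak approximation, with a loss bounded by the `ℓ`-power torsion. Passing to the
limit uses that submodules of finitely generated `ℤ_ℓ`-modules are closed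
(`exists_sub_mem_infinitesimal`). Places with `ℓ`-divisible multiplicative group, such as complex
ones, are set aside: they contribute zero, and their torsion need not be bounded. -/

namespace LadicClass

/-! ### Algebra of `ℓ`-adifications and of `ℤ_ℓ ⊗ A`. -/

section EllAdicAlgebra

variable {ℓ : ℕ} [Fact ℓ.Prime]

namespace EllAdic

variable {A B C : Type*} [AddCommGroup A] [AddCommGroup B] [AddCommGroup C]

@[simp] theorem add_apply (x y : EllAdic ℓ A) (n : ℕ) : (x + y).1 n = x.1 n + y.1 n := rfl

@[simp] theorem sub_apply (x y : EllAdic ℓ A) (n : ℕ) : (x - y).1 n = x.1 n - y.1 n := rfl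

@[simp] theorem zero_apply (n : ℕ) : (0 : EllAdic ℓ A).1 n = 0 := rfl

@[simp] theorem nsmul_apply (m : ℕ) (x : EllAdic ℓ A) (n : ℕ) : (m • x).1 n = m • x.1 n := rfl

@[simp] theorem of_apply (a : A) (n : ℕ) : (of ℓ A a).1 n = Level.mk ℓ A n a := rfl

theorem map_apply_mk (f : A →+ B) (x : EllAdic ℓ A) (n : ℕ) (a : A)
    (h : x.1 n = Level.mk ℓ A n a) : (map ℓ f x).1 n = Level.mk ℓ B n (f a) := by
  change Level.map ℓ n f (x.1 n) = _
  rw [h, Level.map_mk]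

theorem pow_nsmul_level (n : ℕ) (x : Level ℓ A n) : ℓ ^ n • x = 0 := by
  obtain ⟨a, rfl⟩ := Level.mk_surjective ℓ n x
  rw [← map_nsmul, Level.mk_eq_zero_iff]
  exact ⟨a, rfl⟩

theorem level_eq_zero_of_le {x : EllAdic ℓ A} {m n : ℕ} (h : m ≤ n) (hx : x.1 n = 0) :
    x.1 m = 0 := by
  induction n, h using Nat.le_induction with
  | base => exact hx
  | succ n _ ih => exact ih (by rw [← x.2 n, hx, map_zero])

theorem exists_of_seq (s : ℕ → A) (h : ∀ n, ∃ b, ℓ ^ n • b = s (n + 1) - s n) :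
    ∃ y : EllAdic ℓ A, ∀ n, y.1 n = Level.mk ℓ A n (s n) :=
  ⟨⟨fun n => Level.mk ℓ A n (s n), fun n => by
    rw [Level.trans_mk, ← sub_eq_zero, ← map_sub, Level.mk_eq_zero_iff]
    exact h n⟩, fun _ => rfl⟩

/-- No torsion hypothesis on `A` is required. Lift `x` to a sequence `a n` with `a (n + 1) - a n = ℓ
^ n • c n` and `a k = ℓ ^ k • b`; all terms from index `k` on can be divided by `ℓ ^ k` coherently,
using the chosen `b` and `c`. -/
theorem level_eq_zero_iff (x : EllAdic ℓ A) (k : ℕ) :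
    x.1 k = 0 ↔ ∃ y : EllAdic ℓ A, x = ℓ ^ k • y := by
  constructor
  · intro hx
    choose a ha using fun n => Level.mk_surjective ℓ n (x.1 n)
    have hc : ∀ n, ∃ c, ℓ ^ n • c = a (n + 1) - a n := by
      intro n
      rw [← Level.mk_eq_zero_iff, map_sub, ha n, ← x.2 n, ← ha (n + 1), Level.trans_mk, sub_self]
    choose c hc using hc
    obtain ⟨b, hb⟩ := (Level.mk_eq_zero_iff ℓ k (a k)).1 (by rw [ha, hx])
    -- This is the divided sequence: `ℓ ^ k • s j = a (k + j)`, and consecutive terms differ by `ℓ ^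
    -- j • c (k + j)`.
    let s : ℕ → A := fun j => b + ∑ i ∈ Finset.range j, ℓ ^ i • c (k + i)
    have hs : ∀ j, ℓ ^ k • s j = a (k + j) := by
      intro j
      induction j with
      | zero => simp [s, hb]
      | succ j ih =>
        have h1 : s (j + 1) = s j + ℓ ^ j • c (k + j) := by
          simp only [s, Finset.sum_range_succ, add_assoc]
        rw [h1, smul_add, ih, smul_smul, ← pow_add, hc, ← add_assoc]
        abel
    obtain ⟨y, hy⟩ := exists_of_seq (ℓ := ℓ) s fun j =>
      ⟨c (k + j), by simp [s, Finset.sum_range_succ]⟩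
    · refine ⟨y, ext ℓ fun j => ?_⟩
      rw [nsmul_apply, hy, ← map_nsmul, hs]
      have hj : ∀ i, Level.mk ℓ A j (a (j + i)) = x.1 j := by
        intro i
        induction i with
        | zero => exact ha j
        | succ i ih =>
          rw [← ih, ← sub_eq_zero, ← map_sub, Level.mk_eq_zero_iff]
          exact ⟨ℓ ^ i • c (j + i), by rw [smul_smul, ← pow_add, hc]; rfl⟩
      rw [add_comm, hj]
  · rintro ⟨y, rfl⟩
    rw [nsmul_apply, pow_nsmul_level]

theorem exists_of_add (x : EllAdic ℓ A) (k : ℕ) :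
    ∃ (a : A) (y : EllAdic ℓ A), x = of ℓ A a + ℓ ^ k • y := by
  obtain ⟨a, ha⟩ := Level.mk_surjective ℓ k (x.1 k)
  obtain ⟨y, hy⟩ := (level_eq_zero_iff (x - of ℓ A a) k).1 (by
    rw [sub_apply, of_apply, ha, sub_self])
  exact ⟨a, y, by rw [← hy]; abel⟩

theorem eq_zero_of_forall {x : EllAdic ℓ A} (h : ∀ k, ∃ n ≥ k, x.1 n = 0) : x = 0 :=
  ext ℓ fun k => by
    obtain ⟨n, hn, h0⟩ := h k
    exact level_eq_zero_of_le hn h0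

theorem eq_zero_of_divisible (h : ∀ (a : A) (n : ℕ), ∃ b, ℓ ^ n • b = a) (x : EllAdic ℓ A) :
    x = 0 :=
  ext ℓ fun n => by
    obtain ⟨a, ha⟩ := Level.mk_surjective ℓ n (x.1 n)
    rw [← ha, zero_apply, Level.mk_eq_zero_iff]
    exact h a n

/-- To see that `x` vanishes at level `n`, look at level `m + n`: there `ℓ ^ m • a` is divisible by
`ℓ ^ (m + n)`, and `ℓ ^ m` cancels in `A`. -/
theorem eq_zero_of_pow_nsmul (h : ∀ a : A, ℓ • a = 0 → a = 0) {x : EllAdic ℓ A} {m : ℕ}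
    (hx : ℓ ^ m • x = 0) : x = 0 := by
  have h' : ∀ (m : ℕ) (a : A), ℓ ^ m • a = 0 → a = 0 := by
    intro m
    induction m with
    | zero => intro a ha; simpa using ha
    | succ m ih =>
      intro a ha
      rw [pow_succ, mul_smul] at ha
      exact h a (ih _ ha)
  refine ext ℓ fun n => ?_
  obtain ⟨a, ha⟩ := Level.mk_surjective ℓ (m + n) (x.1 (m + n))
  have h1 : (ℓ ^ m • x).1 (m + n) = 0 := by rw [hx]; rfl
  rw [nsmul_apply, ← ha, ← map_nsmul, Level.mk_eq_zero_iff] at h1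
  obtain ⟨b, hb⟩ := h1
  rw [pow_add, mul_smul] at hb
  have h2 : ℓ ^ n • b = a := sub_eq_zero.1 (h' m _ (by rw [smul_sub, hb, sub_self]))
  have h3 : (x - of ℓ A a).1 (m + n) = 0 := by rw [sub_apply, of_apply, ha, sub_self]
  have h4 := level_eq_zero_of_le (Nat.le_add_left n m) h3
  rw [sub_apply, sub_eq_zero] at h4
  rw [h4, of_apply, zero_apply, Level.mk_eq_zero_iff]
  exact ⟨b, h2⟩

theorem map_add_hom (f g : A →+ B) (x : EllAdic ℓ A) : map ℓ (f + g) x = map ℓ f x + map ℓ g x := by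
  refine ext ℓ fun n => ?_
  obtain ⟨a, ha⟩ := Level.mk_surjective ℓ n (x.1 n)
  rw [map_apply_mk _ _ _ a ha.symm, add_apply, map_apply_mk _ _ _ a ha.symm,
    map_apply_mk _ _ _ a ha.symm, ← map_add]
  rfl

theorem map_zero_hom (x : EllAdic ℓ A) : map ℓ (0 : A →+ B) x = 0 := by
  refine ext ℓ fun n => ?_
  obtain ⟨a, ha⟩ := Level.mk_surjective ℓ n (x.1 n)
  rw [map_apply_mk _ _ _ a ha.symm]
  exact map_zero _

/-- The kernel of the map induced by a split surjection is the `ℓ`-adification of its kernel. -/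
theorem mem_range_map_iff (i : C →+ A) (f : A →+ B) (s : B →+ A) (hs : ∀ b, f (s b) = b)
    (hf : ∀ a, f a = 0 ↔ ∃ c, i c = a) (hi : Function.Injective i) (x : EllAdic ℓ A) :
    x ∈ LinearMap.range (map ℓ i) ↔ map ℓ f x = 0 := by
  constructor
  · rintro ⟨y, rfl⟩
    rw [map_map]
    have : f.comp i = 0 := by ext c; exact (hf _).2 ⟨c, rfl⟩
    rw [this, map_zero_hom]
  · intro hx
    -- The section yields a projection of `A` onto the kernel. The identity `i ∘ p + s ∘ f = id`
    -- survives `ℓ`-adification, so no exactness of inverse limits is involved.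
    have hp : ∀ a, ∃ c, i c = a - s (f a) := fun a => (hf _).1 (by rw [map_sub, hs, sub_self])
    choose p hp using hp
    let p' : A →+ C := AddMonoidHom.mk' p fun a b => hi (by
      rw [map_add, hp, hp, hp, map_add, map_add]; abel)
    refine ⟨map ℓ p' x, ?_⟩
    have h1 : i.comp p' + s.comp f = AddMonoidHom.id A := by
      ext a
      change i (p a) + s (f a) = a
      rw [hp]; abel
    have h2 := map_add_hom (i.comp p') (s.comp f) x
    rw [h1, map_id, ← map_map, ← map_map, hx, map_zero, add_zero] at h2
    exact h2.symm

theorem natCast_pow_smul {M : Type*} [AddCommGroup M] [Module ℤ_[ℓ] M] (k : ℕ) (x : M) :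
    ((ℓ : ℤ_[ℓ]) ^ k) • x = ℓ ^ k • x := by
  rw [← Nat.cast_pow, Nat.cast_smul_eq_nsmul]

theorem mem_pow_smul_top {M : Type*} [AddCommGroup M] [Module ℤ_[ℓ] M] (k : ℕ) (x : M) :
    x ∈ ((Ideal.span {(ℓ : ℤ_[ℓ])}) ^ k • ⊤ : Submodule ℤ_[ℓ] M) ↔ ∃ y, x = ℓ ^ k • y := by
  rw [Ideal.span_singleton_pow, Submodule.ideal_span_singleton_smul]
  constructor
  · rintro ⟨y, -, rfl⟩
    exact ⟨y, natCast_pow_smul k y⟩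
  · rintro ⟨y, rfl⟩
    exact ⟨y, trivial, natCast_pow_smul k y⟩

/-- Limits and divisions by `ℓ ^ n` are taken coordinatewise. It makes the source complete in the
Nakayama argument of `finite_of_finite_cosets`. -/
theorem isPrecomplete_fun (ι : Type*) : IsPrecomplete (Ideal.span {(ℓ : ℤ_[ℓ])}) (ι → ℤ_[ℓ]) := by
  have hc : IsPrecomplete (Ideal.span {(ℓ : ℤ_[ℓ])}) ℤ_[ℓ] := by
    rw [← PadicInt.maximalIdeal_eq_span_p]
    infer_instance
  refine ⟨fun f hf => ?_⟩
  have h1 : ∀ i, ∃ L : ℤ_[ℓ], ∀ n, f n i ≡ L [SMOD (Ideal.span {(ℓ : ℤ_[ℓ])} ^ n • ⊤ :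
      Submodule ℤ_[ℓ] ℤ_[ℓ])] := by
    intro i
    refine hc.prec' (fun n => f n i) fun {m n} hmn => ?_
    have := hf hmn
    rw [SModEq.sub_mem, mem_pow_smul_top] at this ⊢
    obtain ⟨y, hy⟩ := this
    exact ⟨y i, congrFun hy i⟩
  choose L hL using h1
  refine ⟨L, fun n => ?_⟩
  simp only [SModEq.sub_mem, mem_pow_smul_top] at hL ⊢
  choose y hy using fun i => hL i n
  exact ⟨y, funext hy⟩

/-- If `A / ℓA` is finite then `lim A / ℓⁿ A` is a finitely generated `ℤ_ℓ`-module. -/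
theorem finite_of_finite_cosets (F : Set A) (hF : F.Finite) (h : ∀ a : A, ∃ f ∈ F, ∃ b, a = f + ℓ • b) :
    Module.Finite ℤ_[ℓ] (EllAdic ℓ A) := by
  have := hF.fintype
  have hN : IsHausdorff (Ideal.span {(ℓ : ℤ_[ℓ])}) (EllAdic ℓ A) := by
    refine ⟨fun x hx => eq_zero_of_forall fun k => ⟨k, le_rfl, ?_⟩⟩
    have := hx k
    rw [SModEq.zero, mem_pow_smul_top] at this
    exact (level_eq_zero_iff x k).2 this
  have := isPrecomplete_fun (ℓ := ℓ) F
  let g : (F → ℤ_[ℓ]) →ₗ[ℤ_[ℓ]] EllAdic ℓ A := Fintype.linearCombination ℤ_[ℓ]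
    fun f : F => of ℓ A f.1
  -- Complete source and Hausdorff target: surjectivity modulo `ℓ` suffices, and the finitely many
  -- coset representatives provide it.
  refine Module.Finite.of_surjective g (surjective_of_mkQ_comp_surjective
    (I := Ideal.span {(ℓ : ℤ_[ℓ])}) fun y => ?_)
  classical
  obtain ⟨x, rfl⟩ := Submodule.mkQ_surjective _ y
  obtain ⟨a, z, hz⟩ := exists_of_add x 1
  obtain ⟨f, hf, b, hb⟩ := h a
  refine ⟨Pi.single ⟨f, hf⟩ 1, ?_⟩
  rw [LinearMap.comp_apply, ← sub_eq_zero, ← map_sub, Submodule.mkQ_apply,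
    Submodule.Quotient.mk_eq_zero, ← pow_one (Ideal.span {(ℓ : ℤ_[ℓ])}), mem_pow_smul_top]
  refine ⟨-(of ℓ A b + z), ?_⟩
  rw [hz, hb]
  simp only [g, Fintype.linearCombination_apply_single, one_smul, map_add, map_nsmul, pow_one]
  simp only [smul_neg, smul_add]
  abel

end EllAdic

/-- Submodules of finitely generated `ℤ_ℓ`-modules are closed. -/
theorem mem_of_forall_mem_add_pow {P : Type*} [AddCommGroup P] [Module ℤ_[ℓ] P]
    [Module.Finite ℤ_[ℓ] P] (Z : Submodule ℤ_[ℓ] P) (y : P)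
    (h : ∀ k : ℕ, ∃ z ∈ Z, ∃ p, y = z + ℓ ^ k • p) : y ∈ Z := by
  -- Krull's intersection theorem in the finitely generated module `P ⧸ Z`.
  rw [← Submodule.Quotient.mk_eq_zero, ← Submodule.mem_bot ℤ_[ℓ],
    ← Ideal.iInf_pow_smul_eq_bot_of_isLocalRing (M := P ⧸ Z) (Ideal.span {(ℓ : ℤ_[ℓ])}) (by
      rw [← PadicInt.maximalIdeal_eq_span_p]
      exact (IsLocalRing.maximalIdeal.isMaximal _).ne_top), Submodule.mem_iInf]
  intro k
  rw [EllAdic.mem_pow_smul_top]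
  obtain ⟨z, hz, p, rfl⟩ := h k
  refine ⟨Submodule.Quotient.mk p, ?_⟩
  rw [Submodule.Quotient.mk_add, (Submodule.Quotient.mk_eq_zero Z).2 hz, zero_add]
  rfl

/-- Integers are dense in `ℤ_ℓ`. This reduces questions on `ℤ_ℓ ⊗ Kˣ` modulo `ℓ ^ n` to questions on
elements of `Kˣ`. -/
theorem exists_tmul_add (A : Type*) [AddCommGroup A] (x : ℤ_[ℓ] ⊗[ℤ] A) (n : ℕ) :
    ∃ (a : A) (y : ℤ_[ℓ] ⊗[ℤ] A), x = (1 : ℤ_[ℓ]) ⊗ₜ[ℤ] a + ℓ ^ n • y := by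
  induction x using TensorProduct.induction_on with
  | zero => exact ⟨0, 0, by simp⟩
  | add x y hx hy =>
    obtain ⟨a, x', rfl⟩ := hx
    obtain ⟨b, y', rfl⟩ := hy
    exact ⟨a + b, x' + y', by rw [TensorProduct.tmul_add, smul_add]; abel⟩
  | tmul z a =>
    obtain ⟨w, hw⟩ := Ideal.mem_span_singleton'.1 (PadicInt.appr_spec n z)
    refine ⟨(z.appr n) • a, w ⊗ₜ a, ?_⟩
    have : z = (z.appr n : ℤ_[ℓ]) + ℓ ^ n • w := by
      rw [← EllAdic.natCast_pow_smul, smul_eq_mul, mul_comm, hw]; ring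
    conv_lhs => rw [this]
    rw [TensorProduct.add_tmul, TensorProduct.smul_tmul', TensorProduct.tmul_smul,
      TensorProduct.smul_tmul', nsmul_eq_mul, nsmul_eq_mul, mul_one]

/-- Flatness of `ℤ_ℓ` over `ℤ`; it transports Hilbert 90 from `Nˣ` to `R(N)`. -/
theorem baseChange_exact {A B C : Type*} [AddCommGroup A] [AddCommGroup B] [AddCommGroup C]
    (f : A →+ B) (g : B →+ C) (h : ∀ b, g b = 0 → ∃ a, f a = b) (hgf : ∀ a, g (f a) = 0)
    (x : ℤ_[ℓ] ⊗[ℤ] B) (hx : LinearMap.baseChange ℤ_[ℓ] g.toIntLinearMap x = 0) :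
    ∃ y, LinearMap.baseChange ℤ_[ℓ] f.toIntLinearMap y = x := by
  have : Module.Flat ℤ ℤ_[ℓ] := inferInstance
  have hex : Function.Exact f.toIntLinearMap g.toIntLinearMap :=
    fun b => ⟨h b, by rintro ⟨a, rfl⟩; exact hgf a⟩
  exact (Module.Flat.lTensor_exact ℤ_[ℓ] hex x).1 hx

end EllAdicAlgebra

/-! ### Absolute values of a number field and weak approximation. -/

open NumberField IsDedekindDomain

namespace Place

variable {K : Type*} [Field K] [NumberField K]

theorem norm_embed (w : Place K) (x : K) : ‖embed w x‖ = w.1 x :=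
  UniformSpace.Completion.norm_coe _

theorem denseRange_embed (w : Place K) : DenseRange (embed w) :=
  UniformSpace.Completion.denseRange_coe.comp (WithAbs.equiv w.1).symm.surjective.denseRange
    (UniformSpace.Completion.continuous_coe _)

theorem exists_norm_sub_embed_lt (w : Place K) (x : w.Completion) {ε : ℝ} (hε : 0 < ε) :
    ∃ a : K, ‖x - embed w a‖ < ε := by
  obtain ⟨a, ha⟩ := (denseRange_embed w).exists_dist_lt x hε
  exact ⟨a, by rwa [← dist_eq_norm]⟩

instance charZero_completion (w : Place K) : CharZero w.Completion :=
  charZero_of_injective_ringHom (embed w).injective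

section Finite

variable {w : AbsoluteValue K ℝ}

theorem isNonarchimedean_of_isFinitePlace (hw : IsFinitePlace w) : IsNonarchimedean w := by
  obtain ⟨v, rfl⟩ := hw
  exact FinitePlace.add_le (FinitePlace.mk v)

theorem apply_natCast_le_one_of_isFinitePlace (hw : IsFinitePlace w) (n : ℕ) : w n ≤ 1 :=
  (isNonarchimedean_of_isFinitePlace hw).apply_natCast_le_one

theorem exists_zpow_of_isFinitePlace (hw : IsFinitePlace w) :
    ∃ q : ℝ, 1 < q ∧ (∀ x : K, x ≠ 0 → ∃ k : ℤ, w x = q ^ k) ∧ ∃ a : K, w a = q := by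
  obtain ⟨v, rfl⟩ := hw
  have key : ∀ (x : K) (k : ℤ), v.valuation K x = WithZero.exp k →
      place (FinitePlace.embedding v) x = (Ideal.absNorm v.asIdeal : ℝ) ^ k := by
    intro x k hx
    rw [place_apply, FinitePlace.norm_embedding', hx]
    rw [WithZeroMulInt.toNNReal_neg_apply _ WithZero.exp_ne_zero]
    push_cast
    rfl
  refine ⟨Ideal.absNorm v.asIdeal, mod_cast HeightOneSpectrum.one_lt_absNorm v, ?_, ?_⟩
  · intro x hx
    have hx' : v.valuation K x ≠ 0 := (Valuation.ne_zero_iff _).2 hx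
    exact ⟨_, key x _ (WithZero.exp_log hx').symm⟩
  · obtain ⟨π, hπ⟩ := v.valuation_exists_uniformizer K
    refine ⟨π⁻¹, ?_⟩
    rw [key π⁻¹ 1 (by rw [map_inv₀, hπ, ← WithZero.exp_neg, neg_neg]), zpow_one]

/-- Choose `k` so that the `k`-th power of a uniformizer has absolute value below `ε`;
representatives of the finite ring `𝓞 K / v ^ k` form the net, since elements of the valuation ring
are approximated by integers. -/
theorem exists_finite_net_of_isFinitePlace (hw : IsFinitePlace w) {ε : ℝ} (hε : 0 < ε) :
    ∃ F : Set K, F.Finite ∧ ∀ x, w x ≤ 1 → ∃ f ∈ F, w (x - f) < ε := by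
  obtain ⟨v, rfl⟩ := hw
  have hq1 := HeightOneSpectrum.one_lt_absNorm_nnreal v
  have hmono : ∀ x y : K, v.valuation K x ≤ v.valuation K y ↔
      place (FinitePlace.embedding v) x ≤ place (FinitePlace.embedding v) y := by
    intro x y
    simp only [place_apply, FinitePlace.norm_embedding']
    rw [NNReal.coe_le_coe, (WithZeroMulInt.toNNReal_strictMono hq1).le_iff_le]
  obtain ⟨π, hπ⟩ := v.valuation_exists_uniformizer K
  have hπ1 : place (FinitePlace.embedding (K := K) v) π < 1 := by
    rw [← not_le, ← map_one (place (FinitePlace.embedding (K := K) v)), ← hmono, hπ,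
      map_one (v.valuation K), not_le, ← WithZero.exp_zero, WithZero.exp_lt_exp]
    norm_num
  obtain ⟨k, hk⟩ := exists_pow_lt_of_lt_one hε hπ1
  have hπk : v.valuation K (π ^ k) = WithZero.exp (-(k : ℤ)) := by
    rw [map_pow, hπ, ← WithZero.exp_nsmul]; simp
  have hfin : Finite (𝓞 K ⧸ v.asIdeal ^ k) :=
    Ideal.finiteQuotientOfFreeOfNeBot _ (pow_ne_zero k v.ne_bot)
  let g : 𝓞 K ⧸ v.asIdeal ^ k → K := fun c => algebraMap (𝓞 K) K (Quotient.out c)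
  refine ⟨Set.range g, Set.finite_range g, fun x hx => ?_⟩
  have hx : v.valuation K x ≤ 1 := by
    have := (hmono x 1).2 (by rwa [map_one (place (FinitePlace.embedding v))])
    rwa [map_one (v.valuation K)] at this
  obtain ⟨a, ha⟩ := v.exists_valuation_sub_lt_of_integer hx
    (Units.mk0 (WithZero.exp (-(k : ℤ))) WithZero.exp_ne_zero)
  refine ⟨_, ⟨Ideal.Quotient.mk _ a, rfl⟩, lt_of_le_of_lt ?_ hk⟩
  rw [← map_pow, ← hmono, hπk]
  have h1 : v.valuation K (algebraMap (𝓞 K) K (a - Quotient.out (Ideal.Quotient.mk (v.asIdeal ^ k) a)))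
      ≤ WithZero.exp (-(k : ℤ)) := by
    rw [HeightOneSpectrum.valuation_of_algebraMap, HeightOneSpectrum.intValuation_le_pow_iff_mem,
      ← Ideal.Quotient.eq]
    exact (Quotient.out_eq _).symm
  have h2 : x - g (Ideal.Quotient.mk _ a) = (x - algebraMap (𝓞 K) K a) +
      algebraMap (𝓞 K) K (a - Quotient.out (Ideal.Quotient.mk (v.asIdeal ^ k) a)) := by
    rw [map_sub]; simp only [g]; ring
  rw [h2]
  refine (Valuation.map_add _ _ _).trans (max_le ?_ h1)
  rw [Valuation.map_sub_swap]
  exact ha.le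

end Finite

theorem apply_two_of_isInfinitePlace {w : AbsoluteValue K ℝ} (hw : IsInfinitePlace w) :
    w 2 = 2 := by
  obtain ⟨φ, rfl⟩ := hw
  rw [place_apply, map_ofNat]
  simp

theorem not_isInfinitePlace_of_isFinitePlace {w : AbsoluteValue K ℝ} (hw : IsFinitePlace w) :
    ¬ IsInfinitePlace w := fun h => by
  have h1 := apply_natCast_le_one_of_isFinitePlace hw 2
  rw [Nat.cast_two, apply_two_of_isInfinitePlace h] at h1
  norm_num at h1

theorem isNontrivial (w : Place K) : w.1.IsNontrivial := by
  rcases w.2 with h | h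
  · obtain ⟨q, hq, -, a, ha⟩ := exists_zpow_of_isFinitePlace h
    exact ⟨a, w.1.pos_iff.1 (by rw [ha]; linarith), by rw [ha]; exact hq.ne'⟩
  · exact ⟨2, two_ne_zero, by rw [apply_two_of_isInfinitePlace h]; norm_num⟩

/-- The value at `2` separates finite from infinite places. Equivalent finite places have the same
prime, and the normalisation then fixes the absolute value. -/
theorem eq_of_isEquiv {w w' : Place K} (h : w.1.IsEquiv w'.1) : w = w' := by
  have h2 : w.1 2 ≤ 1 ↔ w'.1 2 ≤ 1 := h.le_one_iff
  rcases w.2 with hw | hw <;> rcases w'.2 with hw' | hw'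
  · obtain ⟨v, hv⟩ := hw
    obtain ⟨v', hv'⟩ := hw'
    have hvv : v = v' := by
      have hle : ∀ x : 𝓞 K, x ∈ v.asIdeal ↔ x ∈ v'.asIdeal := fun x => by
        rw [← FinitePlace.norm_lt_one_iff_mem K, ← FinitePlace.norm_lt_one_iff_mem K,
          ← place_apply, ← place_apply, hv, hv', h.lt_one_iff]
      exact HeightOneSpectrum.ext (Ideal.ext hle)
    exact Subtype.ext (by rw [← hv, ← hv', hvv])
  · rw [apply_two_of_isInfinitePlace hw'] at h2
    have := h2.1 (by exact_mod_cast apply_natCast_le_one_of_isFinitePlace hw 2)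
    norm_num at this
  · rw [apply_two_of_isInfinitePlace hw] at h2
    have := h2.2 (by exact_mod_cast apply_natCast_le_one_of_isFinitePlace hw' 2)
    norm_num at this
  · have := (InfinitePlace.eq_iff_isEquiv (w := (⟨w.1, hw⟩ : InfinitePlace K))
      (v := ⟨w'.1, hw'⟩)).2 h
    exact Subtype.ext (congrArg (fun v : InfinitePlace K => v.1) this)

theorem finite_isInfinitePlace : {w : Place K | IsInfinitePlace w.1}.Finite := by
  refine Set.Finite.of_finite_image (f := fun w : Place K => w.1)
    ((Set.finite_range fun v : InfinitePlace K => v.1).subset ?_) Subtype.val_injective.injOn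
  rintro _ ⟨w, hw, rfl⟩
  exact ⟨⟨w.1, hw⟩, rfl⟩

theorem finite_apply_ne_one {x : K} (hx : x ≠ 0) : {w : Place K | w.1 x ≠ 1}.Finite := by
  refine (finite_isInfinitePlace.union (?_ : {w : Place K | IsFinitePlace w.1 ∧ w.1 x ≠ 1}.Finite)).subset
    fun w hw => ?_
  · refine Set.Finite.of_finite_image (f := fun w : Place K => w.1)
      (((FinitePlace.hasFiniteMulSupport hx).image fun v : FinitePlace K => v.1).subset ?_)
      Subtype.val_injective.injOn
    rintro _ ⟨w, hw, rfl⟩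
    exact ⟨⟨w.1, hw.1⟩, hw.2, rfl⟩
  · rcases w.2 with h | h
    · exact Or.inr ⟨h, hw⟩
    · exact Or.inl h

/-- In a completion of a number field, the `n`-th powers contain a neighbourhood of `1`. -/
theorem exists_pow_eq_of_norm_sub_one_lt (w : Place K) {n : ℕ} (hn : n ≠ 0) :
    ∃ ε > 0, ∀ u : (w.Completion)ˣ, ‖(u : w.Completion) - 1‖ < ε → ∃ v, v ^ n = u := by
  have hnt : ∃ x : w.Completion, x ≠ 0 ∧ ‖x‖ ≠ 1 := by
    obtain ⟨a, ha, ha1⟩ := isNontrivial w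
    exact ⟨embed w a, (map_ne_zero _).2 ha, by rwa [norm_embed]⟩
  let _ : NontriviallyNormedField w.Completion := NontriviallyNormedField.ofNormNeOne hnt
  -- In characteristic zero the derivative of `x ^ n` at `1` is nonzero, so the inverse function
  -- theorem makes the power map open there.
  have h1 := (hasStrictDerivAt_pow (𝕜 := w.Completion) n 1).map_nhds_eq (by simpa using hn)
  have h2 : Set.range (fun x : w.Completion => x ^ n) ∈ nhds (1 : w.Completion) := by
    rw [one_pow] at h1
    rw [← h1]
    exact Filter.range_mem_map
  obtain ⟨ε, hε, hball⟩ := Metric.mem_nhds_iff.1 h2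
  refine ⟨ε, hε, fun u hu => ?_⟩
  obtain ⟨y, hy⟩ := hball (show (u : w.Completion) ∈ Metric.ball 1 ε by
    rwa [Metric.mem_ball, dist_eq_norm])
  have hy0 : y ≠ 0 := by
    rintro rfl
    exact u.ne_zero (by rw [← hy]; exact zero_pow hn)
  exact ⟨Units.mk0 y hy0, Units.ext hy⟩

/-- Weak approximation in a number field. -/
theorem exists_norm_embed_sub_lt {T : Set (Place K)} (hT : T.Finite) (z : ∀ w : Place K, w.Completion)
    {ε : ℝ} (hε : 0 < ε) : ∃ c : K, ∀ w ∈ T, ‖embed w c - z w‖ < ε := by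
  have := hT.to_subtype
  have := Fintype.ofFinite T
  have hd := AbsoluteValue.denseRange_algebraMap_pi (v := fun w : T => w.1.1)
    (fun w => isNontrivial w.1) (fun w w' hww h => hww (Subtype.ext (eq_of_isEquiv h)))
  choose a ha using fun w : T => exists_norm_sub_embed_lt w.1 (z w.1) (half_pos hε)
  obtain ⟨c, hc⟩ := hd.exists_dist_lt (fun w : T => WithAbs.toAbs w.1.1 (a w)) (half_pos hε)
  refine ⟨c, fun w hw => ?_⟩
  have h1 := (dist_pi_lt_iff (half_pos hε)).1 hc ⟨w, hw⟩
  rw [dist_comm, dist_eq_norm] at h1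
  have h2 : ‖embed w (c - a ⟨w, hw⟩)‖ < ε / 2 := by
    rw [norm_embed]
    exact h1
  have h3 := ha ⟨w, hw⟩
  rw [norm_sub_rev] at h3
  calc ‖embed w c - z w‖ = ‖embed w (c - a ⟨w, hw⟩) + (embed w (a ⟨w, hw⟩) - z w)‖ := by
        rw [map_sub]; congr 1; ring
    _ < ε := by linarith [norm_add_le (embed w (c - a ⟨w, hw⟩)) (embed w (a ⟨w, hw⟩) - z w)]

/-- The embedding `Kˣ → K_wˣ`. -/
noncomputable abbrev embedUnits (w : Place K) : Kˣ →* (w.Completion)ˣ := Units.map (embed w : K →* w.Completion)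

theorem exists_eq_mul_pow {n : ℕ} (hn : n ≠ 0) (w : Place K) (z : (w.Completion)ˣ) :
    ∃ ε > 0, ∀ u : (w.Completion)ˣ, ‖(u : w.Completion) - z‖ < ε → ∃ r, u = z * r ^ n := by
  obtain ⟨ε, hε, h⟩ := exists_pow_eq_of_norm_sub_one_lt w hn
  have hz : 0 < ‖(z : w.Completion)‖ := norm_pos_iff.2 z.ne_zero
  refine ⟨ε * ‖(z : w.Completion)‖, by positivity, fun u hu => ?_⟩
  obtain ⟨r, hr⟩ := h (u * z⁻¹) (by
    have : ((u * z⁻¹ : (w.Completion)ˣ) : w.Completion) - 1 = (u - z) * (z : w.Completion)⁻¹ := by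
      rw [sub_mul, mul_inv_cancel₀ z.ne_zero]; simp
    rw [this, norm_mul, norm_inv, ← div_eq_mul_inv, div_lt_iff₀ hz]
    exact hu)
  exact ⟨r, by rw [hr, mul_comm u, mul_inv_cancel_left]⟩

/-- A bound `ε` such that every approximation of `z` up to `ε` agrees with `z` up to `n`-th powers
at the places in `T`. -/
theorem exists_approx_bound {T : Set (Place K)} (hT : T.Finite) {n : ℕ} (hn : n ≠ 0)
    (z : ∀ w : Place K, (w.Completion)ˣ) : ∃ ε > 0, ∀ c : K,
      (∀ w ∈ T, ‖embed w c - z w‖ < ε) → ∃ u : Kˣ, (T.Nonempty → (u : K) = c) ∧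
        ∀ w ∈ T, ∃ r, embedUnits w u = z w * r ^ n := by
  choose δ hδ h using fun w : Place K => exists_eq_mul_pow hn w (z w)
  -- For empty `T` nothing prevents `c = 0`, whence the proviso `T.Nonempty` in the conclusion.
  -- Otherwise the bound is also at most some `‖z w‖`, which forces `c ≠ 0`.
  rcases T.eq_empty_or_nonempty with rfl | hne
  · exact ⟨1, one_pos, fun c _ => ⟨1, by simp, by simp⟩⟩
  obtain ⟨w₀, hw₀, hmin⟩ := hT.toFinset.exists_min_image
    (fun w => min (δ w) ‖(z w : w.Completion)‖) (by simpa using hne)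
  refine ⟨min (δ w₀) ‖(z w₀ : w₀.Completion)‖, lt_min (hδ _) (norm_pos_iff.2 (z w₀).ne_zero),
    fun c hc => ?_⟩
  have hc' : ∀ w ∈ T, ‖embed w c - z w‖ < min (δ w) ‖(z w : w.Completion)‖ := fun w hw =>
    (hc w hw).trans_le (hmin w (by simpa using hw))
  have hc0 : c ≠ 0 := by
    rintro rfl
    have := (hc' w₀ (by simpa using hw₀)).trans_le (min_le_right _ _)
    rw [map_zero, zero_sub, norm_neg] at this
    exact this.false
  refine ⟨Units.mk0 c hc0, fun _ => rfl, fun w hw => h w _ ?_⟩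
  exact (hc' w hw).trans_le (min_le_left _ _)

theorem exists_units_eq_mul_pow {T : Set (Place K)} (hT : T.Finite) {n : ℕ} (hn : n ≠ 0)
    (z : ∀ w : Place K, (w.Completion)ˣ) :
    ∃ u : Kˣ, ∀ w ∈ T, ∃ r, embedUnits w u = z w * r ^ n := by
  obtain ⟨ε, hε, h⟩ := exists_approx_bound hT hn z
  obtain ⟨c, hc⟩ := exists_norm_embed_sub_lt hT (fun w => (z w : w.Completion)) hε
  obtain ⟨u, -, hu⟩ := h c hc
  exact ⟨u, hu⟩

end Place

/-! ### Completions at finite places: valuation, power classes, torsion. -/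

open NumberField IsDedekindDomain

namespace Place

variable {K : Type*} [Field K] [NumberField K]

section FinitePlace

variable {w : Place K}

theorem norm_add_le_max (hw : IsFinitePlace w.1) (x y : w.Completion) :
    ‖x + y‖ ≤ max ‖x‖ ‖y‖ := by
  induction x, y using UniformSpace.Completion.induction_on₂ with
  | hp => exact isClosed_le (by fun_prop) (by fun_prop)
  | ih a b =>
    rw [← UniformSpace.Completion.coe_add, UniformSpace.Completion.norm_coe,
      UniformSpace.Completion.norm_coe, UniformSpace.Completion.norm_coe]
    exact isNonarchimedean_of_isFinitePlace hw a.ofAbs b.ofAbs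

theorem norm_sub_le_max (hw : IsFinitePlace w.1) (x y : w.Completion) :
    ‖x - y‖ ≤ max ‖x‖ ‖y‖ := by
  simpa [sub_eq_add_neg] using norm_add_le_max hw x (-y)

theorem norm_eq_of_norm_sub_lt (hw : IsFinitePlace w.1) {x y : w.Completion} (h : ‖x - y‖ < ‖x‖) :
    ‖y‖ = ‖x‖ := by
  apply le_antisymm
  · have := norm_sub_le_max hw x (x - y)
    rw [sub_sub_cancel] at this
    exact this.trans (max_le le_rfl h.le)
  · have := norm_add_le_max hw (x - y) y
    rw [sub_add_cancel] at this
    exact (le_max_iff.1 this).resolve_left (not_le.2 h)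

theorem exists_apply_eq_norm (hw : IsFinitePlace w.1) {x : w.Completion} (hx : x ≠ 0) :
    ∃ a : K, a ≠ 0 ∧ w.1 a = ‖x‖ := by
  obtain ⟨a, ha⟩ := exists_norm_sub_embed_lt w x (norm_pos_iff.2 hx)
  have := norm_eq_of_norm_sub_lt hw ha
  rw [norm_embed] at this
  refine ⟨a, ?_, this⟩
  rintro rfl
  rw [map_zero] at this
  exact (norm_pos_iff.2 hx).ne this

/-- The normalised order at a finite place, up to sign. -/
theorem exists_ord (hw : IsFinitePlace w.1) :
    ∃ (q : ℝ) (f : Additive (w.Completion)ˣ →+ ℤ), 1 < q ∧ (∃ a : Kˣ, f (.ofMul (embedUnits w a)) = 1) ∧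
      ∀ u : (w.Completion)ˣ, ‖(u : w.Completion)‖ = q ^ f (.ofMul u) := by
  obtain ⟨q, hq, hval, a, ha⟩ := exists_zpow_of_isFinitePlace hw
  have h1 : ∀ u : (w.Completion)ˣ, ∃ k : ℤ, ‖(u : w.Completion)‖ = q ^ k := fun u => by
    obtain ⟨b, hb, hbu⟩ := exists_apply_eq_norm hw u.ne_zero
    obtain ⟨k, hk⟩ := hval b hb
    exact ⟨k, by rw [← hbu, hk]⟩
  choose f hf using h1
  have hinj := zpow_right_injective₀ (zero_lt_one.trans hq) hq.ne'
  let f' : Additive (w.Completion)ˣ →+ ℤ := AddMonoidHom.mk' (fun u => f u.toMul) fun u v => hinj (by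
    change q ^ f (u.toMul * v.toMul) = q ^ (f u.toMul + f v.toMul)
    rw [← hf, zpow_add₀ (zero_lt_one.trans hq).ne', ← hf, ← hf, Units.val_mul, norm_mul])
  have ha0 : a ≠ 0 := by
    rintro rfl
    rw [map_zero] at ha
    linarith
  refine ⟨q, f', hq, ⟨Units.mk0 a ha0, hinj ?_⟩, hf⟩
  change q ^ f (embedUnits w (Units.mk0 a ha0)) = q ^ (1 : ℤ)
  rw [← hf, zpow_one, ← ha]
  exact norm_embed w a

theorem exists_finite_net (hw : IsFinitePlace w.1) {ε : ℝ} (hε : 0 < ε) :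
    ∃ F : Set K, F.Finite ∧ ∀ x : w.Completion, ‖x‖ ≤ 1 → ∃ f ∈ F, ‖x - embed w f‖ < ε := by
  obtain ⟨F, hF, h⟩ := exists_finite_net_of_isFinitePlace hw (lt_min hε one_pos)
  refine ⟨F, hF, fun x hx => ?_⟩
  obtain ⟨a, ha⟩ := exists_norm_sub_embed_lt w x (lt_min hε one_pos)
  have ha1 : w.1 a ≤ 1 := by
    rw [← norm_embed]
    have := norm_sub_le_max hw x (x - embed w a)
    rw [sub_sub_cancel] at this
    exact this.trans (max_le hx (ha.le.trans (min_le_right _ _)))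
  obtain ⟨f, hf, hfa⟩ := h a ha1
  refine ⟨f, hf, ?_⟩
  have h2 : x - embed w f = (x - embed w a) + embed w (a - f) := by rw [map_sub]; ring
  rw [h2]
  refine (norm_add_le_max hw _ _).trans_lt (max_lt (ha.trans_le (min_le_left _ _)) ?_)
  rw [norm_embed]
  exact hfa.trans_le (min_le_left _ _)

/-- Write `u = v * π ^ k` with `v` a unit. Only `k` modulo `n` matters, and `v` differs by an `n`-th
power from a nearby point of a finite net. -/
theorem exists_finite_cosets_of_isFinitePlace (hw : IsFinitePlace w.1) {n : ℕ} (hn : n ≠ 0) :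
    ∃ F : Set (w.Completion)ˣ, F.Finite ∧ ∀ u, ∃ f ∈ F, ∃ b, u = f * b ^ n := by
  obtain ⟨q, ord, hq, ⟨a, ha⟩, hord⟩ := exists_ord hw
  obtain ⟨ε, hε, hpow⟩ := exists_pow_eq_of_norm_sub_one_lt w hn
  -- A radius at most `1` ensures that net points close to an element of norm `1` are nonzero.
  obtain ⟨F, hF, hnet⟩ := exists_finite_net hw (lt_min hε one_pos)
  let π := embedUnits w a
  let G : Set w.Completion := (fun p : ℕ × K => (π : w.Completion) ^ p.1 * embed w p.2) ''
    (Set.Iio n ×ˢ F)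
  have hG : G.Finite := ((Set.finite_Iio n).prod hF).image _
  refine ⟨Units.val ⁻¹' G, hG.preimage Units.val_injective.injOn, fun u => ?_⟩
  set k : ℤ := ord (.ofMul u) with hk
  set v : (w.Completion)ˣ := u * π ^ (-k) with hv
  have hv1 : ‖(v : w.Completion)‖ = 1 := by
    have : ord (.ofMul v) = 0 := by
      rw [hv, ofMul_mul, ofMul_zpow, map_add, map_zsmul, ha, ← hk]
      simp
    rw [hord, this, zpow_zero]
  obtain ⟨f, hf, hvf⟩ := hnet v hv1.le
  have hf0 : embed w f ≠ 0 := by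
    intro h0
    rw [h0, sub_zero, hv1] at hvf
    exact (hvf.trans_le (min_le_right _ _)).false
  obtain ⟨r, hr⟩ := hpow (Units.mk0 _ hf0 * v⁻¹) (by
    have : ((Units.mk0 _ hf0 * v⁻¹ : (w.Completion)ˣ) : w.Completion) - 1 =
        (embed w f - v) * (v : w.Completion)⁻¹ := by
      rw [sub_mul, mul_inv_cancel₀ v.ne_zero]; simp
    rw [this, norm_mul, norm_inv, hv1, inv_one, mul_one, norm_sub_rev]
    exact hvf.trans_le (min_le_left _ _))
  have hn0 : (0 : ℤ) < n := by exact_mod_cast Nat.pos_of_ne_zero hn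
  have hkm : ((k % n).toNat : ℤ) = k % n := Int.toNat_of_nonneg (Int.emod_nonneg _ hn0.ne')
  refine ⟨π ^ (k % n).toNat * Units.mk0 _ hf0, ⟨((k % n).toNat, f), ⟨?_, hf⟩, rfl⟩,
    π ^ (k / n) * r⁻¹, ?_⟩
  · have := Int.emod_lt_of_pos k hn0
    exact Set.mem_Iio.2 (by omega)
  · have h1 : u = v * π ^ k := by rw [hv, mul_assoc, ← zpow_add, neg_add_cancel, zpow_zero, mul_one]
    have h2 : π ^ k = π ^ (k % n).toNat * (π ^ (k / n)) ^ n := by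
      rw [← zpow_natCast (π ^ (k / n)), ← zpow_mul, ← zpow_natCast π, hkm, ← zpow_add,
        mul_comm, Int.emod_add_mul_ediv]
    have h3 : v = Units.mk0 _ hf0 * (r ^ n)⁻¹ := by rw [hr]; simp
    rw [h1, h2, h3, mul_pow, inv_pow, mul_comm (Units.mk0 _ hf0 * (r ^ n)⁻¹), mul_assoc, mul_assoc]
    congr 1
    rw [mul_left_comm]

/-- The `ℓ`-power roots of unity are uniformly separated in a totally bounded ball, hence finite in
number. Separation: near `1` the only `ℓ`-th root of unity is `1`, and `‖ζ ^ ℓ - 1‖ ≤ ‖ζ - 1‖`, so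
by induction on the exponent any `ζ` near `1` equals `1`. -/
theorem exists_torsion_bound_of_isFinitePlace (hw : IsFinitePlace w.1) (ℓ : ℕ) [hℓ : Fact ℓ.Prime] :
    ∃ c : ℕ, ∀ (ζ : (w.Completion)ˣ) (n : ℕ), ζ ^ ℓ ^ n = 1 → ζ ^ ℓ ^ c = 1 := by
  have hfin : {x : w.Completion | x ^ ℓ = 1}.Finite := by
    refine ((Polynomial.nthRootsFinset ℓ (1 : w.Completion)).finite_toSet).subset fun x hx => ?_
    exact (Polynomial.mem_nthRootsFinset hℓ.out.pos _).2 hx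
  obtain ⟨ε, hε, hε1⟩ : ∃ ε > 0, ∀ x : w.Completion, x ^ ℓ = 1 → ‖x - 1‖ < ε → x = 1 := by
    have h1 : ({x : w.Completion | x ^ ℓ = 1} \ {1})ᶜ ∈ nhds (1 : w.Completion) :=
      (hfin.subset Set.sdiff_subset).isClosed.isOpen_compl.mem_nhds (by simp)
    obtain ⟨ε, hε, h⟩ := Metric.mem_nhds_iff.1 h1
    refine ⟨ε, hε, fun x hx hx1 => ?_⟩
    by_contra hne
    exact h (show x ∈ Metric.ball 1 ε by rwa [Metric.mem_ball, dist_eq_norm]) ⟨hx, hne⟩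
  have hnorm : ∀ (ζ : (w.Completion)ˣ) (n : ℕ), ζ ^ ℓ ^ n = 1 → ‖(ζ : w.Completion)‖ = 1 := by
    intro ζ n h
    have h2 : ‖(ζ : w.Completion)‖ ^ ℓ ^ n = 1 := by
      rw [← norm_pow, ← Units.val_pow_eq_pow_val, h]; simp
    exact (pow_eq_one_iff_of_nonneg (norm_nonneg _) (pow_ne_zero _ hℓ.out.ne_zero)).1 h2
  have hball : ∀ (n : ℕ) (ζ : (w.Completion)ˣ), ζ ^ ℓ ^ n = 1 → ‖(ζ : w.Completion) - 1‖ < ε →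
      ζ = 1 := by
    intro n
    induction n with
    | zero => intro ζ h _; simpa using h
    | succ n ih =>
      intro ζ h hlt
      have h1 : ζ ^ ℓ = 1 := by
        refine ih (ζ ^ ℓ) (by rw [← pow_mul, ← pow_succ', h]) (lt_of_le_of_lt ?_ hlt)
        have hle : ∀ m : ℕ, ‖(ζ : w.Completion) ^ m - 1‖ ≤ ‖(ζ : w.Completion) - 1‖ := by
          intro m
          induction m with
          | zero => simp
          | succ m ihm =>
            have : (ζ : w.Completion) ^ (m + 1) - 1 = ζ * (ζ ^ m - 1) + (ζ - 1) := by ring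
            rw [this]
            refine (norm_add_le_max hw _ _).trans (max_le ?_ le_rfl)
            rw [norm_mul, hnorm ζ _ h, one_mul]
            exact ihm
        exact hle ℓ
      exact Units.ext (hε1 ζ (by rw [← Units.val_pow_eq_pow_val, h1]; rfl) hlt)
  obtain ⟨F, hF, hnet⟩ := exists_finite_net hw (half_pos hε)
  let H : Set (w.Completion)ˣ := {ζ | ∃ n, ζ ^ ℓ ^ n = 1}
  have hHnet : ∀ ζ : H, ∃ f : F, ‖((ζ : (w.Completion)ˣ) : w.Completion) - embed w f‖ < ε / 2 := by
    rintro ⟨ζ, n, hn⟩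
    obtain ⟨f, hf, h⟩ := hnet ζ (hnorm ζ n hn).le
    exact ⟨⟨f, hf⟩, h⟩
  choose g hg using hHnet
  have hginj : Function.Injective g := by
    rintro ⟨ζ, n, hn⟩ ⟨ξ, m, hm⟩ h
    have h1 := hg ⟨ζ, n, hn⟩
    have h2 := hg ⟨ξ, m, hm⟩
    rw [← h] at h2
    have h3 : ζ * ξ⁻¹ = 1 := by
      refine hball (n + m) _ ?_ ?_
      · rw [mul_pow, pow_add, pow_mul, hn, one_pow, one_mul, inv_pow, mul_comm, pow_mul, hm,
          one_pow, inv_one]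
      · have : ((ζ * ξ⁻¹ : (w.Completion)ˣ) : w.Completion) - 1 =
            (ζ - ξ) * (ξ : w.Completion)⁻¹ := by
          rw [sub_mul, mul_inv_cancel₀ ξ.ne_zero]; simp
        rw [this, norm_mul, norm_inv, hnorm ξ m hm, inv_one, mul_one]
        calc ‖(ζ : w.Completion) - ξ‖ = ‖((ζ : w.Completion) - embed w (g ⟨ζ, n, hn⟩)) -
              (ξ - embed w (g ⟨ζ, n, hn⟩))‖ := by congr 1; ring
          _ ≤ _ := norm_sub_le _ _
          _ < ε / 2 + ε / 2 := add_lt_add h1 h2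
          _ = ε := add_halves ε
    exact Subtype.ext (mul_inv_eq_one.1 h3)
  have := hF.to_subtype
  have hHfin : Finite H := Finite.of_injective g hginj
  -- A crude exponent: if `ζ` has order `ℓ ^ a`, then `a < ℓ ^ a ≤ Nat.card H`.
  refine ⟨Nat.card H, fun ζ n hn => ?_⟩
  obtain ⟨a, -, ha⟩ := (Nat.dvd_prime_pow hℓ.out).1 (orderOf_dvd_of_pow_eq_one hn)
  have hcard : orderOf ζ ≤ Nat.card H := by
    rw [← Nat.card_zpowers]
    refine Nat.card_mono (Set.toFinite H) ?_
    rintro _ ⟨k, rfl⟩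
    refine ⟨n, ?_⟩
    rw [← zpow_natCast, ← zpow_mul, mul_comm, zpow_mul, zpow_natCast, hn, one_zpow]
  refine orderOf_dvd_iff_pow_eq_one.1 ?_
  rw [ha]
  refine pow_dvd_pow ℓ ((Nat.lt_pow_self hℓ.out.one_lt).le.trans ?_)
  rw [← ha]
  exact hcard

end FinitePlace

/-! ### Completions at infinite places: powers, signs, torsion. -/

section InfinitePlace

variable {w : Place K}

theorem nonempty_ringEquiv_of_isInfinitePlace (hw : IsInfinitePlace w.1) :
    Nonempty (w.Completion ≃+* ℝ) ∨ Nonempty (w.Completion ≃+* ℂ) := by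
  let v : InfinitePlace K := ⟨w.1, hw⟩
  rcases v.isReal_or_isComplex with h | h
  · exact Or.inl ⟨(InfinitePlace.Completion.equiv v).symm.trans
      (InfinitePlace.Completion.ringEquivRealOfIsReal h)⟩
  · exact Or.inr ⟨(InfinitePlace.Completion.equiv v).symm.trans
      (InfinitePlace.Completion.ringEquivComplexOfIsComplex h)⟩

theorem exists_pow_eq_of_ringEquiv_complex (e : w.Completion ≃+* ℂ) (u : (w.Completion)ˣ) {n : ℕ}
    (hn : n ≠ 0) : ∃ v, v ^ n = u := by
  obtain ⟨z, hz⟩ := IsAlgClosed.exists_pow_nat_eq (e u) (Nat.pos_of_ne_zero hn)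
  have h : (e.symm z) ^ n = u := by rw [← map_pow, hz, e.symm_apply_apply]
  have h0 : e.symm z ≠ 0 := by
    intro h0
    rw [h0, zero_pow hn] at h
    exact u.ne_zero h.symm
  exact ⟨Units.mk0 _ h0, Units.ext h⟩

theorem exists_pow_eq_or_of_ringEquiv_real (e : w.Completion ≃+* ℝ) (u : (w.Completion)ˣ) {n : ℕ}
    (hn : n ≠ 0) : ∃ v, v ^ n = u ∨ v ^ n = -u := by
  have key : ∀ r : ℝ, 0 < r → ∃ v : (w.Completion)ˣ, (v : w.Completion) ^ n = e.symm r := by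
    intro r hr
    have h0 : e.symm (r ^ ((n : ℝ)⁻¹)) ≠ 0 := by
      rw [map_ne_zero]; positivity
    refine ⟨Units.mk0 _ h0, ?_⟩
    rw [Units.val_mk0, ← map_pow, Real.rpow_inv_natCast_pow hr.le hn]
  rcases lt_or_gt_of_ne ((map_ne_zero e).2 u.ne_zero) with h | h
  · obtain ⟨v, hv⟩ := key (-e u) (by linarith)
    exact ⟨v, Or.inr (Units.ext (by simpa using hv))⟩
  · obtain ⟨v, hv⟩ := key (e u) h
    exact ⟨v, Or.inl (Units.ext (by simpa using hv))⟩

theorem not_isSquare_neg_one_of_ringEquiv_real (e : w.Completion ≃+* ℝ) :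
    ¬ IsSquare (-1 : (w.Completion)ˣ) := by
  rintro ⟨v, hv⟩
  have h := congrArg (fun u : (w.Completion)ˣ => e u) hv
  simp only [Units.val_neg, Units.val_one, map_neg, map_one, Units.val_mul, map_mul] at h
  nlinarith [mul_self_nonneg (e v)]

/-- The complex/real dichotomy, expressed inside the group `K_wˣ` so that it can be transported
along field homomorphisms. -/
theorem isSquare_neg_one_or_of_isInfinitePlace (hw : IsInfinitePlace w.1) :
    (∀ (u : (w.Completion)ˣ) (n : ℕ), n ≠ 0 → ∃ v, v ^ n = u) ∨
    ((∀ (u : (w.Completion)ˣ) (n : ℕ), n ≠ 0 → ∃ v, v ^ n = u ∨ v ^ n = -u) ∧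
      ¬ IsSquare (-1 : (w.Completion)ˣ)) := by
  rcases nonempty_ringEquiv_of_isInfinitePlace hw with ⟨⟨e⟩⟩ | ⟨⟨e⟩⟩
  · exact Or.inr ⟨fun u n hn => exists_pow_eq_or_of_ringEquiv_real e u hn,
      not_isSquare_neg_one_of_ringEquiv_real e⟩
  · exact Or.inl fun u n hn => exists_pow_eq_of_ringEquiv_complex e u hn

theorem isSquare_or_isSquare_neg (hw : IsInfinitePlace w.1) (u : (w.Completion)ˣ) :
    IsSquare u ∨ IsSquare (-u) := by
  rcases isSquare_neg_one_or_of_isInfinitePlace hw with h | ⟨h, -⟩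
  · obtain ⟨v, hv⟩ := h u 2 two_ne_zero
    exact Or.inl ⟨v, by rw [← hv, sq]⟩
  · obtain ⟨v, hv | hv⟩ := h u 2 two_ne_zero
    · exact Or.inl ⟨v, by rw [← hv, sq]⟩
    · exact Or.inr ⟨v, by rw [← hv, sq]⟩

/-- The sign character at an infinite place; it is trivial at a complex place. -/
theorem exists_sign (hw : IsInfinitePlace w.1) :
    ∃ f : Additive (w.Completion)ˣ →+ ZMod 2, ∀ u, f (.ofMul u) = 0 ↔ IsSquare u := by
  classical
  have hsq : ∀ u v : (w.Completion)ˣ, IsSquare u → (IsSquare (u * v) ↔ IsSquare v) :=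
    fun u v hu => ⟨fun h => by simpa using hu.inv.mul h, fun h => hu.mul h⟩
  have hns : ∀ u v : (w.Completion)ˣ, ¬ IsSquare u → ¬ IsSquare v → IsSquare (u * v) := by
    intro u v hu hv
    have := ((isSquare_or_isSquare_neg hw u).resolve_left hu).mul
      ((isSquare_or_isSquare_neg hw v).resolve_left hv)
    rwa [neg_mul_neg] at this
  refine ⟨AddMonoidHom.mk' (fun u => if IsSquare u.toMul then 0 else 1) fun u v => ?_, fun u => ?_⟩
  · rw [toMul_add]
    by_cases hu : IsSquare u.toMul
    · simp only [hsq _ _ hu, hu, if_true, zero_add]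
    · by_cases hv : IsSquare v.toMul
      · rw [mul_comm]
        simp only [hsq _ _ hv, hv, hu, if_true, if_false, add_zero]
      · simp only [hns _ _ hu hv, hu, hv, if_true, if_false]
        rfl
  · change (if IsSquare u then (0 : ZMod 2) else 1) = 0 ↔ _
    split_ifs with h
    · simp [h]
    · simp [h]

theorem exists_torsion_bound_of_ringEquiv_real (e : w.Completion ≃+* ℝ) (ℓ : ℕ)
    [hℓ : Fact ℓ.Prime] :
    ∃ c : ℕ, ∀ (ζ : (w.Completion)ˣ) (n : ℕ), ζ ^ ℓ ^ n = 1 → ζ ^ ℓ ^ c = 1 := by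
  refine ⟨1, fun ζ n h => ?_⟩
  rcases n with _ | n
  · rw [pow_zero, pow_one] at h
    rw [h, one_pow]
  have h1 : (e ζ) ^ ℓ ^ (n + 1) = 1 := by
    rw [← map_pow, ← Units.val_pow_eq_pow_val, h, Units.val_one, map_one]
  have h2 : |e ζ| = 1 := by
    have : |e ζ| ^ ℓ ^ (n + 1) = 1 := by rw [← abs_pow, h1, abs_one]
    exact (pow_eq_one_iff_of_nonneg (abs_nonneg _) (pow_ne_zero _ hℓ.out.ne_zero)).1 this
  have h3 : ∀ {r : ℝ}, r ^ ℓ ^ 1 = 1 → e ζ = r → ζ ^ ℓ ^ 1 = 1 := fun {r} hr he => by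
    apply Units.ext
    apply e.injective
    rw [Units.val_pow_eq_pow_val, map_pow, he, hr, Units.val_one, map_one]
  rcases (abs_eq zero_le_one).1 h2 with h2 | h2
  · exact h3 (one_pow _) h2
  · refine h3 ?_ h2
    rw [pow_one]
    rw [h2] at h1
    rcases Nat.even_or_odd ℓ with hev | hodd
    · exact hev.neg_one_pow
    · rw [(hodd.pow).neg_one_pow] at h1
      norm_num at h1

end InfinitePlace

/-- At every place, either `K_wˣ` is `ℓ`-divisible, or its `ℓ`-power torsion is bounded and it is
finite modulo `ℓ`-th powers. -/
theorem divisible_or_finite (w : Place K) (ℓ : ℕ) [hℓ : Fact ℓ.Prime] :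
    (∀ (u : (w.Completion)ˣ) (n : ℕ), ∃ v, v ^ ℓ ^ n = u) ∨
    ((∃ c : ℕ, ∀ (ζ : (w.Completion)ˣ) (n : ℕ), ζ ^ ℓ ^ n = 1 → ζ ^ ℓ ^ c = 1) ∧
      ∃ F : Set (w.Completion)ˣ, F.Finite ∧ ∀ u, ∃ f ∈ F, ∃ b, u = f * b ^ ℓ) := by
  rcases w.2 with hw | hw
  · exact Or.inr ⟨exists_torsion_bound_of_isFinitePlace hw ℓ,
      exists_finite_cosets_of_isFinitePlace hw hℓ.out.ne_zero⟩
  · rcases nonempty_ringEquiv_of_isInfinitePlace hw with ⟨⟨e⟩⟩ | ⟨⟨e⟩⟩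
    · refine Or.inr ⟨exists_torsion_bound_of_ringEquiv_real e ℓ, {1, -1}, by simp, fun u => ?_⟩
      obtain ⟨v, hv | hv⟩ := exists_pow_eq_or_of_ringEquiv_real e u hℓ.out.ne_zero
      · exact ⟨1, by simp, v, by rw [hv, one_mul]⟩
      · exact ⟨-1, by simp, v, by rw [hv, neg_one_mul, neg_neg]⟩
    · exact Or.inl fun u n => exists_pow_eq_of_ringEquiv_complex e u (pow_ne_zero n hℓ.out.ne_zero)

end Place

/-! ### Galois action on products of completions and semilocal Hilbert 90. -/

open NumberField

section Semilocal

variable {K N : Type*} [Field K] [NumberField K] [Field N] [NumberField N] [Algebra K N]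

variable (K N) in
/-- The action of the Galois group on `∏_W N_W`. -/
noncomputable def completionsAct :
    (N ≃ₐ[K] N) →* ((∀ W : Place N, W.Completion) →+* (∀ W : Place N, W.Completion)) where
  toFun τ := RingHom.pi fun W =>
    (Place.completionMap (τ : N ≃+* N) W).comp (Pi.evalRingHom _ (Place.comap (τ : N ≃+* N) W))
  map_one' := by
    refine RingHom.ext fun x => funext fun W => ?_
    exact Place.completionMap_refl W _
  map_mul' σ τ := by
    refine RingHom.ext fun x => funext fun W => ?_
    exact Place.completionMap_comp (σ : N ≃+* N) (τ : N ≃+* N) W _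

/-- The action of the Galois group on `∏_W N_Wˣ`. -/
noncomputable def unitsAct (τ : N ≃ₐ[K] N) :
    (∀ W : Place N, (W.Completion)ˣ) →* (∀ W : Place N, (W.Completion)ˣ) :=
  MonoidHom.pi fun W =>
    (Units.map (Place.completionMap (τ : N ≃+* N) W : _ →* W.Completion)).comp
      (Pi.evalMonoidHom _ (Place.comap (τ : N ≃+* N) W))

theorem unitsAct_one (x : ∀ W : Place N, (W.Completion)ˣ) : unitsAct (1 : N ≃ₐ[K] N) x = x :=
  funext fun W => Units.ext (Place.completionMap_refl W _)

theorem unitsAct_mul (σ τ : N ≃ₐ[K] N) (x : ∀ W : Place N, (W.Completion)ˣ) :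
    unitsAct (σ * τ) x = unitsAct σ (unitsAct τ x) :=
  funext fun W => Units.ext (Place.completionMap_comp (σ : N ≃+* N) (τ : N ≃+* N) W _)

theorem unitsAct_apply (τ : N ≃ₐ[K] N) (x : ∀ W : Place N, (W.Completion)ˣ) (W : Place N) :
    unitsAct τ x W = Units.map (Place.completionMap (τ : N ≃+* N) W : _ →* W.Completion)
      (x (Place.comap (τ : N ≃+* N) W)) := rfl

variable (N) in
/-- The diagonal embedding `Nˣ → ∏_W N_Wˣ`. -/
noncomputable def diagUnits : Nˣ →* (∀ W : Place N, (W.Completion)ˣ) :=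
  MonoidHom.pi fun W => Place.embedUnits W

variable (N) in
/-- The diagonal embedding `N → ∏_W N_W`. -/
noncomputable def diagCompletions : N →+* (∀ W : Place N, W.Completion) :=
  RingHom.pi fun W => Place.embed W

theorem completionsAct_diag (τ : N ≃ₐ[K] N) (c : N) :
    completionsAct K N τ (diagCompletions N c) = diagCompletions N (τ c) :=
  funext fun W => Place.completionMap_embed (τ : N ≃+* N) W c

theorem unitsAct_diag (τ : N ≃ₐ[K] N) (c : Nˣ) :
    unitsAct τ (diagUnits N c) = diagUnits N (Units.map (τ : N →* N) c) :=
  funext fun W => Units.ext (Place.completionMap_embed (τ : N ≃+* N) W c)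

/-- The elements of `∏_W N_Wˣ` that are `n`-th powers at the places in `T`. -/
def powOn (T : Set (Place N)) (n : ℕ) : Subgroup (∀ W : Place N, (W.Completion)ˣ) where
  carrier := {x | ∀ W ∈ T, ∃ r, x W = r ^ n}
  one_mem' W _ := ⟨1, by simp⟩
  mul_mem' hx hy W hW := by
    obtain ⟨r, hr⟩ := hx W hW
    obtain ⟨s, hs⟩ := hy W hW
    exact ⟨r * s, by rw [Pi.mul_apply, hr, hs, mul_pow]⟩
  inv_mem' hx W hW := by
    obtain ⟨r, hr⟩ := hx W hW
    exact ⟨r⁻¹, by rw [Pi.inv_apply, hr, inv_pow]⟩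

theorem pow_mem_powOn (T : Set (Place N)) (n : ℕ) (x : ∀ W : Place N, (W.Completion)ˣ) :
    x ^ n ∈ powOn T n := fun W _ => ⟨x W, rfl⟩

theorem exists_pow_of_mem_powOn {T : Set (Place N)} {n : ℕ} {x : ∀ W : Place N, (W.Completion)ˣ}
    (hx : x ∈ powOn T n) : ∃ r : ∀ W : Place N, (W.Completion)ˣ, ∀ W ∈ T, x W = (r ^ n) W := by
  classical
  have : ∀ W, ∃ r : (W.Completion)ˣ, W ∈ T → x W = r ^ n := fun W => by
    by_cases hW : W ∈ T
    · obtain ⟨r, hr⟩ := hx W hW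
      exact ⟨r, fun _ => hr⟩
    · exact ⟨1, fun h => absurd h hW⟩
  choose r hr using this
  exact ⟨r, hr⟩

/-- Galois stability of a set of places. -/
def IsStable (K : Type*) [Field K] [Algebra K N] (T : Set (Place N)) : Prop :=
  ∀ (τ : N ≃ₐ[K] N) (W : Place N), W ∈ T → Place.comap (τ : N ≃+* N) W ∈ T

theorem IsStable.unitsAct_eqOn {T : Set (Place N)} (hT : IsStable K T) (τ : N ≃ₐ[K] N)
    {x y : ∀ W : Place N, (W.Completion)ˣ} (h : ∀ W ∈ T, x W = y W) :
    ∀ W ∈ T, unitsAct τ x W = unitsAct τ y W := fun W hW => by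
  rw [unitsAct_apply, unitsAct_apply, h _ (hT τ W hW)]

theorem IsStable.unitsAct_mem_powOn {T : Set (Place N)} (hT : IsStable K T) (τ : N ≃ₐ[K] N) {n : ℕ}
    {x : ∀ W : Place N, (W.Completion)ˣ} (h : x ∈ powOn T n) : unitsAct τ x ∈ powOn T n :=
  fun W hW => by
    obtain ⟨r, hr⟩ := h _ (hT τ W hW)
    exact ⟨Units.map (Place.completionMap (τ : N ≃+* N) W : _ →* W.Completion) r, by
      rw [unitsAct_apply, hr, map_pow]⟩

theorem IsStable.unitsAct_eqOn_of_generator {T : Set (Place N)} (hT : IsStable K T)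
    {σ : N ≃ₐ[K] N} (hσ : ∀ τ, τ ∈ Subgroup.zpowers σ) {x : ∀ W : Place N, (W.Completion)ˣ}
    (h : ∀ W ∈ T, unitsAct σ x W = x W) (τ : N ≃ₐ[K] N) :
    ∀ W ∈ T, unitsAct τ x W = x W := by
  have : FiniteDimensional K N := Module.Finite.of_restrictScalars_finite ℚ K N
  obtain ⟨i, rfl⟩ := (mem_powers_iff_mem_zpowers.2 (hσ τ) : τ ∈ Submonoid.powers σ)
  change ∀ W ∈ T, unitsAct (σ ^ i) x W = x W
  induction i with
  | zero =>
    intro W _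
    rw [pow_zero, unitsAct_one]
  | succ i ih =>
    intro W hW
    rw [pow_succ', unitsAct_mul, hT.unitsAct_eqOn σ ih W hW, h W hW]

theorem exists_diagUnits_div_mem_powOn {T : Set (Place N)} (hT : T.Finite) {n : ℕ} (hn : n ≠ 0)
    (z : ∀ W : Place N, (W.Completion)ˣ) : ∃ u : Nˣ, diagUnits N u / z ∈ powOn T n := by
  obtain ⟨u, hu⟩ := Place.exists_units_eq_mul_pow hT hn z
  refine ⟨u, fun W hW => ?_⟩
  obtain ⟨r, hr⟩ := hu W hW
  exact ⟨r, div_eq_of_eq_mul' hr⟩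

variable [IsGalois K N]

instance : FiniteDimensional K N := Module.Finite.of_restrictScalars_finite ℚ K N

theorem prod_unitsAct_eq_prod_range {σ : N ≃ₐ[K] N} (hσ : ∀ τ, τ ∈ Subgroup.zpowers σ)
    (y : ∀ W : Place N, (W.Completion)ˣ) :
    ∏ τ : N ≃ₐ[K] N, unitsAct τ y = ∏ i ∈ Finset.range (orderOf σ), unitsAct (σ ^ i) y := by
  classical
  rw [← IsCyclic.image_range_orderOf hσ, Finset.prod_image]
  intro i hi j hj h
  exact pow_injOn_Iio_orderOf (by simpa using hi) (by simpa using hj) h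

/-- For one place this is independence of the characters `embed W ∘ σ ^ i`, the coefficients not
being all zero because `p 0 = 1`. For finitely many places at once: a `ℚ`-vector space is not a
finite union of proper subspaces. -/
theorem exists_sum_ne_zero {σ : N ≃ₐ[K] N} {T : Set (Place N)} (hT : T.Finite)
    (p : ℕ → ∀ W : Place N, W.Completion) (hp : p 0 = 1) (hσ : 0 < orderOf σ) :
    ∃ c : N, ∀ W ∈ T,
      (∑ i ∈ Finset.range (orderOf σ), p i * diagCompletions N ((σ ^ i) c)) W ≠ 0 := by
  have := hT.to_subtype
  let F : ∀ W : Place N, N →+ W.Completion := fun W =>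
    AddMonoidHom.mk' (fun c => (∑ i ∈ Finset.range (orderOf σ),
      p i * diagCompletions N ((σ ^ i) c)) W) fun a b => by
        simp only [map_add, mul_add, Finset.sum_add_distrib, Pi.add_apply]
  by_contra! hc
  let V : T → Submodule ℚ N := fun W => LinearMap.ker (F W.1).toRatLinearMap
  obtain ⟨W, hW⟩ := Subspace.exists_eq_top_of_iUnion_eq_univ (k := ℚ) (p := V) (by
    refine Set.eq_univ_of_forall fun c => ?_
    obtain ⟨W, hW, h⟩ := hc c
    exact Set.mem_iUnion.2 ⟨⟨W, hW⟩, h⟩)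
  let χ : Fin (orderOf σ) → (N →* W.1.Completion) := fun i =>
    ((Place.embed W.1).comp ((σ ^ (i : ℕ) : N ≃ₐ[K] N) : N →+* N) : N →+* W.1.Completion)
  have hχ : Function.Injective χ := by
    intro i j h
    have h1 : σ ^ (i : ℕ) = σ ^ (j : ℕ) := by
      ext c
      exact (Place.embed W.1).injective (DFunLike.congr_fun h c)
    exact Fin.ext (pow_injOn_Iio_orderOf i.2 j.2 h1)
  have hli := (linearIndependent_monoidHom N W.1.Completion).comp χ hχ
  rw [Fintype.linearIndependent_iff] at hli
  have h0 := hli (fun i => p i W.1) (by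
    funext c
    have h1 : c ∈ V W := by rw [hW]; trivial
    have h2 : F W.1 c = 0 := h1
    have h3 : F W.1 c = ∑ i ∈ Finset.range (orderOf σ),
        p i W.1 * Place.embed W.1 ((σ ^ i) c) := by
      change (∑ i ∈ Finset.range (orderOf σ), p i * diagCompletions N ((σ ^ i) c)) W.1 = _
      rw [Finset.sum_apply]
      rfl
    rw [Finset.sum_range] at h3
    rw [Finset.sum_apply, Pi.zero_apply, ← h2, h3]
    rfl) ⟨0, hσ⟩
  rw [hp] at h0
  exact one_ne_zero h0

/-- Hilbert 90 for `∏_{W ∈ T} N_Wˣ`. -/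
theorem exists_unitsAct_eq_mul {σ : N ≃ₐ[K] N} (hσ : ∀ τ, τ ∈ Subgroup.zpowers σ)
    {T : Set (Place N)} (hT : T.Finite) (y : ∀ W : Place N, (W.Completion)ˣ)
    (hy : ∀ W ∈ T, (∏ τ : N ≃ₐ[K] N, unitsAct τ y) W = 1) :
    ∃ u : ∀ W : Place N, (W.Completion)ˣ, ∀ W ∈ T, unitsAct σ u W = y W * u W := by
  classical
  set n := orderOf σ with hn
  -- Partial norms of `y`, the coefficients of the Lagrange–Hilbert resolvent.
  let q : ℕ → ∀ W : Place N, (W.Completion)ˣ := fun i => ∏ j ∈ Finset.range i, unitsAct (σ ^ j) y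
  let p : ℕ → ∀ W : Place N, W.Completion := fun i W => q i W
  have hq : ∀ i, q (i + 1) = y * unitsAct σ (q i) := by
    intro i
    simp only [q, Finset.prod_range_succ', map_prod, pow_zero, unitsAct_one, pow_succ',
      unitsAct_mul]
    rw [mul_comm]
  have hqn : ∀ W ∈ T, q n W = 1 := fun W hW => by
    rw [← hy W hW, prod_unitsAct_eq_prod_range hσ]
  have hp : ∀ i, p (i + 1) = (fun W => (y W : W.Completion)) * completionsAct K N σ (p i) := by
    intro i
    funext W
    exact congrArg Units.val (congrFun (hq i) W)
  have hp0 : p 0 = 1 := by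
    funext W
    simp [p, q]
  obtain ⟨c, hc⟩ := exists_sum_ne_zero (σ := σ) hT p hp0 (orderOf_pos σ)
  set u := ∑ i ∈ Finset.range n, p i * diagCompletions N ((σ ^ i) c) with hu
  have hsu : (fun W => (y W : W.Completion)) * completionsAct K N σ u =
      ∑ i ∈ Finset.range n, p (i + 1) * diagCompletions N ((σ ^ (i + 1)) c) := by
    rw [hu, map_sum, Finset.mul_sum]
    refine Finset.sum_congr rfl fun i _ => ?_
    rw [map_mul, completionsAct_diag, ← mul_assoc, ← hp, pow_succ']
    rfl
  have hsuT : ∀ W ∈ T, (y W : W.Completion) * completionsAct K N σ u W = u W := by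
    intro W hW
    have h1 := congrFun hsu W
    have h2 := (Finset.sum_range_succ (fun i => p i * diagCompletions N ((σ ^ i) c)) n).symm.trans
      (Finset.sum_range_succ' (fun i => p i * diagCompletions N ((σ ^ i) c)) n)
    rw [← hsu, ← hu] at h2
    have h3 := congrFun h2 W
    have hσn : σ ^ n = 1 := pow_orderOf_eq_one σ
    have h4 : p n W = 1 := by
      change (q n W : W.Completion) = 1
      rw [hqn W hW]; rfl
    simp only [Pi.add_apply, Pi.mul_apply, h4, hp0, pow_zero, Pi.one_apply,
      hσn] at h3
    exact (add_right_cancel h3).symm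
  let v : ∀ W : Place N, (W.Completion)ˣ := fun W => if h : u W = 0 then 1 else Units.mk0 _ h
  have hv : ∀ W, u W ≠ 0 → (v W : W.Completion) = u W := fun W h => by simp [v, h]
  -- The resolvent satisfies `y * σ u = u`, so its inverse solves the equation as stated.
  refine ⟨v⁻¹, fun W hW => ?_⟩
  have h1 := hsuT W hW
  have h2 : completionsAct K N σ u W = (unitsAct σ v W : W.Completion) := by
    -- Nonvanishing at the conjugate place comes from the equation at `W`, without stability of `T`.
    have h3 : u (Place.comap (σ : N ≃+* N) W) ≠ 0 := by
      intro h0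
      have : completionsAct K N σ u W = 0 := by
        change Place.completionMap (σ : N ≃+* N) W (u _) = 0
        rw [h0, map_zero]
      rw [this, mul_zero] at h1
      exact hc W hW h1.symm
    change Place.completionMap (σ : N ≃+* N) W (u _) =
      Place.completionMap (σ : N ≃+* N) W (v (Place.comap (σ : N ≃+* N) W))
    rw [hv _ h3]
  rw [h2, ← hv W (hc W hW)] at h1
  have h3 : y W * unitsAct σ v W = v W := Units.ext h1
  rw [map_inv, Pi.inv_apply, Pi.inv_apply, ← h3, mul_inv, mul_inv_cancel_left]

end Semilocal

/-! ### Hilbert 90 up to `ℓ ^ n`-th powers at finitely many places. -/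

open NumberField

section Approximation

variable {K N : Type*} [Field K] [NumberField K] [Field N] [NumberField N] [Algebra K N]
  [IsGalois K N]

variable (K N) in
/-- The inclusion `Kˣ → Nˣ`. -/
abbrev inclUnits : Kˣ →* Nˣ := Units.map (algebraMap K N : K →* N)

variable (K N) in
/-- The norm `Nˣ → Kˣ`. -/
noncomputable abbrev normUnits : Nˣ →* Kˣ := Units.map (Algebra.norm K : N →* K)

theorem prod_map_eq_incl_norm (y : Nˣ) :
    ∏ τ : N ≃ₐ[K] N, Units.map (τ : N →* N) y = inclUnits K N (normUnits K N y) := by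
  apply Units.ext
  rw [Units.coe_prod]
  exact (Algebra.norm_eq_prod_automorphisms K (y : N)).symm

theorem prod_unitsAct_diagUnits (y : Nˣ) :
    ∏ τ : N ≃ₐ[K] N, unitsAct τ (diagUnits N y) = diagUnits N (inclUnits K N (normUnits K N y)) := by
  rw [← prod_map_eq_incl_norm, map_prod]
  exact Finset.prod_congr rfl fun τ _ => unitsAct_diag τ y

theorem unitsAct_diagUnits_incl (τ : N ≃ₐ[K] N) (k : Kˣ) :
    unitsAct τ (diagUnits N (inclUnits K N k)) = diagUnits N (inclUnits K N k) := by
  rw [unitsAct_diag]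
  congr 1
  exact Units.ext (τ.commutes _)

/-- `K` is dense in the invariants of `∏_{W ∈ T} N_W`. -/
theorem exists_diagUnits_incl_div_mem_powOn {T : Set (Place N)} (hT : T.Finite) {n : ℕ}
    (hn : n ≠ 0) (q : ∀ W : Place N, (W.Completion)ˣ)
    (hq : ∀ (τ : N ≃ₐ[K] N), ∀ W ∈ T, unitsAct τ q W = q W) (hTs : IsStable K T) :
    ∃ k : Kˣ, diagUnits N (inclUnits K N k) / q ∈ powOn T n := by
  rcases T.eq_empty_or_nonempty with rfl | hne
  · exact ⟨1, fun W hW => hW.elim⟩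
  obtain ⟨ε, hε, h⟩ := Place.exists_approx_bound hT hn q
  set d : ℕ := Fintype.card (N ≃ₐ[K] N) with hd
  have hd0 : 0 < d := Fintype.card_pos
  -- Approximate `q / d` and take the trace: the `d` conjugates of `q / d` add up to `q`, and the
  -- errors to less than `d * (ε / d)`.
  obtain ⟨c, hc⟩ := Place.exists_norm_embed_sub_lt hT
    (fun W => (q W : W.Completion) / d) (ε := ε / d) (by positivity)
  obtain ⟨u, hu, hu'⟩ := h (algebraMap K N (Algebra.trace K N c)) (by
    intro W hW
    rw [trace_eq_sum_automorphisms, map_sum]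
    have h1 : (q W : W.Completion) = ∑ τ : N ≃ₐ[K] N, (q W : W.Completion) / d := by
      rw [Finset.sum_const, Finset.card_univ, ← hd, nsmul_eq_mul,
        mul_div_cancel₀ _ (Nat.cast_ne_zero.2 hd0.ne')]
    rw [h1, ← Finset.sum_sub_distrib]
    have h2 : ∀ τ : N ≃ₐ[K] N, ‖Place.embed W (τ c) - (q W : W.Completion) / d‖ < ε / d := by
      intro τ
      have h3 : Place.embed W (τ c) - (q W : W.Completion) / d =
          Place.completionMap (τ : N ≃+* N) W (Place.embed (Place.comap (τ : N ≃+* N) W) c -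
            (q (Place.comap (τ : N ≃+* N) W) : (Place.comap (τ : N ≃+* N) W).Completion) / d) := by
        rw [map_sub, Place.completionMap_embed, map_div₀, map_natCast]
        have h4 : Place.completionMap (τ : N ≃+* N) W
            (q (Place.comap (τ : N ≃+* N) W) : (Place.comap (τ : N ≃+* N) W).Completion) = q W :=
          congrArg Units.val (hq τ W hW)
        rw [h4]
        rfl
      rw [h3, Place.norm_completionMap]
      exact hc _ (hTs τ W hW)
    calc _ ≤ ∑ τ : N ≃ₐ[K] N, ‖Place.embed W (τ c) - (q W : W.Completion) / d‖ := norm_sum_le _ _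
      _ < ∑ τ : N ≃ₐ[K] N, ε / d := Finset.sum_lt_sum_of_nonempty Finset.univ_nonempty
          fun τ _ => h2 τ
      _ = ε := by
        rw [Finset.sum_const, Finset.card_univ, ← hd, nsmul_eq_mul]
        field_simp)
  have hk0 : Algebra.trace K N c ≠ 0 := by
    intro h0
    have := hu hne
    rw [h0, map_zero] at this
    exact u.ne_zero this
  refine ⟨Units.mk0 _ hk0, fun W hW => ?_⟩
  obtain ⟨r, hr⟩ := hu' W hW
  have hku : inclUnits K N (Units.mk0 _ hk0) = u := Units.ext (hu hne).symm
  rw [hku]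
  exact ⟨r, div_eq_of_eq_mul' hr⟩

/-- Uniform bound `ℓ ^ c` for the `ℓ`-power torsion of `N_Wˣ`, `W ∈ T`. -/
def TorsionBound (ℓ c : ℕ) (T : Set (Place N)) : Prop :=
  ∀ W ∈ T, ∀ (ζ : (W.Completion)ˣ) (n : ℕ), ζ ^ ℓ ^ n = 1 → ζ ^ ℓ ^ c = 1

theorem exists_torsionBound {ℓ : ℕ} {T : Set (Place N)} (hT : T.Finite)
    (h : ∀ W ∈ T, ∃ c : ℕ, ∀ (ζ : (W.Completion)ˣ) (n : ℕ), ζ ^ ℓ ^ n = 1 → ζ ^ ℓ ^ c = 1) :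
    ∃ c, TorsionBound ℓ c T := by
  choose! c hc using h
  obtain ⟨b, hb⟩ := (hT.image c).bddAbove
  refine ⟨b, fun W hW ζ n hζ => ?_⟩
  obtain ⟨k, hk⟩ := pow_dvd_pow ℓ (hb ⟨W, hW, rfl⟩)
  rw [hk, pow_mul, hc W hW ζ n hζ, one_pow]

variable {σ : N ≃ₐ[K] N} (hσ : ∀ τ, τ ∈ Subgroup.zpowers σ) {T : Set (Place N)} (hT : T.Finite)
  (hTs : IsStable K T) {ℓ c : ℕ} (hℓ : ℓ ≠ 0) (hc : TorsionBound ℓ c T)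
include hσ hT hTs hℓ hc

/-- On `T` write `σ b / b = z ^ ℓ ^ (n + c)`. The norm of `z` is an `ℓ`-power root of unity, so `z ^
ℓ ^ c` has norm `1` and equals some `σ t / t`. Then `b / t ^ ℓ ^ n` is invariant on `T` and can be
approximated from `K`. The extra exponent `c` pays for the torsion. -/
theorem exists_incl_of_div_mem_powOn {n : ℕ} (b : Nˣ)
    (hb : diagUnits N (Units.map (σ : N →* N) b / b) ∈ powOn T (ℓ ^ (n + c))) :
    ∃ k : Kˣ, diagUnits N (b / inclUnits K N k) ∈ powOn T (ℓ ^ n) := by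
  obtain ⟨z, hz⟩ := exists_pow_of_mem_powOn hb
  have hnz : ∀ W ∈ T, (∏ τ : N ≃ₐ[K] N, unitsAct τ (z ^ ℓ ^ c)) W = 1 := by
    intro W hW
    simp only [map_pow, Finset.prod_pow]
    refine hc W hW ((∏ τ : N ≃ₐ[K] N, unitsAct τ z) W) (n + c) ?_
    have h1 : (∏ τ : N ≃ₐ[K] N, unitsAct τ z) W ^ ℓ ^ (n + c) =
        (∏ τ : N ≃ₐ[K] N, unitsAct τ (z ^ ℓ ^ (n + c))) W := by
      simp only [map_pow, Finset.prod_pow, Pi.pow_apply]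
    have h2 : (∏ τ : N ≃ₐ[K] N, unitsAct τ (z ^ ℓ ^ (n + c))) W =
        (∏ τ : N ≃ₐ[K] N, unitsAct τ (diagUnits N (Units.map (σ : N →* N) b / b))) W := by
      rw [Finset.prod_apply, Finset.prod_apply]
      exact Finset.prod_congr rfl fun τ _ => (hTs.unitsAct_eqOn τ hz W hW).symm
    have h3 : normUnits K N (Units.map (σ : N →* N) b / b) = 1 := by
      rw [map_div, div_eq_one]
      exact Units.ext (Algebra.norm_eq_of_algEquiv σ (b : N))
    rw [h1, h2, prod_unitsAct_diagUnits, h3, map_one, map_one]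
    rfl
  obtain ⟨t, ht⟩ := exists_unitsAct_eq_mul hσ hT (z ^ ℓ ^ c) hnz
  set q := diagUnits N b / t ^ ℓ ^ n with hq
  have hσq : ∀ W ∈ T, unitsAct σ q W = q W := by
    intro W hW
    have h1 : unitsAct σ q W = diagUnits N (Units.map (σ : N →* N) b) W / (unitsAct σ t W) ^ ℓ ^ n := by
      rw [hq, map_div, map_pow, unitsAct_diag]
      rfl
    have h2 : diagUnits N (Units.map (σ : N →* N) b) W =
        z W ^ ℓ ^ (n + c) * diagUnits N b W := by
      have := hz W hW
      rw [map_div, Pi.div_apply, div_eq_iff_eq_mul] at this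
      exact this
    rw [h1, h2, ht W hW, mul_pow, Pi.pow_apply, ← pow_mul, ← pow_add, add_comm c n,
      mul_div_mul_left_eq_div]
    rfl
  obtain ⟨k, hk⟩ := exists_diagUnits_incl_div_mem_powOn hT (pow_ne_zero n hℓ) q
    (hTs.unitsAct_eqOn_of_generator hσ hσq) hTs
  refine ⟨k, ?_⟩
  have h1 : diagUnits N (b / inclUnits K N k) =
      (diagUnits N (inclUnits K N k) / q)⁻¹ * t ^ ℓ ^ n := by
    rw [map_div, hq, inv_div, div_mul_eq_mul_div, div_mul_cancel]
  rw [h1]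
  exact mul_mem (inv_mem hk) (pow_mem_powOn T _ t)

/-- If the norm of `y` is `z ^ ℓ ^ (n + m + c)` on `T`, then `σ z / z` is torsion, so `t = z ^ ℓ ^
c` is invariant. The norm of `t ^ ℓ ^ n` is its `ℓ ^ m`-th power, which is the norm of `y`. Hence `y
/ t ^ ℓ ^ n` equals some `σ u / u`, and `u` is approximated by a global `b`. -/
theorem exists_div_mem_powOn_of_norm {n m : ℕ} (hm : Fintype.card (N ≃ₐ[K] N) = ℓ ^ m) (y : Nˣ)
    (hy : diagUnits N (inclUnits K N (normUnits K N y)) ∈ powOn T (ℓ ^ (n + m + c))) :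
    ∃ b : Nˣ, diagUnits N (y / (Units.map (σ : N →* N) b / b)) ∈ powOn T (ℓ ^ n) := by
  obtain ⟨z, hz⟩ := exists_pow_of_mem_powOn hy
  set t := z ^ ℓ ^ c with ht
  have hσt : ∀ W ∈ T, unitsAct σ t W = t W := by
    intro W hW
    have h1 : (unitsAct σ z W / z W) ^ ℓ ^ (n + m + c) = 1 := by
      have h2 := hTs.unitsAct_eqOn σ hz W hW
      rw [unitsAct_diagUnits_incl, map_pow, hz W hW] at h2
      rw [div_pow, div_eq_one]
      exact h2.symm
    have h3 := hc W hW _ _ h1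
    rw [div_pow, div_eq_one] at h3
    rw [ht, map_pow]
    exact h3
  have htτ := hTs.unitsAct_eqOn_of_generator hσ hσt
  set y' := diagUnits N y / t ^ ℓ ^ n with hy'
  have hny : ∀ W ∈ T, (∏ τ : N ≃ₐ[K] N, unitsAct τ y') W = 1 := by
    intro W hW
    simp only [hy', map_div, map_pow, Finset.prod_div_distrib, Finset.prod_pow,
      prod_unitsAct_diagUnits]
    rw [Pi.div_apply, div_eq_one, hz W hW, Pi.pow_apply, Pi.pow_apply, Finset.prod_apply,
      Finset.prod_congr rfl fun τ _ => htτ τ W hW, Finset.prod_const, Finset.card_univ, hm, ht,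
      Pi.pow_apply, ← pow_mul, ← pow_mul, ← pow_add, ← pow_add]
    congr 2
    omega
  obtain ⟨u, hu⟩ := exists_unitsAct_eq_mul hσ hT y' hny
  obtain ⟨b, hb⟩ := exists_diagUnits_div_mem_powOn hT (pow_ne_zero n hℓ) u
  refine ⟨b, ?_⟩
  set r := diagUnits N b / u with hr
  have hbr : diagUnits N b = r * u := by rw [hr, div_mul_cancel]
  have h1 : diagUnits N (y / (Units.map (σ : N →* N) b / b)) =
      (diagUnits N y / (unitsAct σ u / u)) * (r / unitsAct σ r) := by
    rw [map_div, map_div, ← unitsAct_diag, hbr, map_mul]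
    rw [div_div_eq_mul_div, div_div_eq_mul_div, div_mul_div_comm, mul_assoc, mul_comm r u,
      mul_comm (unitsAct σ r)]
  rw [h1]
  refine mul_mem ?_ (div_mem hb (hTs.unitsAct_mem_powOn σ hb))
  intro W hW
  refine ⟨t W, ?_⟩
  rw [Pi.div_apply, Pi.div_apply, hu W hW, mul_div_cancel_right, hy', Pi.div_apply, div_div_cancel]
  rfl

end Approximation

/-! ### Principal ideles: Hilbert 90 and the `T`-infinitesimal condition. -/

open NumberField

section Principal

variable {ℓ : ℕ} [hℓ : Fact ℓ.Prime]

section OneField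

variable {K : Type*} [Field K] [NumberField K]

/-- The principal idèle `1 ⊗ u`. -/
noncomputable def ofUnit (ℓ : ℕ) [Fact ℓ.Prime] (u : Kˣ) : Principal ℓ K :=
  (1 : ℤ_[ℓ]) ⊗ₜ[ℤ] Additive.ofMul u

theorem ofUnit_div (u v : Kˣ) : ofUnit ℓ (u / v) = ofUnit ℓ u - ofUnit ℓ v := by
  unfold ofUnit
  rw [ofMul_div, TensorProduct.tmul_sub]

theorem exists_ofUnit_add (x : Principal ℓ K) (n : ℕ) : ∃ u y, x = ofUnit ℓ u + ℓ ^ n • y :=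
  exists_tmul_add _ x n

theorem diag_tmul (z : ℤ_[ℓ]) (u : Kˣ) (w : Place K) :
    diag ℓ K (z ⊗ₜ[ℤ] Additive.ofMul u) w =
      z • EllAdic.of ℓ _ (Additive.ofMul (Place.embedUnits w u)) := rfl

theorem diag_ofUnit (u : Kˣ) (w : Place K) :
    diag ℓ K (ofUnit ℓ u) w = EllAdic.of ℓ _ (Additive.ofMul (Place.embedUnits w u)) :=
  (diag_tmul 1 u w).trans (one_smul ℤ_[ℓ] _)

/-- The dictionary between `ℓ`-adified ideles at level `n` and `ℓ ^ n`-th powers in the completions.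
-/
theorem diag_level_eq_zero_iff {x y : Principal ℓ K} {u : Kˣ} {n : ℕ}
    (hx : x = ofUnit ℓ u + ℓ ^ n • y) (w : Place K) :
    (diag ℓ K x w).1 n = 0 ↔ ∃ r, Place.embedUnits w u = r ^ ℓ ^ n := by
  rw [hx, map_add, map_nsmul, Pi.add_apply, Pi.smul_apply, diag_ofUnit, EllAdic.add_apply,
    EllAdic.nsmul_apply, EllAdic.pow_nsmul_level, add_zero, EllAdic.of_apply,
    Level.mk_eq_zero_iff]
  exact ⟨fun ⟨r, hr⟩ => ⟨r.toMul, hr.symm⟩, fun ⟨r, hr⟩ => ⟨.ofMul r, hr.symm⟩⟩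

theorem diag_eq_zero_of_divisible {w : Place K}
    (h : ∀ (u : (w.Completion)ˣ) (n : ℕ), ∃ v, v ^ ℓ ^ n = u) (x : LocalR ℓ w) : x = 0 :=
  EllAdic.eq_zero_of_divisible (fun a n => h a.toMul n) x

theorem of_mem_localU {w : Place K} {u : (w.Completion)ˣ} (hu : u ∈ Place.units w) :
    EllAdic.of ℓ _ (Additive.ofMul u) ∈ localU ℓ w :=
  ⟨EllAdic.of ℓ _ (Additive.ofMul ⟨u, hu⟩), rfl⟩

theorem diag_mem_ideles (x : Principal ℓ K) : diag ℓ K x ∈ ideles ℓ K := by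
  induction x using TensorProduct.induction_on with
  | zero => rw [map_zero]; exact zero_mem _
  | add x y hx hy => rw [map_add]; exact add_mem hx hy
  | tmul z u =>
    refine ((Place.finite_apply_ne_one (u.toMul).ne_zero).union
      Place.finite_isInfinitePlace).subset fun w hw => ?_
    by_contra h
    simp only [Set.mem_union, Set.mem_ofPred_eq, not_or, not_not] at h
    exact hw (Submodule.smul_mem _ z (of_mem_localU
      ⟨fun _ => (Place.norm_embed w _).trans h.1, fun h' => absurd h' h.2⟩))

theorem mem_infinitesimal_iff (T : Set (Place K)) (x : Principal ℓ K) :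
    x ∈ infinitesimal ℓ T ↔ ∀ w ∈ T, diag ℓ K x w = 0 :=
  ⟨fun h => h.2, fun h => ⟨diag_mem_ideles x, h⟩⟩

theorem mem_unitsST_iff (S T : Set (Place K)) (x : Principal ℓ K) :
    x ∈ unitsST ℓ S T ↔ diag ℓ K x ∈ idelesUnit ℓ S T :=
  ⟨fun h => h.2, fun h => ⟨(mem_infinitesimal_iff T x).2 h.1, h⟩⟩

theorem finite_localR {w : Place K} (h : ¬ ∀ (u : (w.Completion)ˣ) (n : ℕ), ∃ v, v ^ ℓ ^ n = u) :
    Module.Finite ℤ_[ℓ] (LocalR ℓ w) := by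
  obtain ⟨-, F, hF, hcos⟩ := (Place.divisible_or_finite w ℓ).resolve_left h
  exact EllAdic.finite_of_finite_cosets (A := Additive (w.Completion)ˣ) F hF hcos

end OneField

section Extension

variable {K N : Type*} [Field K] [NumberField K] [Field N] [NumberField N] [Algebra K N]

variable (ℓ K N) in
/-- The map `R(K) → R(N)` induced by the inclusion `Kˣ → Nˣ`. -/
noncomputable def principalIncl : Principal ℓ K →ₗ[ℤ_[ℓ]] Principal ℓ N :=
  LinearMap.baseChange ℤ_[ℓ] (MonoidHom.toAdditive (inclUnits K N)).toIntLinearMap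

theorem principalIncl_ofUnit (u : Kˣ) :
    principalIncl ℓ K N (ofUnit ℓ u) = ofUnit ℓ (inclUnits K N u) := rfl

theorem principalMap_ofUnit (σ : N ≃ₐ[K] N) (u : Nˣ) :
    principalMap ℓ K N σ (ofUnit ℓ u) = ofUnit ℓ (Units.map (σ : N →* N) u) := rfl

theorem principalNorm_ofUnit (u : Nˣ) :
    principalNorm ℓ K N (ofUnit ℓ u) = ofUnit ℓ (normUnits K N u) := rfl

theorem principalIncl_principalNorm [IsGalois K N] (x : Principal ℓ N) :
    principalIncl ℓ K N (principalNorm ℓ K N x) = ∑ τ : N ≃ₐ[K] N, principalMap ℓ K N τ x := by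
  induction x using TensorProduct.induction_on with
  | zero => simp
  | add x y hx hy => simp only [map_add, hx, hy, Finset.sum_add_distrib]
  | tmul z u =>
    change z ⊗ₜ[ℤ] Additive.ofMul (inclUnits K N (normUnits K N u.toMul)) =
      ∑ τ : N ≃ₐ[K] N, z ⊗ₜ[ℤ] Additive.ofMul (Units.map (τ : N →* N) u.toMul)
    rw [← TensorProduct.tmul_sum, ← ofMul_prod, prod_map_eq_incl_norm]

theorem principalNorm_principalMap [IsGalois K N] (σ : N ≃ₐ[K] N) (x : Principal ℓ N) :
    principalNorm ℓ K N (principalMap ℓ K N σ x) = principalNorm ℓ K N x := by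
  induction x using TensorProduct.induction_on with
  | zero => simp
  | add x y hx hy => simp only [map_add, hx, hy]
  | tmul z u =>
    change z ⊗ₜ[ℤ] Additive.ofMul (normUnits K N (Units.map (σ : N →* N) u.toMul)) =
      z ⊗ₜ[ℤ] Additive.ofMul (normUnits K N u.toMul)
    have : normUnits K N (Units.map (σ : N →* N) u.toMul) = normUnits K N u.toMul :=
      Units.ext (Algebra.norm_eq_of_algEquiv σ (u.toMul : N))
    rw [this]

/-- Hilbert 90 for `Nˣ`. -/
theorem exists_map_div_eq_of_norm_eq_one [IsGalois K N] {σ : N ≃ₐ[K] N}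
    (hσ : ∀ τ, τ ∈ Subgroup.zpowers σ) (y : Nˣ) (hy : Algebra.norm K (y : N) = 1) :
    ∃ u : Nˣ, Units.map (σ : N →* N) u / u = y := by
  classical
  set n := orderOf σ with hn
  let p : ℕ → N := fun i => ∏ j ∈ Finset.range i, (σ ^ j) (y : N)
  have hp : ∀ i, p (i + 1) = y * σ (p i) := by
    intro i
    simp only [p, Finset.prod_range_succ', map_prod, pow_zero, pow_succ', AlgEquiv.mul_apply,
      AlgEquiv.one_apply]
    rw [mul_comm]
  have hpn : p n = 1 := by
    rw [← map_one (algebraMap K N), ← hy, Algebra.norm_eq_prod_automorphisms,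
      ← IsCyclic.image_range_orderOf hσ, Finset.prod_image]
    intro i hi j hj h
    exact pow_injOn_Iio_orderOf (by simpa using hi) (by simpa using hj) h
  have hσn : σ ^ n = 1 := pow_orderOf_eq_one σ
  have hli := (linearIndependent_monoidHom N N).comp
    (fun i : Fin n => ((σ ^ (i : ℕ) : N ≃ₐ[K] N) : N →* N)) fun i j h =>
      Fin.ext (pow_injOn_Iio_orderOf i.2 j.2 (AlgEquiv.ext fun c => DFunLike.congr_fun h c))
  rw [Fintype.linearIndependent_iff] at hli
  obtain ⟨c, hc⟩ : ∃ c : N, ∑ i ∈ Finset.range n, p i * (σ ^ i) c ≠ 0 := by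
    by_contra! h
    have h0 := hli (fun i => p i) (by
      funext c
      rw [Finset.sum_apply, Pi.zero_apply, ← h c, Finset.sum_range]
      rfl) ⟨0, orderOf_pos σ⟩
    simp [p] at h0
  set u := ∑ i ∈ Finset.range n, p i * (σ ^ i) c with hu
  have hsu : y * σ u = ∑ i ∈ Finset.range n, p (i + 1) * (σ ^ (i + 1)) c := by
    rw [hu, map_sum, Finset.mul_sum]
    refine Finset.sum_congr rfl fun i _ => ?_
    rw [map_mul, ← mul_assoc, ← hp, pow_succ']
    rfl
  have h2 := (Finset.sum_range_succ (fun i => p i * (σ ^ i) c) n).symm.trans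
    (Finset.sum_range_succ' (fun i => p i * (σ ^ i) c) n)
  rw [← hsu, ← hu, hpn, hσn] at h2
  have hp0 : p 0 = 1 := by simp [p]
  rw [pow_zero, hp0] at h2
  have h3 : (u : N) = y * σ u := add_right_cancel h2
  refine ⟨(Units.mk0 u hc)⁻¹, ?_⟩
  have h4 : Units.mk0 u hc = y * Units.map (σ : N →* N) (Units.mk0 u hc) := Units.ext h3
  rw [map_inv, inv_div_inv, div_eq_iff_eq_mul]
  exact h4

/-- Hilbert 90 for `R(N) = ℤ_ℓ ⊗ Nˣ`. -/
theorem exists_principalMap_sub_eq [IsGalois K N] {σ : N ≃ₐ[K] N}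
    (hσ : ∀ τ, τ ∈ Subgroup.zpowers σ) (x : Principal ℓ N) (hx : principalNorm ℓ K N x = 0) :
    ∃ b, x = principalMap ℓ K N σ b - b := by
  let f : Additive Nˣ →+ Additive Nˣ :=
    MonoidHom.toAdditive (Units.map (σ : N →* N)) - AddMonoidHom.id _
  -- The sequence `Nˣ → Nˣ → Kˣ` given by `σ - 1` and the norm is exact by Hilbert 90, and stays so
  -- after tensoring with `ℤ_ℓ`.
  obtain ⟨b, hb⟩ := baseChange_exact (ℓ := ℓ) f (MonoidHom.toAdditive (normUnits K N)) (by
    intro u hu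
    have h1 : Algebra.norm K (u.toMul : N) = 1 := congrArg (fun v : Kˣ => (v : K)) hu
    obtain ⟨y, hy⟩ := exists_map_div_eq_of_norm_eq_one hσ u.toMul h1
    exact ⟨Additive.ofMul y, hy⟩) (by
    intro u
    change normUnits K N (Units.map (σ : N →* N) u.toMul / u.toMul) = 1
    rw [map_div, div_eq_one]
    exact Units.ext (Algebra.norm_eq_of_algEquiv σ (u.toMul : N))) x hx
  refine ⟨b, hb.symm.trans ?_⟩
  have : f.toIntLinearMap = (MonoidHom.toAdditive (Units.map (σ : N →* N))).toIntLinearMap -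
      LinearMap.id := rfl
  rw [this, LinearMap.baseChange_sub, LinearMap.baseChange_id]
  rfl

theorem isStable_placesAbove (T : Set (Place K)) : IsStable K (placesAbove N T) :=
  fun τ W hW => (comap_mem_placesAbove T τ W).2 hW

/-- If `x` in `K` has absolute value other than `1` at `w`, the same holds at every place above `w`,
and only finitely many places of `N` have this property. -/
theorem finite_placesAbove {T : Set (Place K)} (hT : T.Finite) : (placesAbove N T).Finite := by
  have : placesAbove N T = ⋃ w ∈ T, {W : Place N |
      (W.1.comp (f := algebraMap K N) (algebraMap K N).injective).IsEquiv w.1} := by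
    ext W
    simp [placesAbove]
  rw [this]
  refine hT.biUnion fun w _ => ?_
  obtain ⟨x, hx, hx1⟩ := Place.isNontrivial w
  refine (Place.finite_apply_ne_one (x := algebraMap K N x) (by simpa using hx)).subset fun W hW h => ?_
  exact hx1 (hW.eq_one_iff.1 h)

/-- The preimage is a component of `τ⁻¹` applied to the family concentrated at `W`; this avoids
transport along an equality of places. -/
theorem exists_units_map_completionMap_eq (τ : N ≃ₐ[K] N) (W : Place N) (u : (W.Completion)ˣ) :
    ∃ v, Units.map (Place.completionMap (τ : N ≃+* N) W :
      (Place.comap (τ : N ≃+* N) W).Completion →* W.Completion) v = u := by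
  classical
  refine ⟨unitsAct τ⁻¹ (Function.update 1 W u) (Place.comap (τ : N ≃+* N) W), ?_⟩
  rw [← unitsAct_apply, ← unitsAct_mul, mul_inv_cancel, unitsAct_one, Function.update_self]

variable (ℓ) in
/-- The places of `T` whose multiplicative group is not `ℓ`-divisible. -/
def nonDivisible (T : Set (Place N)) : Set (Place N) :=
  {W ∈ T | ¬ ∀ (u : (W.Completion)ˣ) (n : ℕ), ∃ v, v ^ ℓ ^ n = u}

theorem isStable_nonDivisible {T : Set (Place N)} (hT : IsStable K T) :
    IsStable K (nonDivisible ℓ T) := fun τ W hW =>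
  ⟨hT τ W hW.1, fun h => hW.2 fun u n => by
    obtain ⟨v, rfl⟩ := exists_units_map_completionMap_eq τ W u
    obtain ⟨v', rfl⟩ := h v n
    exact ⟨_, (map_pow _ _ _).symm⟩⟩

theorem exists_torsionBound_nonDivisible {T : Set (Place N)} (hT : T.Finite) :
    ∃ c, TorsionBound ℓ c (nonDivisible ℓ T) :=
  exists_torsionBound (hT.subset (Set.sep_subset _ _)) fun W hW =>
    ((Place.divisible_or_finite W ℓ).resolve_left hW.2).1

variable (ℓ) in
/-- The projection `∏_W R_{N_W} → ∏_{W ∈ T} R_{N_W}`. -/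
noncomputable def restrictTo (T : Set (Place N)) : LocalProd ℓ N →ₗ[ℤ_[ℓ]] ∀ W : T, LocalR ℓ W.1 :=
  LinearMap.pi fun W => LinearMap.proj W.1

/-- A closedness criterion: `x` agrees on `T` with an element of `f(Q)` as soon as it does so
modulo all powers of `ℓ` on the non-divisible places of `T`. -/
theorem exists_sub_mem_infinitesimal {T : Set (Place N)} (hT : T.Finite) {Q : Type*} [AddCommGroup Q]
    [Module ℤ_[ℓ] Q] (f : Q →ₗ[ℤ_[ℓ]] Principal ℓ N) (x : Principal ℓ N)
    (h : ∀ n : ℕ, ∃ q u y, x - f q = ofUnit ℓ u + ℓ ^ n • y ∧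
      diagUnits N u ∈ powOn (nonDivisible ℓ T) (ℓ ^ n)) :
    ∃ q, x - f q ∈ infinitesimal ℓ T := by
  set T' := nonDivisible ℓ T with hT'
  have : Finite T' := (hT.subset (Set.sep_subset _ _)).to_subtype
  have hfin : ∀ W : T', Module.Finite ℤ_[ℓ] (LocalR ℓ W.1) := fun W => finite_localR W.2.2
  have : Module.Finite ℤ_[ℓ] (∀ W : T', LocalR ℓ W.1) := Module.Finite.pi
  let g := (restrictTo ℓ T').comp ((diag ℓ N).comp f)
  -- The product over the non-divisible places is finitely generated over `ℤ_ℓ`, so the image of `f`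
  -- in it is closed.
  have hx : restrictTo ℓ T' (diag ℓ N x) ∈ LinearMap.range g := by
    refine mem_of_forall_mem_add_pow _ _ fun n => ?_
    obtain ⟨q, u, y, hq, hu⟩ := h n
    have h1 : ∀ W : T', ∃ p, diag ℓ N (x - f q) W.1 = ℓ ^ n • p := fun W =>
      (EllAdic.level_eq_zero_iff _ n).1 ((diag_level_eq_zero_iff hq W.1).2 (hu W.1 W.2))
    choose p hp using h1
    refine ⟨g q, ⟨q, rfl⟩, p, funext fun W => ?_⟩
    change diag ℓ N x W.1 = diag ℓ N (f q) W.1 + ℓ ^ n • p W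
    rw [← hp, map_sub, Pi.sub_apply]
    abel
  obtain ⟨q, hq⟩ := hx
  refine ⟨q, (mem_infinitesimal_iff T _).2 fun W hW => ?_⟩
  by_cases hd : ∀ (u : (W.Completion)ˣ) (n : ℕ), ∃ v, v ^ ℓ ^ n = u
  · exact diag_eq_zero_of_divisible hd _
  · rw [map_sub, Pi.sub_apply, sub_eq_zero]
    exact (congrFun hq ⟨W, hW, hd⟩).symm

variable [IsGalois K N] {σ : N ≃ₐ[K] N} (hσ : ∀ τ, τ ∈ Subgroup.zpowers σ)
  {T : Set (Place K)} (hT : T.Finite)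
include hσ hT

/-- `H¹(Γ, R^T(N)) = 0`. -/
theorem exists_sub_principalIncl_mem (b : Principal ℓ N)
    (hb : principalMap ℓ K N σ b - b ∈ infinitesimal ℓ (placesAbove N T)) :
    ∃ k, b - principalIncl ℓ K N k ∈ infinitesimal ℓ (placesAbove N T) := by
  have hTN := finite_placesAbove (N := N) hT
  obtain ⟨c, hc⟩ := exists_torsionBound_nonDivisible (ℓ := ℓ) hTN
  refine exists_sub_mem_infinitesimal hTN _ b fun n => ?_
  -- Precision `n + c` leaves precision `n` after the torsion loss.
  obtain ⟨u, y, hu⟩ := exists_ofUnit_add b (n + c)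
  have h1 : principalMap ℓ K N σ b - b = ofUnit ℓ (Units.map (σ : N →* N) u / u) +
      ℓ ^ (n + c) • (principalMap ℓ K N σ y - y) := by
    rw [hu, map_add, map_nsmul, principalMap_ofUnit, ofUnit_div, smul_sub]
    abel
  obtain ⟨k, hk⟩ := exists_incl_of_div_mem_powOn hσ (hTN.subset (Set.sep_subset _ _))
    (isStable_nonDivisible (isStable_placesAbove T)) hℓ.out.ne_zero hc (n := n) u (fun W hW => by
      refine (diag_level_eq_zero_iff h1 W).1 ?_
      rw [(mem_infinitesimal_iff _ _).1 hb W hW.1, EllAdic.zero_apply])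
  refine ⟨ofUnit ℓ k, _, ℓ ^ c • y, ?_, hk⟩
  rw [principalIncl_ofUnit, ofUnit_div, smul_smul, ← pow_add, hu]
  abel

/-- `H⁻¹(Γ, ∏_{W ∈ T} R_{N_W}) = 0`, together with the surjectivity of `R(N) → ∏_{W ∈ T} R_{N_W}`. -/
theorem exists_sub_principalMap_mem {m : ℕ} (hm : Fintype.card (N ≃ₐ[K] N) = ℓ ^ m)
    (y : Principal ℓ N)
    (hy : ∀ W ∈ placesAbove N T, diag ℓ N (principalIncl ℓ K N (principalNorm ℓ K N y)) W = 0) :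
    ∃ c, y - (principalMap ℓ K N σ c - c) ∈ infinitesimal ℓ (placesAbove N T) := by
  have hTN := finite_placesAbove (N := N) hT
  obtain ⟨c, hc⟩ := exists_torsionBound_nonDivisible (ℓ := ℓ) hTN
  obtain ⟨f, hsub⟩ : ∃ f : Principal ℓ N →ₗ[ℤ_[ℓ]] Principal ℓ N,
      ∀ q, f q = principalMap ℓ K N σ q - q :=
    ⟨principalMap ℓ K N σ - LinearMap.id, fun q => rfl⟩
  suffices h : ∃ q, y - f q ∈
      infinitesimal ℓ (placesAbove N T) by
    obtain ⟨q, hq⟩ := h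
    rw [hsub] at hq
    exact ⟨q, hq⟩
  refine exists_sub_mem_infinitesimal hTN f y fun n => ?_
  -- The loss is `c` for torsion and `m` for the degree `ℓ ^ m`.
  obtain ⟨u, z, hu⟩ := exists_ofUnit_add y (n + m + c)
  have h1 : principalIncl ℓ K N (principalNorm ℓ K N y) =
      ofUnit ℓ (inclUnits K N (normUnits K N u)) +
      ℓ ^ (n + m + c) • principalIncl ℓ K N (principalNorm ℓ K N z) := by
    rw [hu, map_add, map_nsmul, map_add, map_nsmul, principalNorm_ofUnit, principalIncl_ofUnit]
  obtain ⟨b, hb⟩ := exists_div_mem_powOn_of_norm hσ (hTN.subset (Set.sep_subset _ _))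
    (isStable_nonDivisible (isStable_placesAbove T)) hℓ.out.ne_zero hc (n := n) hm u (fun W hW => by
      refine (diag_level_eq_zero_iff h1 W).1 ?_
      rw [hy W hW.1, EllAdic.zero_apply])
  refine ⟨ofUnit ℓ b, u / (Units.map (σ : N →* N) b / b), ℓ ^ (m + c) • z, ?_, hb⟩
  rw [hsub, principalMap_ofUnit, ofUnit_div, ofUnit_div, smul_smul, ← pow_add, ← add_assoc, hu]
  abel

end Extension

end Principal

/-! ### The equation `h ∘ g - h = f` for a permutation `g` of finite order. -/

open NumberField

section Permutation

variable {α A : Type*} [AddCommGroup A]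

theorem sum_range_mul_of_periodic {p : ℕ → A} {k : ℕ} (hp : ∀ j, p (j + k) = p j) (n : ℕ) :
    ∑ j ∈ Finset.range (n * k), p j = n • ∑ j ∈ Finset.range k, p j := by
  have h : ∀ n j, p (n * k + j) = p j := by
    intro n
    induction n with
    | zero => simp
    | succ n ih =>
      intro j
      rw [← ih j, ← hp (n * k + j)]
      congr 1
      ring
  induction n with
  | zero => simp
  | succ n ih =>
    rw [Nat.succ_mul, Finset.sum_range_add, ih, succ_nsmul]
    simp only [h]

/-- Solving `h (g x) - h x = f x` on a set with a permutation `g` all of whose cycles are finite. -/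
theorem exists_map_sub_eq (g : Equiv.Perm α) (f : α → A)
    (hf : ∀ x (k : ℕ), (g ^ k) x = x → ∑ j ∈ Finset.range k, f ((g ^ j) x) = 0)
    {n : ℕ} (hn : 0 < n) (hg : g ^ n = 1) :
    ∃ h : α → A, (∀ x, h (g x) - h x = f x) ∧ ∀ x, h x ≠ 0 → ∃ j : ℕ, f ((g ^ j) x) ≠ 0 := by
  have hfin : IsOfFinOrder g := isOfFinOrder_iff_pow_eq_one.2 ⟨n, hn, hg⟩
  have hnat : ∀ x y, g.SameCycle x y → ∃ i : ℕ, (g ^ i) x = y := by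
    rintro x y ⟨i, rfl⟩
    obtain ⟨j, hj⟩ := hfin.mem_powers_iff_mem_zpowers.2 ⟨i, rfl⟩
    exact ⟨j, congrArg (fun e : Equiv.Perm α => e x) hj⟩
  let s := Equiv.Perm.SameCycle.setoid g
  let r : α → α := fun x => (Quotient.mk s x).out
  have hr : ∀ x, g.SameCycle (r x) x := fun x =>
    Quotient.exact (s := s) (Quotient.out_eq (Quotient.mk s x))
  have hrg : ∀ x, r (g x) = r x := fun x => congrArg Quotient.out
    (Quotient.sound (s := s) (a := g x) (b := x) (Equiv.Perm.sameCycle_apply_left.2 (.refl g x)))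
  choose i hi using fun x => hnat _ _ (hr x)
  have hwd : ∀ x (a b : ℕ), a ≤ b → (g ^ a) x = (g ^ b) x →
      ∑ j ∈ Finset.range a, f ((g ^ j) x) = ∑ j ∈ Finset.range b, f ((g ^ j) x) := by
    intro x a b hab h
    -- The two partial sums differ by the sum over a closed cycle, which vanishes by `hf`.
    obtain ⟨c, rfl⟩ := Nat.exists_eq_add_of_le hab
    rw [Finset.sum_range_add]
    have h1 := hf ((g ^ a) x) c (by rw [← Equiv.Perm.mul_apply, ← pow_add, add_comm, ← h])
    simp only [← Equiv.Perm.mul_apply, ← pow_add] at h1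
    simp only [add_comm a, h1, add_zero]
  have hwd' : ∀ x (a b : ℕ), (g ^ a) x = (g ^ b) x →
      ∑ j ∈ Finset.range a, f ((g ^ j) x) = ∑ j ∈ Finset.range b, f ((g ^ j) x) := fun x a b h =>
    (le_total a b).elim (fun hab => hwd x a b hab h) fun hab => (hwd x b a hab h.symm).symm
  -- Sum `f` along the orbit from the representative `r x` up to `x`. Such an `h` lives on orbits
  -- meeting the support of `f`; this later keeps the constructed family in the restricted product.
  refine ⟨fun x => ∑ j ∈ Finset.range (i x), f ((g ^ j) (r x)), fun x => ?_, fun x hx => ?_⟩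
  · have h1 : (g ^ i (g x)) (r x) = (g ^ (i x + 1)) (r x) := by
      rw [pow_succ', Equiv.Perm.mul_apply, hi, ← hrg, hi]
    simp only [hrg, hwd' _ _ _ h1, Finset.sum_range_succ, hi, add_sub_cancel_left]
  · obtain ⟨j, -, hj⟩ := Finset.exists_ne_zero_of_sum_ne_zero hx
    obtain ⟨k, hk⟩ := hnat _ _ (hr x).symm
    exact ⟨j + k, by rwa [pow_add, Equiv.Perm.mul_apply, hk]⟩

end Permutation

/-! ### Local quotients by units: valuations and signs. -/

section LocalInvariants

variable {ℓ : ℕ} [hℓ : Fact ℓ.Prime] {K : Type*} [Field K] [NumberField K]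

/-- A homomorphism `f : K_wˣ → B` that is a split surjection with kernel the units of `K_w`. -/
def IsUnitQuotient {B : Type*} [AddCommGroup B] (w : Place K) (f : Additive (w.Completion)ˣ →+ B) :
    Prop :=
  (∀ u, f (.ofMul u) = 0 ↔ u ∈ Place.units w) ∧ ∃ s : B →+ Additive (w.Completion)ˣ, ∀ b, f (s b) = b

/-- The splitting lets `ℓ`-adification commute with the kernel, turning membership in `localU` into
a vanishing condition. -/
theorem IsUnitQuotient.mem_localU_iff {B : Type*} [AddCommGroup B] {w : Place K}
    {f : Additive (w.Completion)ˣ →+ B} (hf : IsUnitQuotient w f) (x : LocalR ℓ w) :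
    x ∈ localU ℓ w ↔ EllAdic.map ℓ f x = 0 := by
  obtain ⟨h, s, hs⟩ := hf
  let i : Additive (Place.units w) →+ Additive (w.Completion)ˣ :=
    MonoidHom.toAdditive (Place.units w).subtype
  have hi : Function.Injective i := fun _ _ hab => Subtype.val_injective hab
  refine EllAdic.mem_range_map_iff i f s hs (fun a => (h a.toMul).trans ?_) hi x
  exact ⟨fun ha => ⟨.ofMul ⟨a.toMul, ha⟩, rfl⟩, by rintro ⟨c, rfl⟩; exact c.toMul.2⟩

theorem IsUnitQuotient.map_surjective {B : Type*} [AddCommGroup B] {w : Place K}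
    {f : Additive (w.Completion)ˣ →+ B} (hf : IsUnitQuotient w f) (b : EllAdic ℓ B) :
    ∃ x : LocalR ℓ w, EllAdic.map ℓ f x = b := by
  obtain ⟨-, s, hs⟩ := hf
  refine ⟨EllAdic.map ℓ s b, ?_⟩
  rw [EllAdic.map_map]
  have : f.comp s = AddMonoidHom.id B := AddMonoidHom.ext hs
  rw [this, EllAdic.map_id]

theorem exists_isUnitQuotient_int {w : Place K} (hw : IsFinitePlace w.1) :
    ∃ (q : ℝ) (f : Additive (w.Completion)ˣ →+ ℤ), 1 < q ∧
      (∃ a : Kˣ, f (.ofMul (Place.embedUnits w a)) = 1) ∧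
      (∀ u : (w.Completion)ˣ, ‖(u : w.Completion)‖ = q ^ f (.ofMul u)) ∧ IsUnitQuotient w f := by
  obtain ⟨q, f, hq, ⟨a, ha⟩, hf⟩ := Place.exists_ord hw
  refine ⟨q, f, hq, ⟨a, ha⟩, hf, fun u => ?_,
    zmultiplesHom _ (.ofMul (Place.embedUnits w a)), fun b => ?_⟩
  · have h1 : f (.ofMul u) = 0 ↔ ‖(u : w.Completion)‖ = 1 := by
      rw [hf, zpow_eq_one_iff_right₀ (zero_le_one.trans hq.le) hq.ne']
    rw [h1]
    exact ⟨fun h => ⟨fun _ => h, fun h' =>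
      absurd h' (Place.not_isInfinitePlace_of_isFinitePlace hw)⟩, fun h => h.1 hw⟩
  · rw [zmultiplesHom_apply, map_zsmul, ha, zsmul_eq_mul, mul_one]
    rfl

/-- The real places. -/
def IsRealPlace (w : Place K) : Prop :=
  IsInfinitePlace w.1 ∧ ¬ IsSquare (-1 : (w.Completion)ˣ)

theorem exists_isUnitQuotient_zmod {w : Place K} (hw : IsRealPlace w) :
    ∃ f : Additive (w.Completion)ˣ →+ ZMod 2, (∀ u, f (.ofMul u) = 0 ↔ IsSquare u) ∧
      IsUnitQuotient w f := by
  obtain ⟨f, hf⟩ := Place.exists_sign hw.1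
  -- The section sends `1` to `-1`, a non-square of order dividing `2`.
  refine ⟨f, hf, fun u => ?_, ZMod.lift 2 ⟨zmultiplesHom _ (.ofMul (-1)), ?_⟩, fun b => ?_⟩
  · rw [hf]
    exact ⟨fun h => ⟨fun h' => absurd hw.1 (Place.not_isInfinitePlace_of_isFinitePlace h'),
      fun _ => h⟩, fun h => h.2 hw.1⟩
  · rw [zmultiplesHom_apply, ← ofMul_zpow]
    simp
  · have h1 : f (.ofMul (-1)) = 1 := by
      have h2 : f (.ofMul (-1)) ≠ 0 := fun h => hw.2 ((hf _).1 h)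
      generalize f (.ofMul (-1)) = t at h2
      revert t
      decide
    obtain ⟨k, rfl⟩ := ZMod.intCast_surjective b
    rw [ZMod.lift_coe]
    change f (zmultiplesHom _ _ k) = _
    rw [zmultiplesHom_apply, map_zsmul, h1, zsmul_eq_mul, mul_one]

theorem localR_eq_zero_of_isInfinitePlace {w : Place K} (hw : IsInfinitePlace w.1)
    (h : ¬ IsRealPlace w) (x : LocalR ℓ w) : x = 0 := by
  rcases Place.isSquare_neg_one_or_of_isInfinitePlace hw with h' | ⟨-, h'⟩
  · exact diag_eq_zero_of_divisible (fun u n => h' u _ (pow_ne_zero n hℓ.out.ne_zero)) x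
  · exact absurd ⟨hw, h'⟩ h

/-- Two integer valued homomorphisms that are proportional over `ℝ`, the second one taking the
value `1`, are proportional over `ℤ`. -/
theorem exists_int_smul_of_real {A : Type*} {f g : A → ℤ} {κ : ℝ} (h : ∀ a, (f a : ℝ) = κ * g a)
    (hg : ∃ a, g a = 1) : ∃ k : ℤ, (k : ℝ) = κ ∧ ∀ a, f a = k * g a := by
  obtain ⟨a, ha⟩ := hg
  have hk : (f a : ℝ) = κ := by rw [h, ha, Int.cast_one, mul_one]
  exact ⟨f a, hk, fun b => by exact_mod_cast (hk ▸ h b : (f b : ℝ) = f a * g b)⟩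

theorem log_eq_of_eq_zpow {q r : ℝ} {k : ℤ} (h : r = q ^ k) : Real.log r = k * Real.log q := by
  rw [h, Real.log_zpow]

/-- Two normalised valuations that agree as absolute values are equal. -/
theorem eq_of_zpow_eq {A : Type*} {f g : A → ℤ} {q q' : ℝ} (hq : 1 < q) (hq' : 1 < q')
    (h : ∀ a, q ^ f a = q' ^ g a) (hf : ∃ a, f a = 1) (hg : ∃ a, g a = 1) (a : A) : f a = g a := by
  have hl := Real.log_pos hq
  have hl' := Real.log_pos hq'
  have hlog : ∀ a, (f a : ℝ) * Real.log q = g a * Real.log q' := fun a => by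
    rw [← log_eq_of_eq_zpow rfl, ← log_eq_of_eq_zpow rfl, h]
  obtain ⟨k, hk, hfk⟩ := exists_int_smul_of_real (f := f) (g := g) (κ := Real.log q' / Real.log q)
    (fun a => by rw [div_mul_eq_mul_div, eq_div_iff hl.ne', hlog, mul_comm]) hg
  obtain ⟨b, hb⟩ := hf
  have h1 : k * g b = 1 := by rw [← hfk, hb]
  have hk0 : 0 < k := by
    have : (0 : ℝ) < k := by rw [hk]; positivity
    exact_mod_cast this
  have : k = 1 := by
    rcases Int.eq_one_or_neg_one_of_mul_eq_one h1 with h | h <;> omega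
  rw [hfk, this, one_mul]

end LocalInvariants

/-! ### Vanishing of `H⁻¹` for the group of divisors. -/

open NumberField

section Idele

variable {ℓ : ℕ} [hℓ : Fact ℓ.Prime]
variable {K N : Type*} [Field K] [NumberField K] [Field N] [NumberField N] [Algebra K N]

/-- The permutation of the places of `N` induced by a Galois automorphism. -/
noncomputable def placePerm (τ : N ≃ₐ[K] N) : Equiv.Perm (Place N) where
  toFun := Place.comap (τ : N ≃+* N)
  invFun := Place.comap ((τ⁻¹ : N ≃ₐ[K] N) : N ≃+* N)
  left_inv W := Subtype.ext (AbsoluteValue.ext fun x => congrArg W.1 (τ.apply_symm_apply x))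
  right_inv W := Subtype.ext (AbsoluteValue.ext fun x => congrArg W.1 (τ.symm_apply_apply x))

theorem placePerm_one : placePerm (1 : N ≃ₐ[K] N) = 1 := rfl

theorem placePerm_pow (τ : N ≃ₐ[K] N) (j : ℕ) : placePerm (τ ^ j) = placePerm τ ^ j := by
  induction j with
  | zero => rfl
  | succ j ih =>
    -- `W ↦ W ∘ τ` reverses products, hence the two different expansions of the power.
    rw [pow_succ', pow_succ (placePerm τ), ← ih]
    rfl

theorem localProdRep_apply (τ : N ≃ₐ[K] N) (x : LocalProd ℓ N) (W : Place N) :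
    localProdRep ℓ K N τ x W =
      EllAdic.map ℓ (localUnitsMap (τ : N ≃+* N) W) (x (Place.comap (τ : N ≃+* N) W)) := rfl

theorem sum_eq_sum_range {σ : N ≃ₐ[K] N} [IsGalois K N] (hσ : ∀ τ, τ ∈ Subgroup.zpowers σ)
    {A : Type*} [AddCommMonoid A] (f : (N ≃ₐ[K] N) → A) :
    ∑ τ, f τ = ∑ j ∈ Finset.range (Fintype.card (N ≃ₐ[K] N)), f (σ ^ j) := by
  classical
  rw [← IsCyclic.image_range_card hσ, Finset.sum_image]
  · rw [Nat.card_eq_fintype_card]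
  · rw [← orderOf_eq_card_of_forall_mem_zpowers hσ]
    exact fun i hi j hj => pow_injOn_Iio_orderOf (by simpa using hi) (by simpa using hj)

/-- A norm-trivial idèle is of the form `σ d - d` modulo units, on a stable set of places where
the quotients by the units are naturally identified with a fixed group. -/
theorem exists_sub_mem_localU [IsGalois K N] {σ : N ≃ₐ[K] N} (hσ : ∀ τ, τ ∈ Subgroup.zpowers σ)
    {B : Type*} [AddCommGroup B] {X : Set (Place N)} (hX : IsStable K X)
    (φ : ∀ W : Place N, Additive (W.Completion)ˣ →+ B) (hφ : ∀ W ∈ X, IsUnitQuotient W (φ W))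
    (hnat : ∀ (τ : N ≃ₐ[K] N), ∀ W ∈ X, (φ W).comp (localUnitsMap (τ : N ≃+* N) W) =
      φ (Place.comap (τ : N ≃+* N) W))
    (hB : (∀ b : EllAdic ℓ B, Fintype.card (N ≃ₐ[K] N) • b = 0 → b = 0) ∨
      ∀ W ∈ X, ∀ τ : N ≃ₐ[K] N, Place.comap (τ : N ≃+* N) W = W → τ = 1)
    {y : LocalProd ℓ N} (hy : y ∈ ideles ℓ N)
    (hN : ∀ W ∈ X, (∑ τ, localProdRep ℓ K N τ y) W ∈ localU ℓ W) :
    ∃ d ∈ ideles ℓ N, (∀ W ∉ X, d W = 0) ∧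
      ∀ W ∈ X, (y - (localProdRep ℓ K N σ d - d)) W ∈ localU ℓ W := by
  classical
  set n := Fintype.card (N ≃ₐ[K] N) with hn
  have hσn : σ ^ n = 1 := pow_card_eq_one
  have hF : ∀ (x : LocalProd ℓ N) (τ : N ≃ₐ[K] N), ∀ W ∈ X,
      EllAdic.map ℓ (φ W) (localProdRep ℓ K N τ x W) =
        EllAdic.map ℓ (φ (placePerm τ W)) (x (placePerm τ W)) := fun x τ W hW => by
    rw [localProdRep_apply, EllAdic.map_map, hnat τ W hW]
    rfl
  -- Through the `φ W`, the action of `σ` modulo units becomes the permutation of places acting on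
  -- functions with values in one fixed group.
  let f : Place N → EllAdic ℓ B := fun W => if W ∈ X then EllAdic.map ℓ (φ W) (y W) else 0
  have hfX : ∀ W ∈ X, f W = EllAdic.map ℓ (φ W) (y W) := fun W hW => if_pos hW
  have hfX' : ∀ W ∉ X, f W = 0 := fun W hW => if_neg hW
  have hpX : ∀ (τ : N ≃ₐ[K] N) (W : Place N), placePerm τ W ∈ X ↔ W ∈ X := fun τ W =>
    ⟨fun h => (placePerm τ).symm_apply_apply W ▸ hX τ⁻¹ _ h, hX τ W⟩
  have hsum : ∀ W, ∑ j ∈ Finset.range n, f ((placePerm σ ^ j) W) = 0 := by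
    intro W
    simp only [← placePerm_pow]
    by_cases hW : W ∈ X
    · rw [← sum_eq_sum_range hσ fun τ => f (placePerm τ W), ← (((hφ W hW).mem_localU_iff _).1 (hN W hW)),
        Finset.sum_apply, map_sum]
      exact Finset.sum_congr rfl fun τ _ => by rw [hfX _ ((hpX τ W).2 hW), hF y τ W hW]
    · exact Finset.sum_eq_zero fun j _ => hfX' _ (mt (hpX _ W).1 hW)
  have hper : ∀ (W : Place N) (k : ℕ), (placePerm σ ^ k) W = W →
      ∀ j, f ((placePerm σ ^ (j + k)) W) = f ((placePerm σ ^ j) W) := fun W k hk j => by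
    rw [pow_add, Equiv.Perm.mul_apply, hk]
  have hgn : placePerm σ ^ n = 1 := by rw [← placePerm_pow, hσn, placePerm_one]
  obtain ⟨h, hh, hsupp⟩ := exists_map_sub_eq (placePerm σ) f (fun W k hk => by
    by_cases hW : W ∈ X
    · rcases hB with hB | hB
      -- Periodicity gives `n` times the sum over `k` terms as `k` times the sum over `n` terms, and
      -- the latter is zero.
      · refine hB _ ?_
        rw [← sum_range_mul_of_periodic (hper W k hk), mul_comm,
          sum_range_mul_of_periodic (hper W n (by rw [hgn]; rfl)), hsum, smul_zero]
      -- With a free action every return time `k` is a multiple of `n`, so torsion in the values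
      -- does no harm.
      · have h1 := hB W hW (σ ^ k) (by rw [← placePerm_pow] at hk; exact hk)
        obtain ⟨c, rfl⟩ : n ∣ k := by
          rw [hn, ← Nat.card_eq_fintype_card, ← orderOf_eq_card_of_forall_mem_zpowers hσ]
          exact orderOf_dvd_of_pow_eq_one h1
        rw [mul_comm, sum_range_mul_of_periodic (hper W n (by rw [hgn]; rfl)), hsum, smul_zero]
    · exact Finset.sum_eq_zero fun j _ => by
        rw [← placePerm_pow]
        exact hfX' _ (mt (hpX _ W).1 hW)) Fintype.card_pos hgn
  have hd : ∀ W, ∃ x : LocalR ℓ W, (W ∈ X → EllAdic.map ℓ (φ W) x = h W) ∧ (W ∉ X → x = 0) := by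
    intro W
    by_cases hW : W ∈ X
    · obtain ⟨x, hx⟩ := (hφ W hW).map_surjective (h W)
      exact ⟨x, fun _ => hx, fun h => absurd hW h⟩
    · exact ⟨0, fun h => absurd h hW, fun _ => rfl⟩
  choose d hd hd' using hd
  refine ⟨d, ?_, hd', fun W hW => ?_⟩
  · refine (Set.finite_iUnion fun τ : N ≃ₐ[K] N =>
      Set.Finite.preimage (placePerm τ).injective.injOn hy).subset fun W hW => ?_
    have hWX : W ∈ X := by
      by_contra hWX
      exact hW (hd' W hWX ▸ zero_mem _)
    have hW0 : h W ≠ 0 := fun h0 => hW (((hφ W hWX).mem_localU_iff _).2 ((hd W hWX).trans h0))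
    obtain ⟨j, hj⟩ := hsupp W hW0
    rw [← placePerm_pow, hfX _ ((hpX _ W).2 hWX)] at hj
    exact Set.mem_iUnion.2 ⟨σ ^ j, fun hmem =>
      hj (((hφ _ ((hpX _ W).2 hWX)).mem_localU_iff _).1 hmem)⟩
  · rw [(hφ W hW).mem_localU_iff, Pi.sub_apply, Pi.sub_apply, map_sub, map_sub, hF d σ W hW,
      hd _ ((hpX σ W).2 hW), hd W hW, hh, hfX W hW, sub_self]

end Idele

open NumberField

section Idele

variable {ℓ : ℕ} [hℓ : Fact ℓ.Prime]
variable {K N : Type*} [Field K] [NumberField K] [Field N] [NumberField N] [Algebra K N]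

theorem isSquare_localUnitsMap_iff (τ : N ≃ₐ[K] N) (W : Place N)
    (u : ((Place.comap (τ : N ≃+* N) W).Completion)ˣ) :
    IsSquare (Units.map (Place.completionMap (τ : N ≃+* N) W : _ →* W.Completion) u) ↔
      IsSquare u := by
  refine ⟨fun ⟨r, hr⟩ => ?_, fun h => h.map _⟩
  obtain ⟨s, rfl⟩ := exists_units_map_completionMap_eq τ W r
  rw [← map_mul] at hr
  exact ⟨s, Units.map_injective (Place.completionMap (τ : N ≃+* N) W).injective hr⟩

theorem isRealPlace_comap {W : Place N} (hW : IsRealPlace W) (τ : N ≃ₐ[K] N) :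
    IsRealPlace (Place.comap (τ : N ≃+* N) W) := by
  refine ⟨isInfinitePlace_comp _ hW.1, fun h => hW.2 ?_⟩
  have h1 := (isSquare_localUnitsMap_iff τ W (-1)).2 h
  have h2 : Units.map (Place.completionMap (τ : N ≃+* N) W :
      (Place.comap (τ : N ≃+* N) W).Completion →* W.Completion) (-1) = -1 :=
    Units.ext (by simp)
  rwa [h2] at h1

/-- Galois automorphisms act freely on the real places. -/
theorem eq_one_of_comap_eq_of_isRealPlace {W : Place N} (hW : IsRealPlace W) (τ : N ≃ₐ[K] N)
    (h : Place.comap (τ : N ≃+* N) W = W) : τ = 1 := by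
  let w : InfinitePlace N := ⟨W.1, hW.1⟩
  have hreal : w.IsReal := by
    refine w.isReal_or_isComplex.resolve_right fun hc => hW.2 ?_
    obtain ⟨v, hv⟩ := Place.exists_pow_eq_of_ringEquiv_complex (w := W)
      ((InfinitePlace.Completion.equiv w).symm.trans
        (InfinitePlace.Completion.ringEquivComplexOfIsComplex hc)) (-1) two_ne_zero
    exact ⟨v, by rw [← hv, pow_two]⟩
  have hψ := InfinitePlace.isReal_iff.1 hreal
  have hmk : InfinitePlace.mk (w.embedding.comp (τ : N →+* N)) = InfinitePlace.mk w.embedding := by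
    refine Subtype.ext (AbsoluteValue.ext fun x => ?_)
    change ‖w.embedding (τ x)‖ = ‖w.embedding x‖
    rw [InfinitePlace.norm_embedding_eq, InfinitePlace.norm_embedding_eq]
    exact congrArg (fun V : Place N => V.1 x) h
  have hcomp : w.embedding.comp (τ : N →+* N) = w.embedding := by
    -- A real embedding is its own conjugate, so both cases give equality of embeddings.
    rcases InfinitePlace.mk_eq_iff.1 hmk.symm with h' | h'
    · exact h'.symm
    · rw [← h', ComplexEmbedding.isReal_iff.1 hψ]
  exact AlgEquiv.ext fun x => w.embedding.injective (RingHom.congr_fun hcomp x)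

/-- Normalised valuations are compatible with Galois conjugation, and the `ℓ`-adification of `ℤ` is
torsion-free. -/
theorem exists_sub_mem_localU_of_isFinitePlace [IsGalois K N] {σ : N ≃ₐ[K] N}
    (hσ : ∀ τ, τ ∈ Subgroup.zpowers σ) {m : ℕ} (hm : Fintype.card (N ≃ₐ[K] N) = ℓ ^ m)
    {X : Set (Place N)} (hX : IsStable K X) (hXf : ∀ W ∈ X, IsFinitePlace W.1)
    {y : LocalProd ℓ N} (hy : y ∈ ideles ℓ N)
    (hN : ∀ W ∈ X, (∑ τ, localProdRep ℓ K N τ y) W ∈ localU ℓ W) :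
    ∃ d ∈ ideles ℓ N, (∀ W ∉ X, d W = 0) ∧
      ∀ W ∈ X, (y - (localProdRep ℓ K N σ d - d)) W ∈ localU ℓ W := by
  have hφ : ∀ W : Place N, ∃ (q : ℝ) (f : Additive (W.Completion)ˣ →+ ℤ), IsFinitePlace W.1 → 1 < q ∧
      (∃ a : Nˣ, f (.ofMul (Place.embedUnits W a)) = 1) ∧
      (∀ u : (W.Completion)ˣ, ‖(u : W.Completion)‖ = q ^ f (.ofMul u)) ∧ IsUnitQuotient W f := by
    intro W
    by_cases hW : IsFinitePlace W.1
    · obtain ⟨q, f, h⟩ := exists_isUnitQuotient_int hW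
      exact ⟨q, f, fun _ => h⟩
    · exact ⟨0, 0, fun h => absurd h hW⟩
  choose q φ hφ using hφ
  refine exists_sub_mem_localU hσ hX φ (fun W hW => (hφ W (hXf W hW)).2.2.2) (fun τ W hW => ?_)
    (Or.inl fun b hb => ?_) hy hN
  · have hf := hXf W hW
    obtain ⟨hq, ⟨a, ha⟩, hn, -⟩ := hφ W hf
    obtain ⟨hq', ⟨a', ha'⟩, hn', -⟩ := hφ (Place.comap (τ : N ≃+* N) W) (isFinitePlace_comp (τ : N ≃+* N) hf)
    refine AddMonoidHom.ext fun u => ?_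
    refine eq_of_zpow_eq (f := (φ W).comp (localUnitsMap (τ : N ≃+* N) W)) hq hq' (fun u => ?_) ?_
      ⟨_, ha'⟩ u
    · refine ((hn _).symm.trans ?_).trans (hn' u.toMul)
      exact Place.norm_completionMap _ W _
    · obtain ⟨v, hv⟩ := exists_units_map_completionMap_eq τ W (Place.embedUnits W a)
      refine ⟨.ofMul v, ?_⟩
      rw [← ha, ← hv]
      rfl
  · rw [hm] at hb
    exact EllAdic.eq_zero_of_pow_nsmul (fun a ha => by simpa [hℓ.out.ne_zero] using ha) hb

/-- Signs take values in a torsion group, so here it is freeness of the action on real places that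
makes the cycle sums vanish. -/
theorem exists_sub_mem_localU_of_isRealPlace [IsGalois K N] {σ : N ≃ₐ[K] N}
    (hσ : ∀ τ, τ ∈ Subgroup.zpowers σ)
    {X : Set (Place N)} (hX : IsStable K X) (hXr : ∀ W ∈ X, IsRealPlace W)
    {y : LocalProd ℓ N} (hy : y ∈ ideles ℓ N)
    (hN : ∀ W ∈ X, (∑ τ, localProdRep ℓ K N τ y) W ∈ localU ℓ W) :
    ∃ d ∈ ideles ℓ N, (∀ W ∉ X, d W = 0) ∧
      ∀ W ∈ X, (y - (localProdRep ℓ K N σ d - d)) W ∈ localU ℓ W := by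
  have hφ : ∀ W : Place N, ∃ f : Additive (W.Completion)ˣ →+ ZMod 2, IsRealPlace W →
      (∀ u, f (.ofMul u) = 0 ↔ IsSquare u) ∧ IsUnitQuotient W f := by
    intro W
    by_cases hW : IsRealPlace W
    · obtain ⟨f, h⟩ := exists_isUnitQuotient_zmod hW
      exact ⟨f, fun _ => h⟩
    · exact ⟨0, fun h => absurd h hW⟩
  choose φ hφ using hφ
  refine exists_sub_mem_localU hσ hX φ (fun W hW => (hφ W (hXr W hW)).2) (fun τ W hW => ?_)
    (Or.inr fun W hW τ => eq_one_of_comap_eq_of_isRealPlace (hXr W hW) τ) hy hN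
  refine AddMonoidHom.ext fun u => ?_
  have hr := hXr W hW
  have h1 := ((hφ W hr).1 _).trans (isSquare_localUnitsMap_iff τ W u.toMul)
  rw [← (hφ _ (isRealPlace_comap hr τ)).1] at h1
  have h2 : ∀ a b : ZMod 2, (a = 0 ↔ b = 0) → a = b := by decide
  exact h2 _ _ h1

/-- `H⁻¹(Γ, D^T_S(N)) = 0`. -/
theorem exists_sub_mem_idelesUnit [IsGalois K N] {σ : N ≃ₐ[K] N}
    (hσ : ∀ τ, τ ∈ Subgroup.zpowers σ) {m : ℕ} (hm : Fintype.card (N ≃ₐ[K] N) = ℓ ^ m)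
    {S T : Set (Place K)} {y : LocalProd ℓ N} (hy : y ∈ idelesAway ℓ (placesAbove N T))
    (hN : ∑ τ, localProdRep ℓ K N τ y ∈ idelesUnit ℓ (placesAbove N S) (placesAbove N T)) :
    ∃ d ∈ idelesAway ℓ (placesAbove N T), y - (localProdRep ℓ K N σ d - d) ∈
      idelesUnit ℓ (placesAbove N S) (placesAbove N T) := by
  have hout : IsStable K {W : Place N | W ∉ placesAbove N S ∧ W ∉ placesAbove N T} :=
    fun τ W hW => ⟨mt (comap_mem_placesAbove S τ W).1 hW.1, mt (comap_mem_placesAbove T τ W).1 hW.2⟩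
  -- Finite and real places are treated separately; at the remaining infinite places the local group
  -- is zero.
  let X : Set (Place N) := {W | IsFinitePlace W.1 ∧ W ∉ placesAbove N S ∧ W ∉ placesAbove N T}
  let Y : Set (Place N) := {W | IsRealPlace W ∧ W ∉ placesAbove N S ∧ W ∉ placesAbove N T}
  have hX : IsStable K X := fun τ W hW => ⟨isFinitePlace_comp _ hW.1, hout τ W hW.2⟩
  have hY : IsStable K Y := fun τ W hW => ⟨isRealPlace_comap hW.1 τ, hout τ W hW.2⟩
  have hXY : ∀ W, W ∈ X → W ∉ Y := fun W h h' =>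
    Place.not_isInfinitePlace_of_isFinitePlace h.1 h'.1.1
  obtain ⟨d, hd, hd0, hdX⟩ := exists_sub_mem_localU_of_isFinitePlace hσ hm hX (fun _ h => h.1) hy.1
    fun W hW => hN.2 W hW.2.1 hW.2.2
  obtain ⟨e, he, he0, heY⟩ := exists_sub_mem_localU_of_isRealPlace hσ hY (fun _ h => h.1) hy.1
    fun W hW => hN.2 W hW.2.1 hW.2.2
  have hrep : ∀ {Z : Set (Place N)} {c : LocalProd ℓ N}, (∀ W ∉ Z, c W = 0) → ∀ W,
      W ∉ Z → Place.comap (σ : N ≃+* N) W ∉ Z → (localProdRep ℓ K N σ c - c) W = 0 :=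
    fun h W h1 h2 => by
      rw [Pi.sub_apply, localProdRep_apply, h _ h1, h _ h2, map_zero, sub_zero]
  have hst : ∀ {Z : Set (Place N)}, IsStable K Z → ∀ W, W ∉ Z →
      Place.comap (σ : N ≃+* N) W ∉ Z := fun hZ W h h' =>
    h ((placePerm σ).symm_apply_apply W ▸ hZ σ⁻¹ _ h')
  have hsplit : y - (localProdRep ℓ K N σ (d + e) - (d + e)) =
      y - (localProdRep ℓ K N σ d - d) - (localProdRep ℓ K N σ e - e) := by
    rw [map_add]
    abel
  refine ⟨d + e, ⟨add_mem hd he, fun W hW => ?_⟩, fun W hW => ?_, fun W hS hT => ?_⟩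
  · rw [Pi.add_apply, hd0 W fun h => h.2.2 hW, he0 W fun h => h.2.2 hW, add_zero]
  · have h1 : W ∉ X := fun h => h.2.2 hW
    have h2 : W ∉ Y := fun h => h.2.2 hW
    rw [hsplit, Pi.sub_apply, Pi.sub_apply, hrep hd0 W h1 (hst hX W h1),
      hrep he0 W h2 (hst hY W h2), hy.2 W hW, sub_zero, sub_zero]
  · rw [hsplit]
    by_cases hWX : W ∈ X
    · have h2 := hXY W hWX
      rw [Pi.sub_apply, hrep he0 W h2 (hst hY W h2), sub_zero]
      exact hdX W hWX
    by_cases hWY : W ∈ Y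
    · rw [sub_right_comm, Pi.sub_apply, hrep hd0 W hWX (hst hX W hWX), sub_zero]
      exact heY W hWY
    · have hinf : IsInfinitePlace W.1 := W.2.resolve_left fun h => hWX ⟨h, hS, hT⟩
      have h0 := localR_eq_zero_of_isInfinitePlace (ℓ := ℓ) hinf fun h => hWY ⟨h, hS, hT⟩
      exact (Submodule.mem_bot ℤ_[ℓ]).2 (h0 _) |> (bot_le : ⊥ ≤ localU ℓ W)

end Idele

/-! ### Places above a given place and continuity of the norm. -/

open NumberField IsDedekindDomain

section Above

variable {K N : Type*} [Field K] [NumberField K] [Field N] [NumberField N] [Algebra K N]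

namespace Place

/-- The place `W` of `N` lies above the place `v` of `K`. -/
def Above (W : Place N) (v : Place K) : Prop :=
  (W.1.comp (f := algebraMap K N) (algebraMap K N).injective).IsEquiv v.1

theorem mem_placesAbove_iff {S : Set (Place K)} {W : Place N} :
    W ∈ placesAbove N S ↔ ∃ v ∈ S, W.Above v := Iff.rfl

theorem Above.mem_iff {W : Place N} {v : Place K} (h : W.Above v) (S : Set (Place K)) :
    W ∈ placesAbove N S ↔ v ∈ S := by
  refine ⟨fun ⟨v', hv', h'⟩ => ?_, fun hv => ⟨v, hv, h⟩⟩
  rwa [eq_of_isEquiv (h.symm.trans h')]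

theorem Above.exists_rpow {W : Place N} {v : Place K} (h : W.Above v) :
    ∃ c : ℝ, 0 < c ∧ ∀ x : K, W.1 (algebraMap K N x) = v.1 x ^ c := by
  obtain ⟨c, hc, hcv⟩ := AbsoluteValue.isEquiv_iff_exists_rpow_eq.1 h.symm
  exact ⟨c, hc, fun x => (congrFun hcv x).symm⟩

theorem isFinitePlace_iff (w : Place K) : IsFinitePlace w.1 ↔ w.1 2 ≤ 1 := by
  refine ⟨fun h => by simpa using apply_natCast_le_one_of_isFinitePlace h 2, fun h =>
    w.2.resolve_right fun h' => ?_⟩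
  rw [apply_two_of_isInfinitePlace h'] at h
  norm_num at h

theorem Above.isFinitePlace_iff {W : Place N} {v : Place K} (h : W.Above v) :
    IsFinitePlace W.1 ↔ IsFinitePlace v.1 := by
  have h2 : W.1 (algebraMap K N 2) ≤ 1 ↔ v.1 2 ≤ 1 := AbsoluteValue.IsEquiv.le_one_iff h
  rw [Place.isFinitePlace_iff, Place.isFinitePlace_iff, ← h2, map_ofNat (algebraMap K N)]

theorem Above.isInfinitePlace_iff {W : Place N} {v : Place K} (h : W.Above v) :
    IsInfinitePlace W.1 ↔ IsInfinitePlace v.1 :=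
  ⟨fun hW => v.2.resolve_left fun hv =>
      not_isInfinitePlace_of_isFinitePlace (h.isFinitePlace_iff.2 hv) hW,
    fun hv => W.2.resolve_left fun hW =>
      not_isInfinitePlace_of_isFinitePlace (h.isFinitePlace_iff.1 hW) hv⟩

/-- The embedding `K_v → N_W`. -/
theorem Above.exists_ringHom {W : Place N} {v : Place K} (h : W.Above v) :
    ∃ j : v.Completion →+* W.Completion, ∀ x : K, j (embed v x) = embed W (algebraMap K N x) := by
  obtain ⟨c, hc, hcv⟩ := h.exists_rpow
  have hcont : Continuous (WithAbs.map v.1 W.1 (algebraMap K N)) := by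
    refine continuous_of_continuousAt_zero _ ?_
    rw [ContinuousAt, map_zero, tendsto_zero_iff_norm_tendsto_zero]
    have h1 : ∀ x, ‖WithAbs.map v.1 W.1 (algebraMap K N) x‖ = ‖x‖ ^ c := fun x => hcv _
    simp only [h1]
    have h2 : Filter.Tendsto (fun x : WithAbs v.1 => ‖x‖ ^ c) (nhds 0) (nhds (‖(0 : WithAbs v.1)‖ ^ c)) :=
      (continuous_norm.rpow_const fun _ => Or.inr hc.le).tendsto 0
    rwa [norm_zero, Real.zero_rpow hc.ne'] at h2
  exact ⟨UniformSpace.Completion.mapRingHom _ hcont, fun x =>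
    UniformSpace.Completion.mapRingHom_coe _ _⟩

theorem norm_embedding_lt_one_iff (p : HeightOneSpectrum (𝓞 K)) (x : K) :
    ‖FinitePlace.embedding p x‖ < 1 ↔ p.valuation K x < 1 := by
  rw [FinitePlace.norm_embedding, HeightOneSpectrum.adicAbv_def, NNReal.coe_lt_one,
    ← (WithZeroMulInt.toNNReal_strictMono (HeightOneSpectrum.one_lt_absNorm_nnreal p)).lt_iff_lt,
    map_one]

/-- On `K` the `P`-adic valuation is the `p`-adic one raised to the nonzero ramification index, so
elements small at `v` are small at `W`; for nontrivial absolute values this implies equivalence. -/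
theorem above_of_liesOver {P : HeightOneSpectrum (𝓞 N)} {p : HeightOneSpectrum (𝓞 K)}
    (h : P.asIdeal.LiesOver p.asIdeal) {W : Place N} {v : Place K}
    (hW : ∀ x, W.1 x = ‖FinitePlace.embedding P x‖) (hv : ∀ x, v.1 x = ‖FinitePlace.embedding p x‖) :
    W.Above v := by
  refine AbsoluteValue.IsEquiv.symm
    (AbsoluteValue.isEquiv_of_lt_one_imp (isNontrivial v) fun x hx => ?_)
  change W.1 (algebraMap K N x) < 1
  rw [hv, norm_embedding_lt_one_iff] at hx
  rw [hW, norm_embedding_lt_one_iff, ← HeightOneSpectrum.valuation_liesOver N p P]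
  exact pow_lt_one₀ zero_le hx
    (Ideal.IsDedekindDomain.ramificationIdx'_ne_zero_of_liesOver P.asIdeal p.ne_bot)

theorem exists_above_of_place (W : Place N) : ∃ v : Place K, W.Above v := by
  rcases W.2 with hW | hW
  · obtain ⟨P, hP⟩ := hW
    let p : HeightOneSpectrum (𝓞 K) := ⟨P.asIdeal.under (𝓞 K), inferInstance,
      Ideal.under_ne_bot (A := 𝓞 K) P.ne_bot⟩
    exact ⟨⟨(FinitePlace.mk p).1, Or.inl (FinitePlace.mk p).2⟩,
      above_of_liesOver (P := P) (p := p) ⟨rfl⟩ (fun x => by rw [← hP]; rfl) fun x => rfl⟩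
  · obtain ⟨φ, hφ⟩ := hW
    exact ⟨⟨NumberField.place (φ.comp (algebraMap K N)), Or.inr ⟨_, rfl⟩⟩,
      fun x y => by rw [← hφ]; rfl⟩

theorem exists_place_above (v : Place K) : ∃ W : Place N, W.Above v := by
  rcases v.2 with hv | hv
  · obtain ⟨p, hp⟩ := hv
    obtain ⟨P, hPm, hP⟩ := Ideal.exists_maximal_ideal_liesOver_of_isIntegral (S := 𝓞 N) p.asIdeal
    let Q : HeightOneSpectrum (𝓞 N) := ⟨P, hPm.isPrime, Ideal.ne_bot_of_liesOver_of_ne_bot p.ne_bot P⟩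
    exact ⟨⟨(FinitePlace.mk Q).1, Or.inl (FinitePlace.mk Q).2⟩,
      above_of_liesOver (P := Q) (p := p) hP (fun x => rfl) fun x => by rw [← hp]; rfl⟩
  · obtain ⟨w, hw⟩ := InfinitePlace.comap_surjective (K := N) (⟨v.1, hv⟩ : InfinitePlace K)
    refine ⟨⟨w.1, Or.inr w.2⟩, fun x y => ?_⟩
    rw [← congrArg (fun u : InfinitePlace K => u.1) hw]
    rfl

/-- Weak approximation of units, with separate bounds. -/
theorem exists_units_norm_sub_lt {T : Set (Place K)} (hT : T.Finite)
    (z : ∀ w : Place K, (w.Completion)ˣ) (ε : Place K → ℝ) (hε : ∀ w, 0 < ε w) :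
    ∃ u : Kˣ, ∀ w ∈ T, ‖(embedUnits w u : w.Completion) - z w‖ < ε w := by
  rcases T.eq_empty_or_nonempty with rfl | hne
  · exact ⟨1, by simp⟩
  obtain ⟨w₀, hw₀, hmin⟩ := hT.toFinset.exists_min_image
    (fun w => min (ε w) ‖(z w : w.Completion)‖) (by simpa using hne)
  obtain ⟨c, hc⟩ := exists_norm_embed_sub_lt hT (fun w => (z w : w.Completion))
    (lt_min (hε w₀) (norm_pos_iff.2 (z w₀).ne_zero))
  have hc' : ∀ w ∈ T, ‖embed w c - z w‖ < min (ε w) ‖(z w : w.Completion)‖ := fun w hw =>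
    (hc w hw).trans_le (hmin w (by simpa using hw))
  have hc0 : c ≠ 0 := by
    rintro rfl
    have := (hc' w₀ (by simpa using hw₀)).trans_le (min_le_right _ _)
    rw [map_zero, zero_sub, norm_neg] at this
    exact this.false
  exact ⟨Units.mk0 c hc0, fun w hw => (hc' w hw).trans_le (min_le_left _ _)⟩

end Place

/-- Continuity of the norm at `1`. -/
theorem exists_apply_norm_sub_one_lt [IsGalois K N] (v : Place K) {ε : ℝ} (hε : 0 < ε) :
    ∃ δ > 0, ∀ c : N, (∀ W : Place N, W.Above v → W.1 (c - 1) < δ) →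
      v.1 (Algebra.norm K c - 1) < ε := by
  obtain ⟨W, hW⟩ := Place.exists_place_above (N := N) v
  obtain ⟨t, ht, hWv⟩ := hW.exists_rpow
  set d : ℕ := Fintype.card (N ≃ₐ[K] N) with hd
  have hd0 : 0 < d := Fintype.card_pos
  have hη : 0 < ε ^ t := Real.rpow_pos_of_pos hε t
  have hlog : 0 < Real.log (1 + ε ^ t) := Real.log_pos (by linarith)
  -- Chosen for the estimate `‖∏ (1 + x) - 1‖ ≤ exp (∑ ‖x‖) - 1` over `d` conjugates; the exponent
  -- `t` converts `v` into `W` on `K`.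
  refine ⟨Real.log (1 + ε ^ t) / d, by positivity, fun c hc => ?_⟩
  have hτ : ∀ τ : N ≃ₐ[K] N, ‖Place.embed W (τ c - 1)‖ < Real.log (1 + ε ^ t) / d := fun τ => by
    have h1 := hc (Place.comap (τ : N ≃+* N) W) (by
      refine AbsoluteValue.IsEquiv.trans (fun x y => ?_) hW
      change W.1 (τ (algebraMap K N x)) ≤ W.1 (τ (algebraMap K N y)) ↔ _
      rw [τ.commutes, τ.commutes]
      rfl)
    rw [Place.norm_embed]
    have h2 : τ c - 1 = τ (c - 1) := by rw [map_sub, map_one]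
    rw [h2]
    exact h1
  have hprod : W.1 (algebraMap K N (Algebra.norm K c - 1)) < ε ^ t := by
    rw [← Place.norm_embed, map_sub, map_one, Algebra.norm_eq_prod_automorphisms, map_sub, map_one,
      map_prod]
    have h3 := Finset.univ.norm_prod_one_add_sub_one_le
      (fun τ : N ≃ₐ[K] N => Place.embed W (τ c - 1))
    have h4 : ∀ τ : N ≃ₐ[K] N, 1 + Place.embed W (τ c - 1) = Place.embed W (τ c) := fun τ => by
      rw [map_sub, map_one]; ring
    simp only [h4] at h3
    have h5 : ∑ τ : N ≃ₐ[K] N, ‖Place.embed W (τ c - 1)‖ < Real.log (1 + ε ^ t) := by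
      calc _ < ∑ τ : N ≃ₐ[K] N, Real.log (1 + ε ^ t) / d :=
            Finset.sum_lt_sum_of_nonempty Finset.univ_nonempty fun τ _ => hτ τ
        _ = _ := by
          rw [Finset.sum_const, Finset.card_univ, ← hd, nsmul_eq_mul]
          field_simp
    have h6 := Real.exp_lt_exp.2 h5
    rw [Real.exp_log (by linarith)] at h6
    exact h3.trans_lt (by linarith)
  rw [hWv] at hprod
  exact (Real.rpow_lt_rpow_iff (v.1.nonneg _) hε.le ht).1 hprod

/-- The norm of an element that is locally an `n`-th power at all places above `v` is an `n`-th
power in `K_v`. -/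
theorem exists_embedUnits_norm_eq_pow [IsGalois K N] (v : Place K) {n : ℕ} (hn : n ≠ 0) (u : Nˣ)
    (hu : ∀ W : Place N, W.Above v → ∃ r, Place.embedUnits W u = r ^ n) :
    ∃ r, Place.embedUnits v (normUnits K N u) = r ^ n := by
  obtain ⟨ε, hε, hpow⟩ := Place.exists_pow_eq_of_norm_sub_one_lt v hn
  obtain ⟨δ, hδ, hnorm⟩ := exists_apply_norm_sub_one_lt (N := N) v hε
  have hr : ∀ W : Place N, ∃ r : (W.Completion)ˣ, W.Above v → Place.embedUnits W u = r ^ n := by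
    intro W
    by_cases hW : W.Above v
    · obtain ⟨r, hr⟩ := hu W hW
      exact ⟨r, fun _ => hr⟩
    · exact ⟨1, fun h => absurd h hW⟩
  choose r hr using hr
  have hε' : ∀ W : Place N, ∃ ε > 0, ∀ x : W.Completion, ‖x - (r W)⁻¹‖ < ε →
      ‖(r W * x) ^ n - 1‖ < δ := by
    intro W
    have hc : Continuous fun x : W.Completion => ((r W : W.Completion) * x) ^ n :=
      (continuous_const.mul continuous_id).pow n
    obtain ⟨ε, hε, h⟩ := Metric.continuous_iff.1 hc ((r W)⁻¹ : (W.Completion)ˣ) δ hδ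
    refine ⟨ε, hε, fun x hx => ?_⟩
    have := h x (by rwa [dist_eq_norm])
    rwa [dist_eq_norm, Units.mul_inv, one_pow] at this
  choose ε' hε' hδ' using hε'
  have hfin : {W : Place N | W.Above v}.Finite := by
    refine (finite_placesAbove (N := N) (Set.finite_singleton v)).subset fun W hW => ⟨v, rfl, hW⟩
  -- With `b` close to each `(r W)⁻¹`, the global element `u * b ^ n` is close to `1` above `v`. Its
  -- norm is then close to `1` at `v`, hence an `n`-th power; no local norm maps are needed.
  obtain ⟨b, hb⟩ := Place.exists_units_norm_sub_lt hfin (fun W => (r W)⁻¹) ε' hε'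
  obtain ⟨s, hs⟩ := hpow (Place.embedUnits v (normUnits K N (u * b ^ n))) (by
    change ‖Place.embed v (Algebra.norm K ((u * b ^ n : Nˣ) : N)) - 1‖ < ε
    rw [← map_one (Place.embed v), ← map_sub, Place.norm_embed]
    refine hnorm _ fun W hW => ?_
    have h1 := hδ' W (Place.embedUnits W b) (hb W hW)
    rw [mul_pow, ← Units.val_pow_eq_pow_val, ← hr W hW] at h1
    rw [← Place.norm_embed, map_sub, map_one, Units.val_mul, Units.val_pow_eq_pow_val, map_mul,
      map_pow]
    exact h1)
  refine ⟨s * (Place.embedUnits v (normUnits K N b))⁻¹, ?_⟩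
  rw [mul_pow, hs, map_mul, map_mul, map_pow, map_pow, inv_pow, mul_inv_cancel_right]

end Above

/-! ### Comparison of units of `K` and of `N`. -/

open NumberField

section UnitsAbove

variable {ℓ : ℕ} [hℓ : Fact ℓ.Prime]
variable {K N : Type*} [Field K] [NumberField K] [Field N] [NumberField N] [Algebra K N]

theorem EllAdic.eq_zero_of_zsmul {A : Type*} [AddCommGroup A] (h : ∀ a : A, ℓ • a = 0 → a = 0)
    {k : ℤ} (hk : k ≠ 0) {x : EllAdic ℓ A} (hx : k • x = 0) : x = 0 := by
  have hk' : (k : ℤ_[ℓ]) ≠ 0 := Int.cast_ne_zero.2 hk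
  rw [← Int.cast_smul_eq_zsmul ℤ_[ℓ], PadicInt.unitCoeff_spec hk', mul_smul] at hx
  have h1 := (PadicInt.unitCoeff hk').isUnit.smul_eq_zero.1 hx
  rw [← Nat.cast_pow, Nat.cast_smul_eq_nsmul] at h1
  exact eq_zero_of_pow_nsmul h h1

theorem map_diag_principalIncl {B : Type*} [AddCommGroup B] {W : Place N} {v : Place K}
    {f : Additive (W.Completion)ˣ →+ B} {g : Additive (v.Completion)ˣ →+ B} {k : ℤ}
    (h : ∀ u : Kˣ, f (.ofMul (Place.embedUnits W (inclUnits K N u))) =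
      k • g (.ofMul (Place.embedUnits v u))) (x : Principal ℓ K) :
    EllAdic.map ℓ f (diag ℓ N (principalIncl ℓ K N x) W) = k • EllAdic.map ℓ g (diag ℓ K x v) := by
  induction x using TensorProduct.induction_on with
  | zero => simp
  | add x y hx hy => simp only [map_add, Pi.add_apply, hx, hy, smul_add]
  | tmul z u =>
    have h1 := diag_tmul z u.toMul v
    have h2 := diag_tmul z (inclUnits K N u.toMul) W
    refine (congrArg (EllAdic.map ℓ f) h2).trans (Eq.trans ?_
      (congrArg (fun t => k • EllAdic.map ℓ g t) h1).symm)
    simp only [map_smul, EllAdic.map_of, h, map_zsmul]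
    rw [smul_comm]

theorem diag_principalIncl_eq_zero {W : Place N} {v : Place K} (h : W.Above v) {x : Principal ℓ K}
    (hx : diag ℓ K x v = 0) : diag ℓ N (principalIncl ℓ K N x) W = 0 := by
  obtain ⟨j, hj⟩ := h.exists_ringHom
  refine EllAdic.ext ℓ fun n => ?_
  obtain ⟨u, y, hu⟩ := exists_ofUnit_add x n
  have h1 : principalIncl ℓ K N x =
      ofUnit ℓ (inclUnits K N u) + ℓ ^ n • principalIncl ℓ K N y := by
    rw [hu, map_add, map_nsmul, principalIncl_ofUnit]
  rw [EllAdic.zero_apply, diag_level_eq_zero_iff h1]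
  obtain ⟨r, hr⟩ := (diag_level_eq_zero_iff hu v).1 (by rw [hx, EllAdic.zero_apply])
  refine ⟨Units.map (j : v.Completion →* W.Completion) r, ?_⟩
  rw [← map_pow, ← hr]
  exact Units.ext (hj u).symm

theorem diag_principalNorm_eq_zero [IsGalois K N] {v : Place K} {a : Principal ℓ N}
    (ha : ∀ W : Place N, W.Above v → diag ℓ N a W = 0) :
    diag ℓ K (principalNorm ℓ K N a) v = 0 := by
  refine EllAdic.ext ℓ fun n => ?_
  obtain ⟨u, y, hu⟩ := exists_ofUnit_add a n
  have h1 : principalNorm ℓ K N a = ofUnit ℓ (normUnits K N u) + ℓ ^ n • principalNorm ℓ K N y := by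
    rw [hu, map_add, map_nsmul, principalNorm_ofUnit]
  rw [EllAdic.zero_apply, diag_level_eq_zero_iff h1]
  exact exists_embedUnits_norm_eq_pow v (pow_ne_zero n hℓ.out.ne_zero) u fun W hW =>
    (diag_level_eq_zero_iff hu W).1 (by rw [ha W hW, EllAdic.zero_apply])

/-- On `K` the order at `W` is a nonzero integral multiple of the order at `v`, and multiplication
by a nonzero integer is injective on the `ℓ`-adification of `ℤ`. -/
theorem mem_localU_above_iff_of_isFinitePlace {W : Place N} {v : Place K} (h : W.Above v)
    (hv : IsFinitePlace v.1) (x : Principal ℓ K) :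
    diag ℓ N (principalIncl ℓ K N x) W ∈ localU ℓ W ↔ diag ℓ K x v ∈ localU ℓ v := by
  obtain ⟨q, f, hq, -, hf, hfW⟩ := exists_isUnitQuotient_int (h.isFinitePlace_iff.2 hv)
  obtain ⟨r, g, hr, hg1, hg, hgv⟩ := exists_isUnitQuotient_int hv
  obtain ⟨c, hc, hcv⟩ := h.exists_rpow
  have hq0 := Real.log_pos hq
  have hr0 := Real.log_pos hr
  have hlog : ∀ u : Kˣ, (f (.ofMul (Place.embedUnits W (inclUnits K N u))) : ℝ) * Real.log q =
      c * (g (.ofMul (Place.embedUnits v u)) * Real.log r) := fun u => by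
    rw [← log_eq_of_eq_zpow (hf _), ← log_eq_of_eq_zpow (hg _)]
    change Real.log ‖Place.embed W (algebraMap K N u)‖ = c * Real.log ‖Place.embed v u‖
    rw [Place.norm_embed, Place.norm_embed, hcv, Real.log_rpow (v.1.pos u.ne_zero)]
  obtain ⟨k, hk, hfg⟩ := exists_int_smul_of_real
    (f := fun u : Kˣ => f (.ofMul (Place.embedUnits W (inclUnits K N u))))
    (g := fun u : Kˣ => g (.ofMul (Place.embedUnits v u))) (κ := c * Real.log r / Real.log q)
    (fun u => by
      rw [div_mul_eq_mul_div, eq_div_iff hq0.ne', hlog]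
      ring) hg1
  have hk0 : k ≠ 0 := by
    rintro rfl
    have : 0 < c * Real.log r / Real.log q := by positivity
    rw [← hk, Int.cast_zero] at this
    exact this.false
  rw [hfW.mem_localU_iff, hgv.mem_localU_iff,
    map_diag_principalIncl (fun u => (hfg u).trans (smul_eq_mul _ _).symm)]
  refine ⟨fun h0 => EllAdic.eq_zero_of_zsmul (fun a ha => ?_) hk0 h0, fun h0 => by
    rw [h0, smul_zero]⟩
  simpa [hℓ.out.ne_zero] using ha

theorem isRealPlace_of_above {W : Place N} {v : Place K} (h : W.Above v) (hW : IsRealPlace W) :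
    IsRealPlace v := by
  obtain ⟨j, -⟩ := h.exists_ringHom
  refine ⟨h.isInfinitePlace_iff.1 hW.1, fun hs => hW.2 ?_⟩
  have := hs.map (Units.map (j : v.Completion →* W.Completion))
  rwa [show Units.map (j : v.Completion →* W.Completion) (-1) = -1 from Units.ext (by simp)] at this

/-- The sign at `W` restricts to the sign at `v`: were a non-square of `K_v` to become a square in
`N_W`, its negative would too, and `-1` would be a square. -/
theorem mem_localU_above_iff_of_isRealPlace {W : Place N} {v : Place K} (h : W.Above v)
    (hW : IsRealPlace W) (x : Principal ℓ K) :
    diag ℓ N (principalIncl ℓ K N x) W ∈ localU ℓ W ↔ diag ℓ K x v ∈ localU ℓ v := by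
  have hv := isRealPlace_of_above h hW
  obtain ⟨j, hj⟩ := h.exists_ringHom
  obtain ⟨f, hf, hfW⟩ := exists_isUnitQuotient_zmod hW
  obtain ⟨g, hg, hgv⟩ := exists_isUnitQuotient_zmod hv
  have hsq : ∀ u : Kˣ, IsSquare (Place.embedUnits v u) →
      IsSquare (Place.embedUnits W (inclUnits K N u)) := fun u hu => by
    have := hu.map (Units.map (j : v.Completion →* W.Completion))
    rwa [show Units.map (j : v.Completion →* W.Completion) (Place.embedUnits v u) =
      Place.embedUnits W (inclUnits K N u) from Units.ext (hj u)] at this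
  have hiff : ∀ u : Kˣ, IsSquare (Place.embedUnits W (inclUnits K N u)) ↔
      IsSquare (Place.embedUnits v u) := fun u => by
    refine ⟨fun hs => ?_, hsq u⟩
    refine (Place.isSquare_or_isSquare_neg hv.1 _).resolve_right fun hn => hW.2 ?_
    have h1 := hsq (-u) (by rwa [show Place.embedUnits v (-u) = -Place.embedUnits v u from
      Units.ext (by simp)])
    have h2 := h1.div hs
    rwa [show Place.embedUnits W (inclUnits K N (-u)) = -Place.embedUnits W (inclUnits K N u) from
      Units.ext (by simp), neg_div, div_self'] at h2
  have h2 : ∀ a b : ZMod 2, (a = 0 ↔ b = 0) → a = b := by decide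
  rw [hfW.mem_localU_iff, hgv.mem_localU_iff, map_diag_principalIncl (g := g) (k := 1) (fun u => by
    rw [one_smul]
    exact h2 _ _ ((hf _).trans ((hiff u).trans (hg _).symm))), one_smul]

theorem mem_localU_above {W : Place N} {v : Place K} (h : W.Above v) {x : Principal ℓ K}
    (hx : diag ℓ K x v ∈ localU ℓ v) : diag ℓ N (principalIncl ℓ K N x) W ∈ localU ℓ W := by
  rcases v.2 with hv | hv
  · exact (mem_localU_above_iff_of_isFinitePlace h hv x).2 hx
  · by_cases hW : IsRealPlace W
    · exact (mem_localU_above_iff_of_isRealPlace h hW x).2 hx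
    · rw [localR_eq_zero_of_isInfinitePlace (h.isInfinitePlace_iff.2 hv) hW (diag ℓ N _ W)]
      exact zero_mem _

/-- `E^T_S(K) ⊆ E^T_S(N)`. -/
theorem diag_principalIncl_mem_idelesUnit {S T : Set (Place K)} {x : Principal ℓ K}
    (hx : x ∈ unitsST ℓ S T) : diag ℓ N (principalIncl ℓ K N x) ∈
      idelesUnit ℓ (placesAbove N S) (placesAbove N T) := by
  have hx' := (mem_unitsST_iff S T x).1 hx
  refine ⟨fun W hW => ?_, fun W hS hT => ?_⟩
  · obtain ⟨v, hv, h⟩ := Place.mem_placesAbove_iff.1 hW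
    exact diag_principalIncl_eq_zero h (hx'.1 v hv)
  · obtain ⟨v, h⟩ := Place.exists_above_of_place (K := K) W
    exact mem_localU_above h (hx'.2 v (mt (h.mem_iff S).2 hS) (mt (h.mem_iff T).2 hT))

/-- The norms of `T`-infinitesimal elements that become `S`-units of `N` are `S`-units of `K`. -/
theorem principalNorm_mem_unitsST [IsGalois K N] {S T : Set (Place K)} {a : Principal ℓ N}
    (ha : a ∈ infinitesimal ℓ (placesAbove N T))
    (hN : diag ℓ N (principalIncl ℓ K N (principalNorm ℓ K N a)) ∈
      idelesUnit ℓ (placesAbove N S) (placesAbove N T)) :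
    principalNorm ℓ K N a ∈ unitsST ℓ S T := by
  rw [mem_unitsST_iff]
  have ha' := (mem_infinitesimal_iff _ _).1 ha
  refine ⟨fun v hv => diag_principalNorm_eq_zero fun W hW => ha' W ((hW.mem_iff T).2 hv),
    fun v hS hT => ?_⟩
  have hloc : ∀ W : Place N, W.Above v →
      diag ℓ N (principalIncl ℓ K N (principalNorm ℓ K N a)) W ∈ localU ℓ W := fun W h =>
    hN.2 W (mt (h.mem_iff S).1 hS) (mt (h.mem_iff T).1 hT)
  rcases v.2 with hv | hv
  · obtain ⟨W, hW⟩ := Place.exists_place_above (N := N) v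
    exact (mem_localU_above_iff_of_isFinitePlace hW hv _).1 (hloc W hW)
  · by_cases hr : ∃ W : Place N, W.Above v ∧ IsRealPlace W
    · obtain ⟨W, hW, hWr⟩ := hr
      exact (mem_localU_above_iff_of_isRealPlace hW hWr _).1 (hloc W hW)
    -- With only complex places above `v`, nothing can be read off upstairs; but all local groups
    -- there vanish, so the norm is trivial at `v`.
    · rw [diag_principalNorm_eq_zero fun W hW => localR_eq_zero_of_isInfinitePlace
        (hW.isInfinitePlace_iff.2 hv) (fun h => hr ⟨W, hW, h⟩) _]
      exact zero_mem _

end UnitsAbove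

/-! ### Linked pairs and the comparison of the two quotients. -/

open NumberField

section Comparison

variable {ℓ : ℕ} [hℓ : Fact ℓ.Prime]
variable {K N : Type*} [Field K] [NumberField K] [Field N] [NumberField N] [Algebra K N]

/-- Two quotients of one module with the same kernel are isomorphic. -/
theorem nonempty_quotient_linearEquiv {R B A C : Type*} [Ring R] [AddCommGroup B] [AddCommGroup A]
    [AddCommGroup C] [Module R B] [Module R A] [Module R C] (f : B →ₗ[R] A) (g : B →ₗ[R] C)
    (hf : Function.Surjective f) (hg : Function.Surjective g) (A₀ : Submodule R A)
    (C₀ : Submodule R C) (h : ∀ b, f b ∈ A₀ ↔ g b ∈ C₀) : Nonempty ((A ⧸ A₀) ≃ₗ[R] (C ⧸ C₀)) := by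
  have hker : LinearMap.ker (A₀.mkQ.comp f) = LinearMap.ker (C₀.mkQ.comp g) := by
    ext b
    simp [LinearMap.mem_ker, h b]
  exact ⟨((A₀.mkQ.comp f).quotKerEquivOfSurjective (A₀.mkQ_surjective.comp hf)).symm.trans
    ((Submodule.quotEquivOfEq _ _ hker).trans
      ((C₀.mkQ.comp g).quotKerEquivOfSurjective (C₀.mkQ_surjective.comp hg)))⟩

theorem nonempty_subquotient_linearEquiv {R P V W : Type*} [Ring R] [AddCommGroup P]
    [AddCommGroup V] [AddCommGroup W] [Module R P] [Module R V] [Module R W] (B : Submodule R P)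
    (f : P →ₗ[R] V) (g : P →ₗ[R] W) (A A₀ : Submodule R V) (C C₀ : Submodule R W)
    (hfA : ∀ p ∈ B, f p ∈ A) (hgC : ∀ p ∈ B, g p ∈ C) (hf : ∀ a ∈ A, ∃ p ∈ B, f p = a)
    (hg : ∀ c ∈ C, ∃ p ∈ B, g p = c) (h : ∀ p ∈ B, f p ∈ A₀ ↔ g p ∈ C₀) :
    Nonempty ((A ⧸ A₀.submoduleOf A) ≃ₗ[R] (C ⧸ C₀.submoduleOf C)) := by
  refine nonempty_quotient_linearEquiv
    ((f.comp B.subtype).codRestrict A fun p => hfA p.1 p.2)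
    ((g.comp B.subtype).codRestrict C fun p => hgC p.1 p.2) ?_ ?_ _ _ fun p => h p.1 p.2
  · rintro ⟨a, ha⟩
    obtain ⟨p, hp, rfl⟩ := hf a ha
    exact ⟨⟨p, hp⟩, rfl⟩
  · rintro ⟨c, hc⟩
    obtain ⟨p, hp, rfl⟩ := hg c hc
    exact ⟨⟨p, hp⟩, rfl⟩

theorem mem_invariants_iff_of_generator {k G V : Type*} [CommRing k] [Group G] [Finite G]
    [AddCommGroup V] [Module k V] (ρ : Representation k G V) {g : G}
    (hg : ∀ h, h ∈ Subgroup.zpowers g) (x : V) : x ∈ ρ.invariants ↔ ρ g x = x := by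
  refine ⟨fun h => h g, fun h τ => ?_⟩
  obtain ⟨i, rfl⟩ := (mem_powers_iff_mem_zpowers.2 (hg τ) : τ ∈ Submonoid.powers g)
  change ρ (g ^ i) x = x
  induction i with
  | zero => rw [pow_zero, map_one, Module.End.one_apply]
  | succ i ih => rw [pow_succ, map_mul, Module.End.mul_apply, h, ih]

theorem principalMap_principalIncl (σ : N ≃ₐ[K] N) (x : Principal ℓ K) :
    principalMap ℓ K N σ (principalIncl ℓ K N x) = principalIncl ℓ K N x := by
  induction x using TensorProduct.induction_on with
  | zero => simp
  | add x y hx hy => simp only [map_add, hx, hy]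
  | tmul z u =>
    change z ⊗ₜ[ℤ] Additive.ofMul (Units.map (σ : N →* N) (inclUnits K N u.toMul)) =
      z ⊗ₜ[ℤ] Additive.ofMul (inclUnits K N u.toMul)
    congr 2
    exact Units.ext (σ.commutes _)

theorem mk_mem_principalDivisors_iff {S T : Set (Place N)} (d : idelesAway ℓ T) :
    ((idelesUnit ℓ S T).submoduleOf (idelesAway ℓ T)).mkQ d ∈ principalDivisors ℓ S T ↔
      ∃ a ∈ infinitesimal ℓ T, (d : LocalProd ℓ N) - diag ℓ N a ∈ idelesUnit ℓ S T := by
  constructor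
  · rintro ⟨e, ⟨a, ha, hae⟩, he⟩
    refine ⟨a, ha, ?_⟩
    have h1 := (Submodule.Quotient.eq _).1 he.symm
    rw [hae]
    exact h1
  · rintro ⟨a, ha, h⟩
    exact ⟨⟨diag ℓ N a, ha⟩, ⟨a, ha, rfl⟩, ((Submodule.Quotient.eq
      ((idelesUnit ℓ S T).submoduleOf (idelesAway ℓ T)) (x := d) (y := ⟨diag ℓ N a, ha⟩)).2 h).symm⟩

theorem sum_localProdRep_diag [IsGalois K N] (a : Principal ℓ N) :
    ∑ τ, localProdRep ℓ K N τ (diag ℓ N a) = diag ℓ N (principalIncl ℓ K N (principalNorm ℓ K N a)) := by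
  rw [principalIncl_principalNorm, map_sum]
  exact Finset.sum_congr rfl fun τ _ => localProdRep_diag ℓ τ a

theorem sum_localProdRep_sub [IsGalois K N] (σ : N ≃ₐ[K] N) (d : LocalProd ℓ N) :
    ∑ τ, localProdRep ℓ K N τ (localProdRep ℓ K N σ d - d) = 0 := by
  simp only [map_sub, Finset.sum_sub_distrib, ← Module.End.mul_apply, ← map_mul]
  rw [sub_eq_zero]
  exact Fintype.sum_equiv (Equiv.mulRight σ) _ _ fun τ => rfl

variable (ℓ) in
/-- The pairs `(d, a)` such that `σ d - d` and `a` define the same `S`-divisor. -/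
noncomputable def linkedPairs (σ : N ≃ₐ[K] N) (S T : Set (Place K)) :
    Submodule ℤ_[ℓ] (idelesAway ℓ (placesAbove N T) × infinitesimal ℓ (placesAbove N T)) :=
  (idelesUnit ℓ (placesAbove N S) (placesAbove N T)).comap
    ((localProdRep ℓ K N σ).comp ((Submodule.subtype _).comp (LinearMap.fst _ _ _)) -
      (Submodule.subtype _).comp (LinearMap.fst _ _ _) -
      (diag ℓ N).comp ((Submodule.subtype _).comp (LinearMap.snd _ _ _)))

theorem mem_linkedPairs_iff {σ : N ≃ₐ[K] N} {S T : Set (Place K)}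
    (p : idelesAway ℓ (placesAbove N T) × infinitesimal ℓ (placesAbove N T)) :
    p ∈ linkedPairs ℓ σ S T ↔ localProdRep ℓ K N σ p.1 - p.1 - diag ℓ N p.2 ∈
      idelesUnit ℓ (placesAbove N S) (placesAbove N T) := Iff.rfl

variable (ℓ N) in
/-- The projection from `J^T(N)` to the class group `Cl^T_S(N)`. -/
noncomputable def classOf (S T : Set (Place K)) : idelesAway ℓ (placesAbove N T) →ₗ[ℤ_[ℓ]]
    ClassGroupST ℓ (placesAbove N S) (placesAbove N T) :=
  (principalDivisors ℓ (placesAbove N S) (placesAbove N T)).mkQ.comp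
    ((idelesUnit ℓ (placesAbove N S) (placesAbove N T)).submoduleOf
      (idelesAway ℓ (placesAbove N T))).mkQ

theorem classOf_surjective (S T : Set (Place K)) : Function.Surjective (classOf ℓ N S T) :=
  (Submodule.mkQ_surjective _).comp (Submodule.mkQ_surjective _)

theorem classOf_eq_zero_iff {S T : Set (Place K)} (d : idelesAway ℓ (placesAbove N T)) :
    classOf ℓ N S T d = 0 ↔ ∃ a ∈ infinitesimal ℓ (placesAbove N T),
      (d : LocalProd ℓ N) - diag ℓ N a ∈ idelesUnit ℓ (placesAbove N S) (placesAbove N T) :=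
  (Submodule.Quotient.mk_eq_zero _).trans (mk_mem_principalDivisors_iff d)

section Maps

variable [IsGalois K N] {σ : N ≃ₐ[K] N} (hσ : ∀ τ, τ ∈ Subgroup.zpowers σ) {S T : Set (Place K)}
include hσ

/-- The right side says that `d` is the first component of a linked pair, so this gives both the
target and the surjectivity of the first projection. -/
theorem classOf_mem_ambiguousClasses_iff (d : idelesAway ℓ (placesAbove N T)) :
    classOf ℓ N S T d ∈ ambiguousClasses ℓ N S T ↔
      ∃ a ∈ infinitesimal ℓ (placesAbove N T), localProdRep ℓ K N σ d - d - diag ℓ N a ∈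
        idelesUnit ℓ (placesAbove N S) (placesAbove N T) := by
  refine (mem_invariants_iff_of_generator (classRep ℓ N S T) hσ _).trans ?_
  rw [← sub_eq_zero]
  have h : classRep ℓ N S T σ (classOf ℓ N S T d) = classOf ℓ N S T (idelesAwayRep ℓ N T σ d) := rfl
  rw [h, ← map_sub, classOf_eq_zero_iff]
  rfl

theorem classOf_mem_classesOfAmbiguousDivisors_iff (d : idelesAway ℓ (placesAbove N T)) :
    classOf ℓ N S T d ∈ classesOfAmbiguousDivisors ℓ N S T ↔
      ∃ d' : idelesAway ℓ (placesAbove N T), ∃ a ∈ infinitesimal ℓ (placesAbove N T),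
        localProdRep ℓ K N σ d' - d' ∈ idelesUnit ℓ (placesAbove N S) (placesAbove N T) ∧
        (d : LocalProd ℓ N) - d' - diag ℓ N a ∈
          idelesUnit ℓ (placesAbove N S) (placesAbove N T) := by
  have hinv : ∀ d' : idelesAway ℓ (placesAbove N T),
      ((idelesUnit ℓ (placesAbove N S) (placesAbove N T)).submoduleOf
        (idelesAway ℓ (placesAbove N T))).mkQ d' ∈ (divisorsRep ℓ N S T).invariants ↔
      localProdRep ℓ K N σ d' - d' ∈ idelesUnit ℓ (placesAbove N S) (placesAbove N T) := fun d' =>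
    (mem_invariants_iff_of_generator (divisorsRep ℓ N S T) hσ _).trans
      (Submodule.Quotient.eq _ (x := idelesAwayRep ℓ N T σ d'))
  constructor
  · rintro ⟨D, hD, hDd⟩
    obtain ⟨d', rfl⟩ := Submodule.mkQ_surjective _ D
    have h1 : classOf ℓ N S T (d - d') = 0 := by
      rw [map_sub, sub_eq_zero]
      exact hDd.symm
    obtain ⟨a, ha, h2⟩ := (classOf_eq_zero_iff _).1 h1
    exact ⟨d', a, ha, (hinv d').1 hD, h2⟩
  · rintro ⟨d', a, ha, h1, h2⟩
    refine ⟨_, (hinv d').2 h1, ?_⟩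
    have h3 : classOf ℓ N S T (d - d') = 0 := (classOf_eq_zero_iff _).2 ⟨a, ha, h2⟩
    rw [map_sub, sub_eq_zero] at h3
    exact h3.symm

/-- The kernels of the two projections from the linked pairs agree. -/
theorem classOf_mem_classesOfAmbiguousDivisors_iff_norm (hT : T.Finite)
    {p : idelesAway ℓ (placesAbove N T) × infinitesimal ℓ (placesAbove N T)}
    (hp : p ∈ linkedPairs ℓ σ S T) :
    classOf ℓ N S T p.1 ∈ classesOfAmbiguousDivisors ℓ N S T ↔
      principalNorm ℓ K N p.2 ∈ normsOfUnits ℓ N S T := by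
  obtain ⟨d, a, ha⟩ := p
  rw [mem_linkedPairs_iff] at hp
  rw [classOf_mem_classesOfAmbiguousDivisors_iff hσ]
  constructor
  · rintro ⟨d', a', ha', h1, h2⟩
    have h3 := idelesUnit_le_comap ℓ S T σ h2
    -- Modulo unit ideles `d` is `d' + a'` with `d'` invariant, so `σ a' - a'` has the divisor of
    -- `a`; removing it leaves a unit with the norm of `a`.
    refine ⟨a - (principalMap ℓ K N σ a' - a'), (mem_unitsST_iff _ _ _).2 ?_, ?_⟩
    · have h4 : diag ℓ N (a - (principalMap ℓ K N σ a' - a')) =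
          localProdRep ℓ K N σ (d - d' - diag ℓ N a') - (d - d' - diag ℓ N a') +
            (localProdRep ℓ K N σ d' - d') - (localProdRep ℓ K N σ d - d - diag ℓ N a) := by
        rw [map_sub, map_sub, map_sub, map_sub, localProdRep_diag]
        abel
      rw [h4]
      exact sub_mem (add_mem (sub_mem h3 h2) h1) hp
    · rw [map_sub, map_sub, principalNorm_principalMap, sub_self, sub_zero]
  · rintro ⟨e, he, hea⟩
    have he' := (mem_unitsST_iff _ _ _).1 he
    obtain ⟨b, hb⟩ := exists_principalMap_sub_eq hσ (a - e) (by rw [map_sub, hea, sub_self])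
    obtain ⟨k, hk⟩ := exists_sub_principalIncl_mem hσ hT b (by
      rw [← hb]
      exact sub_mem ha he.1)
    have hd' : (d : LocalProd ℓ N) - diag ℓ N (b - principalIncl ℓ K N k) ∈
        idelesAway ℓ (placesAbove N T) := sub_mem d.2 hk
    -- The invariant divisor is that of `d - (b - k)`: as `k` is fixed by `σ`, applying `σ - 1`
    -- gives `(σ d - d - a) + e`, a sum of unit ideles.
    refine ⟨⟨_, hd'⟩, _, hk, ?_, ?_⟩
    · have h4 : localProdRep ℓ K N σ (d - diag ℓ N (b - principalIncl ℓ K N k)) -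
          (d - diag ℓ N (b - principalIncl ℓ K N k)) =
          (localProdRep ℓ K N σ d - d - diag ℓ N a) + diag ℓ N e := by
        have h5 : diag ℓ N a = diag ℓ N e + (diag ℓ N (principalMap ℓ K N σ b) - diag ℓ N b) := by
          rw [← map_sub, ← hb, map_sub]
          abel
        rw [h5, map_sub, localProdRep_diag, map_sub, map_sub, map_sub, principalMap_principalIncl]
        abel
      change localProdRep ℓ K N σ (d - diag ℓ N (b - principalIncl ℓ K N k)) -
          (d - diag ℓ N (b - principalIncl ℓ K N k)) ∈ _
      rw [h4]
      exact add_mem hp he'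
    · change (d : LocalProd ℓ N) - (d - diag ℓ N (b - principalIncl ℓ K N k)) -
        diag ℓ N (b - principalIncl ℓ K N k) ∈ _
      rw [sub_sub_cancel, sub_self]
      exact zero_mem _

omit hσ in
-- Summing `σ d - d - a` over the group kills `σ d - d` and leaves minus the norm of `a`, still a
-- unit idele of `N`.
theorem principalNorm_mem_of_mem_linkedPairs
    {p : idelesAway ℓ (placesAbove N T) × infinitesimal ℓ (placesAbove N T)}
    (hp : p ∈ linkedPairs ℓ σ S T) : principalNorm ℓ K N p.2 ∈ unitsThatAreNorms ℓ N S T := by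
  refine ⟨principalNorm_mem_unitsST p.2.2 ?_, _, rfl⟩
  have h1 : ∑ τ, localProdRep ℓ K N τ (localProdRep ℓ K N σ p.1 - p.1 - diag ℓ N p.2) =
      -diag ℓ N (principalIncl ℓ K N (principalNorm ℓ K N p.2)) := by
    rw [← sum_localProdRep_diag, ← zero_sub, ← sum_localProdRep_sub σ (p.1 : LocalProd ℓ N),
      ← Finset.sum_sub_distrib]
    exact Finset.sum_congr rfl fun τ _ => map_sub _ _ _
  rw [← neg_mem_iff, ← h1]
  exact sum_mem fun τ _ => idelesUnit_le_comap ℓ S T τ hp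

/-- Every `S`-unit that is a norm is the norm of the second component of a linked pair. -/
theorem exists_linkedPair_of_mem_unitsThatAreNorms (hT : T.Finite) {m : ℕ}
    (hm : Fintype.card (N ≃ₐ[K] N) = ℓ ^ m) {x : Principal ℓ K}
    (hx : x ∈ unitsThatAreNorms ℓ N S T) :
    ∃ p ∈ linkedPairs ℓ σ S T, principalNorm ℓ K N p.2 = x := by
  obtain ⟨hxE, y, rfl⟩ := hx
  have hU := diag_principalIncl_mem_idelesUnit (N := N) hxE
  -- An arbitrary `y` of the given norm need not be trivial at `T`; it is corrected there without
  -- changing its norm.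
  obtain ⟨c, hc⟩ := exists_sub_principalMap_mem hσ hT hm y hU.1
  have hnorm : principalNorm ℓ K N (y - (principalMap ℓ K N σ c - c)) = principalNorm ℓ K N y := by
    rw [map_sub, map_sub, principalNorm_principalMap, sub_self, sub_zero]
  obtain ⟨d, hd, hdU⟩ := exists_sub_mem_idelesUnit hσ hm (S := S) (T := T) hc (by
    rw [sum_localProdRep_diag, hnorm]
    exact hU)
  refine ⟨⟨⟨d, hd⟩, ⟨_, hc⟩⟩, ?_, hnorm⟩
  rw [mem_linkedPairs_iff, ← neg_mem_iff, neg_sub]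
  exact hdU

end Maps

end Comparison

end LadicClass

theorem mainTheorem7 (ℓ : ℕ) [Fact ℓ.Prime]
    (K N : Type*) [Field K] [NumberField K] [Field N] [NumberField N] [Algebra K N]
    [IsGalois K N] [IsCyclic (N ≃ₐ[K] N)] (hdeg : ∃ n : ℕ, Module.finrank K N = ℓ ^ n)
    (S T : Set (LadicClass.Place K)) (hS : S.Finite) (hT : T.Finite) (hST : Disjoint S T) :
    Nonempty
      ((↥(LadicClass.ambiguousClasses ℓ N S T) ⧸
          (LadicClass.classesOfAmbiguousDivisors ℓ N S T).submoduleOf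
            (LadicClass.ambiguousClasses ℓ N S T)) ≃ₗ[ℤ_[ℓ]]
        (↥(LadicClass.unitsThatAreNorms ℓ N S T) ⧸
          (LadicClass.normsOfUnits ℓ N S T).submoduleOf
            (LadicClass.unitsThatAreNorms ℓ N S T))) := by
  open LadicClass in
  obtain ⟨σ, hσ⟩ := IsCyclic.exists_generator (α := N ≃ₐ[K] N)
  obtain ⟨m, hm⟩ := hdeg
  rw [← IsGalois.card_aut_eq_finrank, Nat.card_eq_fintype_card] at hm
  refine nonempty_subquotient_linearEquiv (linkedPairs ℓ σ S T)
    ((classOf ℓ N S T).comp (LinearMap.fst _ _ _))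
    ((principalNorm ℓ K N).comp ((Submodule.subtype _).comp (LinearMap.snd _ _ _))) _ _ _ _
    (fun p hp => (classOf_mem_ambiguousClasses_iff hσ _).2 ⟨p.2, p.2.2, hp⟩)
    (fun p hp => principalNorm_mem_of_mem_linkedPairs hp) (fun c hc => ?_)
    (fun x hx => exists_linkedPair_of_mem_unitsThatAreNorms hσ hT hm hx)
    (fun p hp => classOf_mem_classesOfAmbiguousDivisors_iff_norm hσ hT hp)
  obtain ⟨d, rfl⟩ := classOf_surjective S T c
  obtain ⟨a, ha, h⟩ := (classOf_mem_ambiguousClasses_iff hσ d).1 hc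
  exact ⟨⟨d, ⟨a, ha⟩⟩, h, rfl⟩
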